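/- Let $k=\mathbb{C}(\beta)$, let $\Lambda$ be the $k$-algebra of symmetric functions in $x_1,x_2,\dots$, let $M_n\subset\Lambda$ be the $k$-span of the Schur functions $s_\mu$ with $\ell(\mu)\ge n$, and let $\widehat{\Lambda}=\varprojlim_n \Lambda/M_n$. Setting $x_{n+1}=x_{n+2}=\cdots=0$ kills $M_{n+1}$, so every $F\in\widehat{\Lambda}$ has a specialization $F(x_1,\dots,x_n):=F(x_1,\dots,x_n,0,0,\dots)$. Let $\psi_n,\psi_n^*$ ($n\in\mathbb{Z}$) be free fermions, $[\psi_m,\psi_n]_+=[\psi^*_m,\psi^*_n]_+=0$, $[\psi_m,\psi_n^*]_+=\delta_{m,n}$, acting on the fermionic Fock space (the infinite wedge space) with vacuum $|0\rangle=v_{-1}\wedge v_{-2}\wedge\cdots$, where $\psi_m|0\rangle=\psi^*_n|0\rangle=0$ for $m<0\le n$; let $|-\ell\rangle=\psi^*_{-\ell}\cdots\psi^*_{-1}|0\rangle$, and let $\langle 0|v\rangle$ denote the coefficient of $|0\rangle$ in $v$. Put $a_m=\sum_{j\in\mathbb{Z}}{:}\psi_j\psi^*_{j+m}{:}$ (normal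 ordering), $\Theta=\sum_{m\ge1}\frac{(-1)^{m-1}\beta^m}{m}a_{-m}$, and $H(x_1,\dots,x_n)=\sum_{m\ge 1}\frac{p_m(x_1,\dots,x_n)}{m}a_m$, where $p_m$ is the $m$-th power sum. Let $\lambda=(\lambda_1\ge\dots\ge\lambda_\ell>0)$ be a partition of length $\ell\ge0$, with $\lambda_j=0$ for $j>\ell$. (a) There is a unique element $G_\lambda(x)\in\widehat{\Lambda}$, the stable ($\beta$-)Grothendieck polynomial, such that for all $n\ge\ell$ $$G_\lambda(x_1,\dots,x_n)=\frac{\det\bigl(x_i^{\lambda_j+n-j}(1+\beta x_i)^{j-1}\bigr)_{1\le i,j\le n}}{\prod_{1\le i<j\le n}(x_i-x_j)}.$$ (b) There is a unique element of $\widehat{\Lambda}$, denoted $\langle 0|e^{H(x)}\psi_{\lambda_1-1}e^{\Theta}\cdots\psi_{\lambda_\ell-\ell}e^{\Theta}|-\ell\rangle$, whose specialization to $x_1,\dots,x_n$ is, for every $n\ge0$, the vacuum expectation value $\langle 0|e^{H(x_1,\dots,x_n)}\psi_{\lambda_1-1}e^{\Theta}\cdots\psi_{\lambda_\ell-\ell}e^{\Theta}|-\ell\rangle\in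 k[[x_1,\dots,x_n]]$ (which is, in particular, a polynomial). (c) These two elements of $\widehat{\Lambda}$ are equal: $$G_\lambda(x)=\langle 0|\,e^{H(x)}\,\psi_{\lambda_1-1}e^{\Theta}\,\psi_{\lambda_2-2}e^{\Theta}\cdots\psi_{\lambda_\ell-\ell}e^{\Theta}\,|-\ell\rangle .$$ -/

import Mathlib

namespace StableGrothendieck

noncomputable section

section SymmetricFunctions

variable (k : Type*) [Field k]

/-- The `k`-algebra `Λ` of symmetric functions in `x₀, x₁, x₂, …`: formal power series of bounded
degree that are invariant under all permutations of the variables. -/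
def SymFun : Subalgebra k (MvPowerSeries ℕ k) where
  carrier := {f | (∀ s : Equiv.Perm ℕ, MvPowerSeries.rename s f = f) ∧
    ∃ D : ℕ, ∀ d : ℕ →₀ ℕ, D < d.degree → MvPowerSeries.coeff d f = 0}
  mul_mem' := by
    rintro f g ⟨hf, D, hD⟩ ⟨hg, E, hE⟩
    refine ⟨fun s => by rw [map_mul, hf s, hg s], D + E, fun d hd => ?_⟩
    classical
    rw [MvPowerSeries.coeff_mul]
    refine Finset.sum_eq_zero fun p hp => ?_
    have h : p.1.degree + p.2.degree = d.degree := by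
      rw [← map_add, Finset.HasAntidiagonal.mem_antidiagonal.mp hp]
    rcases Nat.lt_or_ge D p.1.degree with h1 | h1
    · rw [hD _ h1, zero_mul]
    · rw [hE _ (by omega), mul_zero]
  add_mem' := by
    rintro f g ⟨hf, D, hD⟩ ⟨hg, E, hE⟩
    refine ⟨fun s => by rw [map_add, hf s, hg s], D + E, fun d hd => ?_⟩
    rw [map_add, hD d (by omega), hE d (by omega), add_zero]
  algebraMap_mem' := by
    intro r
    refine ⟨fun s => AlgHom.commutes _ r, 0, fun d hd => ?_⟩
    classical
    rw [MvPowerSeries.algebraMap_apply, Algebra.algebraMap_self, RingHom.id_apply,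
      MvPowerSeries.coeff_C, if_neg]
    rintro rfl
    simp at hd

variable {k}

/-- The complete symmetric series of degree `m` (the sum of all monomials of degree `m`) in the
variables indexed by `σ`; it is `0` for `m < 0`. -/
def completeSeries (k : Type*) [Field k] (σ : Type*) (m : ℤ) : MvPowerSeries σ k :=
  fun d => if (d.degree : ℤ) = m then 1 else 0

theorem coeff_completeSeries {σ : Type*} (m : ℤ) (d : σ →₀ ℕ) :
    MvPowerSeries.coeff d (completeSeries k σ m) = if (d.degree : ℤ) = m then 1 else 0 := rfl

/-- The complete symmetric function `h_m ∈ Λ`, with `h_m = 0` for `m < 0`. -/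
def completeSym (k : Type*) [Field k] (m : ℤ) : SymFun k :=
  ⟨completeSeries k ℕ m, by
    constructor
    · intro s
      ext d
      have hd : d = Finsupp.embDomain s.toEmbedding
          (Finsupp.embDomain s.symm.toEmbedding d) := by
        rw [Finsupp.embDomain_eq_mapDomain, Finsupp.embDomain_eq_mapDomain,
          ← Finsupp.mapDomain_comp]
        simp
      have h1 := MvPowerSeries.coeff_embDomain_rename s.toEmbedding (completeSeries k ℕ m)
        (Finsupp.embDomain s.symm.toEmbedding d)
      rw [← hd] at h1
      refine h1.trans ?_
      rw [coeff_completeSeries, coeff_completeSeries, Finsupp.embDomain_eq_mapDomain,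
        Finsupp.degree_mapDomain]
    · refine ⟨m.toNat, fun d hd => ?_⟩
      rw [coeff_completeSeries, if_neg]
      omega⟩

/-- The Schur function `s_μ = det (h_{μ_i - i + j})_{1 ≤ i, j ≤ ℓ(μ)} ∈ Λ`. A partition is a Young
diagram `μ`: its parts are `μ.rowLen 0 ≥ μ.rowLen 1 ≥ …` and its length is `μ.colLen 0`. -/
def schur (k : Type*) [Field k] (μ : YoungDiagram) : SymFun k :=
  Matrix.det (Matrix.of fun i j : Fin (μ.colLen 0) =>
    completeSym k ((μ.rowLen i : ℤ) - (i : ℤ) + (j : ℤ)))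

/-- The subspace `M_n ⊆ Λ` spanned by the Schur functions of partitions of length at least `n`. -/
def lengthFiltration (k : Type*) [Field k] (n : ℕ) : Submodule k (SymFun k) :=
  Submodule.span k {f | ∃ μ : YoungDiagram, n ≤ μ.colLen 0 ∧ f = schur k μ}

theorem lengthFiltration_succ_le (n : ℕ) :
    lengthFiltration k (n + 1) ≤ lengthFiltration k n := by
  refine Submodule.span_mono ?_
  rintro f ⟨μ, h, rfl⟩
  exact ⟨μ, by omega, rfl⟩

/-- The quotient `Λ / M_n`. -/
abbrev SymFunQuot (k : Type*) [Field k] (n : ℕ) : Type _ := SymFun k ⧸ lengthFiltration k n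

/-- The projection `Λ / M_{n+1} → Λ / M_n`. -/
def transition (k : Type*) [Field k] (n : ℕ) : SymFunQuot k (n + 1) →ₗ[k] SymFunQuot k n :=
  Submodule.factor (lengthFiltration_succ_le n)

/-- The completion `Λ̂`, the inverse limit of the quotients `Λ / M_n`. (The extra term for `n = 0`
is `Λ / M_0 = 0`.) -/
def SymFunHat (k : Type*) [Field k] : Submodule k (∀ n : ℕ, SymFunQuot k n) where
  carrier := {F | ∀ n, transition k n (F (n + 1)) = F n}
  zero_mem' := fun n => (transition k n).map_zero
  add_mem' := fun {F G} hF hG n =>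
    ((transition k n).map_add (F (n + 1)) (G (n + 1))).trans (congrArg₂ _ (hF n) (hG n))
  smul_mem' := fun c F hF n =>
    ((transition k n).map_smul c (F (n + 1))).trans (congrArg _ (hF n))

/-- The specialization `f(x₀, x₁, …) ↦ f(x₀, …, x_{n-1}, 0, 0, …)` on `Λ`. -/
def specialize (k : Type*) [Field k] (n : ℕ) : SymFun k →ₐ[k] MvPowerSeries (Fin n) k :=
  (MvPowerSeries.killCompl Fin.valEmbedding).comp (SymFun k).val

theorem specialize_completeSym (n : ℕ) (m : ℤ) :
    specialize k n (completeSym k m) = completeSeries k (Fin n) m := by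
  ext d
  change MvPowerSeries.coeff d (MvPowerSeries.killCompl Fin.valEmbedding (completeSeries k ℕ m)) = _
  rw [MvPowerSeries.coeff_killCompl, coeff_completeSeries, coeff_completeSeries,
    Finsupp.embDomain_eq_mapDomain, Finsupp.degree_mapDomain]

/-- In `n` variables, `∑_A (-1)^|A| x^A h_{m-|A|} = 0` for `m > 0`, the sum being over all sets `A`
of variables. -/
theorem sum_completeSeries_eq_zero (n : ℕ) (m : ℤ) (hm : 0 < m) :
    ∑ A : Finset (Fin n), MvPowerSeries.monomial (Finsupp.indicator A fun _ _ => 1)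
      ((-1 : k) ^ A.card) * completeSeries k (Fin n) (m - A.card) = 0 := by
  classical
  ext d
  rw [map_sum, map_zero]
  have key : ∀ A : Finset (Fin n),
      MvPowerSeries.coeff d (MvPowerSeries.monomial (Finsupp.indicator A fun _ _ => 1)
        ((-1 : k) ^ A.card) * completeSeries k (Fin n) (m - A.card)) =
      if A ⊆ d.support then (if (d.degree : ℤ) = m then (-1 : k) ^ A.card else 0) else 0 := by
    intro A
    rw [MvPowerSeries.coeff_monomial_mul]
    have hle : (Finsupp.indicator A fun _ _ => 1) ≤ d ↔ A ⊆ d.support := by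
      constructor
      · intro h i hi
        have := h i
        rw [Finsupp.indicator_of_mem hi] at this
        simp only [Finsupp.mem_support_iff]
        omega
      · intro h i
        by_cases hi : i ∈ A
        · rw [Finsupp.indicator_of_mem hi]
          have := Finsupp.mem_support_iff.mp (h hi)
          omega
        · rw [Finsupp.indicator_of_notMem hi]
          exact Nat.zero_le _
    by_cases h : A ⊆ d.support
    · rw [if_pos (hle.mpr h), if_pos h, coeff_completeSeries]
      have hdeg : (Finsupp.indicator A fun _ _ => 1).degree = A.card := by
        rw [Finsupp.degree_eq_sum, ← Finset.sum_subset (Finset.subset_univ A)]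
        · rw [Finset.card_eq_sum_ones]
          exact Finset.sum_congr rfl fun i hi => Finsupp.indicator_of_mem hi _
        · intro i _ hi
          exact Finsupp.indicator_of_notMem hi _
      have hsum := congrArg Finsupp.degree (tsub_add_cancel_of_le (hle.mpr h))
      rw [map_add, hdeg] at hsum
      by_cases hd : (d.degree : ℤ) = m
      · rw [if_pos hd, if_pos (by omega), mul_one]
      · rw [if_neg hd, if_neg (by omega), mul_zero]
    · rw [if_neg (fun h' => h (hle.mp h')), if_neg h]
  rw [Finset.sum_congr rfl fun A _ => key A]
  by_cases hd : (d.degree : ℤ) = m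
  · simp only [if_pos hd]
    rw [← Finset.sum_filter]
    have hfil : (Finset.univ.filter fun A : Finset (Fin n) => A ⊆ d.support) =
        d.support.powerset := by
      ext A
      simp
    have hne : d.support.Nonempty := by
      rw [Finsupp.support_nonempty_iff]
      rintro rfl
      simp at hd
      omega
    rw [hfil]
    exact_mod_cast congrArg (Int.cast : ℤ → k)
      (Finset.sum_powerset_neg_one_pow_card_of_nonempty hne)
  · simp only [if_neg hd, ite_self, Finset.sum_const_zero]

/-- A Schur function of length greater than `n` vanishes in `n` variables. -/
theorem specialize_schur_eq_zero (n : ℕ) (μ : YoungDiagram) (h : n + 1 ≤ μ.colLen 0) :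
    specialize k n (schur k μ) = 0 := by
  classical
  have : IsDomain (MvPowerSeries (Fin n) k) := NoZeroDivisors.to_isDomain _
  rw [schur, AlgHom.map_det]
  rw [← Matrix.exists_mulVec_eq_zero_iff]
  refine ⟨fun j => ∑ A : Finset (Fin n), if (j : ℕ) + A.card + 1 = μ.colLen 0 then
    MvPowerSeries.monomial (Finsupp.indicator A fun _ _ => 1) ((-1 : k) ^ A.card) else 0, ?_, ?_⟩
  · intro h0
    have h1 := congrFun h0 ⟨μ.colLen 0 - 1, by omega⟩
    rw [Finset.sum_eq_single ∅] at h1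
    · rw [if_pos (by simp; omega)] at h1
      have h2 := congrArg (MvPowerSeries.coeff (Finsupp.indicator ∅ fun _ _ => 1)) h1
      rw [MvPowerSeries.coeff_monomial_same] at h2
      simp at h2
    · intro A _ hA
      have := Finset.card_pos.mpr (Finset.nonempty_iff_ne_empty.mpr hA)
      rw [if_neg (by simp; omega)]
    · simp
  · funext i
    simp only [Matrix.mulVec, dotProduct, AlgHom.mapMatrix_apply, Matrix.map_apply,
      Matrix.of_apply, specialize_completeSym, Finset.mul_sum, Pi.zero_apply]
    rw [Finset.sum_comm]
    have hpos : 0 < μ.rowLen i :=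
      YoungDiagram.mem_iff_lt_rowLen.mp (YoungDiagram.mem_iff_lt_colLen.mpr i.2)
    have hi := i.2
    refine Eq.trans ?_ (sum_completeSeries_eq_zero (k := k) n
      ((μ.rowLen i : ℤ) - (i : ℕ) + ((μ.colLen 0 : ℤ) - 1)) (by omega))
    refine Finset.sum_congr rfl fun A _ => ?_
    have hA : A.card ≤ n := by simpa using Finset.card_le_univ A
    rw [Finset.sum_eq_single ⟨μ.colLen 0 - 1 - A.card, by omega⟩]
    · rw [if_pos (by simp; omega), mul_comm]
      congr 2
      simp
      omega
    · intro j _ hj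
      rw [if_neg, mul_zero]
      intro h'
      apply hj
      ext
      simp
      omega
    · simp

/-- The specialization `F ↦ F(x₀, …, x_{n-1}, 0, 0, …)` on `Λ̂`; it factors through
`Λ / M_{n+1}`, since `M_{n+1}` is killed by it. -/
def specializeHat (k : Type*) [Field k] (n : ℕ) : SymFunHat k →ₗ[k] MvPowerSeries (Fin n) k :=
  (Submodule.liftQ (lengthFiltration k (n + 1)) (specialize k n).toLinearMap (by
    rw [lengthFiltration, Submodule.span_le]
    rintro f ⟨μ, h, rfl⟩
    exact specialize_schur_eq_zero n μ h)) ∘ₗ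
  LinearMap.proj (n + 1) ∘ₗ (SymFunHat k).subtype

end SymmetricFunctions

section Grothendieck

variable {k : Type*} [Field k]

/-- The numerator `det (x_i^{μ_j + n - j} (1 + β x_i)^{j-1})_{1 ≤ i, j ≤ n}`, with `i`, `j` counted
from `0`. -/
def grothendieckNumerator (β : k) (μ : YoungDiagram) (n : ℕ) : MvPolynomial (Fin n) k :=
  Matrix.det (Matrix.of fun i j : Fin n =>
    MvPolynomial.X i ^ (μ.rowLen j + (n - 1 - (j : ℕ))) *
      (1 + MvPolynomial.C β * MvPolynomial.X i) ^ (j : ℕ))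

/-- The denominator `∏_{i < j} (x_i - x_j)`. -/
def vandermonde (k : Type*) [Field k] (n : ℕ) : MvPolynomial (Fin n) k :=
  ∏ i : Fin n, ∏ j ∈ Finset.Ioi i, (MvPolynomial.X i - MvPolynomial.X j)

/-- `g` is the Grothendieck polynomial `G_μ(x_1, …, x_n)`, the quotient of the two alternants. -/
def IsGrothendieckPolynomial (β : k) (μ : YoungDiagram) (n : ℕ) (g : MvPolynomial (Fin n) k) :
    Prop :=
  g * vandermonde k n = grothendieckNumerator β μ n

/-- `F ∈ Λ̂` is a stable Grothendieck polynomial of `μ`: for all `n ≥ ℓ(μ)`,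
`F(x_1, …, x_n, 0, 0, …) = G_μ(x_1, …, x_n)`. -/
def IsStableGrothendieck (β : k) (μ : YoungDiagram) (F : SymFunHat k) : Prop :=
  ∀ n : ℕ, μ.colLen 0 ≤ n → ∃ g : MvPolynomial (Fin n) k,
    IsGrothendieckPolynomial β μ n g ∧ specializeHat k n F = (g : MvPowerSeries (Fin n) k)

end Grothendieck

section Fermions

/-- The index set of the standard basis `v_{i_1} ∧ v_{i_2} ∧ ⋯` (`i_1 > i_2 > ⋯`) of the fermionic
Fock space (all charges): the sets `S = {i_1, i_2, …}` of integers that differ from the set of all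
negative integers by finitely many elements. -/
def Maya : Type :=
  {S : Set ℤ // {n | n ∈ S ∧ 0 ≤ n}.Finite ∧ {n | n ∉ S ∧ n < 0}.Finite}

/-- `S ∪ {n}`. -/
def Maya.insert (n : ℤ) (S : Maya) : Maya :=
  ⟨S.1 ∪ {n}, (S.2.1.union (Set.finite_singleton n)).subset (by
      rintro m ⟨hm | hm, h0⟩
      · exact Or.inl ⟨hm, h0⟩
      · exact Or.inr hm),
    S.2.2.subset (by
      rintro m ⟨hm, h0⟩
      exact ⟨fun h => hm (Or.inl h), h0⟩)⟩

/-- `S \ {n}`. -/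
def Maya.erase (n : ℤ) (S : Maya) : Maya :=
  ⟨S.1 \ {n}, S.2.1.subset (by
      rintro m ⟨hm, h0⟩
      exact ⟨hm.1, h0⟩),
    (S.2.2.union (Set.finite_singleton n)).subset (by
      rintro m ⟨hm, h0⟩
      by_cases h : m = n
      · exact Or.inr h
      · exact Or.inl ⟨fun h' => hm ⟨h', h⟩, h0⟩)⟩

/-- The set of all negative integers, i.e. `v_{-1} ∧ v_{-2} ∧ ⋯`. -/
def Maya.vacuum : Maya :=
  ⟨{n | n < 0}, Set.finite_empty.subset fun _ h => absurd h.1 (not_lt.mpr h.2),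
    Set.finite_empty.subset fun _ h => absurd h.2 h.1⟩

/-- The sign that occurs when `v_n` is moved to or from its place in `v_{i_1} ∧ v_{i_2} ∧ ⋯`. -/
def Maya.sign (n : ℤ) (S : Maya) : ℤ :=
  (-1) ^ {m | m ∈ S.1 ∧ n < m}.ncard

variable {k : Type*} [Field k] {σ : Type*}

/-- The Fock space over `k[[x_i : i ∈ σ]]`, completed so as to allow infinite linear combinations:
`v` stands for the formal sum `∑_S v(S) · S`, where `S` runs over the basis of the Fock space. -/
abbrev Fock (k : Type*) [Field k] (σ : Type*) : Type _ := Maya → MvPowerSeries σ k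

open Classical in
/-- `ψ_n`, that is, `v_{i_1} ∧ v_{i_2} ∧ ⋯ ↦ v_n ∧ v_{i_1} ∧ v_{i_2} ∧ ⋯`, in coordinates. -/
def psi (n : ℤ) (v : Fock k σ) : Fock k σ := fun S =>
  if n ∈ S.1 then Maya.sign n S • v (S.erase n) else 0

open Classical in
/-- `ψ*_n`, the contraction with `v_n`, in coordinates. -/
def psiStar (n : ℤ) (v : Fock k σ) : Fock k σ := fun S =>
  if n ∈ S.1 then 0 else Maya.sign n S • v (S.insert n)

/-- The normally ordered product `:ψ_m ψ*_n:`, in which the annihilation operators (`ψ_m` for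
`m < 0` and `ψ*_n` for `n ≥ 0`) stand to the right. -/
def normalOrdered (m n : ℤ) (v : Fock k σ) : Fock k σ :=
  if m < 0 ∧ n < 0 then - psiStar n (psi m v) else psi m (psiStar n v)

/-- The formal sum of a family of vectors, computed coefficient by coefficient. In all the uses
below each coefficient receives only finitely many nonzero contributions. -/
def formalSum {ι : Type*} (u : ι → Fock k σ) : Fock k σ := fun S d =>
  ∑ᶠ i, MvPowerSeries.coeff d (u i S)

/-- The current `a_m = ∑_{j ∈ ℤ} :ψ_j ψ*_{j+m}:`. -/
def current (m : ℤ) (v : Fock k σ) : Fock k σ :=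
  formalSum fun j : ℤ => normalOrdered j (j + m) v

/-- The exponential `e^A = ∑_j A^j / j!`. -/
def expOp (A : Fock k σ → Fock k σ) (v : Fock k σ) : Fock k σ :=
  formalSum fun j : ℕ => ((j.factorial : k)⁻¹) • A^[j] v

/-- `Θ = ∑_{m ≥ 1} (-1)^{m-1} (β^m / m) a_{-m}`. -/
def Theta (β : k) (v : Fock k σ) : Fock k σ :=
  formalSum fun m : ℕ+ =>
    ((-1) ^ ((m : ℕ) - 1) * β ^ (m : ℕ) / (m : ℕ) : k) • current (-((m : ℕ) : ℤ)) v

/-- `H(x_1, …, x_n) = ∑_{m ≥ 1} (p_m(x_1, …, x_n) / m) a_m`, where `p_m` is the `m`-th power sum. -/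
def Hamiltonian {n : ℕ} (v : Fock k (Fin n)) : Fock k (Fin n) :=
  formalSum fun m : ℕ+ =>
    (((m : ℕ) : k)⁻¹ • ∑ i : Fin n, (MvPowerSeries.X i : MvPowerSeries (Fin n) k) ^ (m : ℕ)) •
      current ((m : ℕ) : ℤ) v

open Classical in
/-- The shifted vacuum `|-l⟩ = ψ*_{-l} ⋯ ψ*_{-2} ψ*_{-1} |0⟩`. -/
def ketNeg : ℕ → Fock k σ
  | 0 => fun S => if S = Maya.vacuum then 1 else 0
  | l + 1 => psiStar (-((l : ℤ) + 1)) (ketNeg l)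

/-- The pairing `⟨0|v⟩` of a vector with the dual vacuum. -/
def vacuumPairing (v : Fock k σ) : MvPowerSeries σ k := v Maya.vacuum

/-- The vacuum expectation value
`⟨0| e^{H(x_1, …, x_n)} ψ_{μ_1 - 1} e^Θ ψ_{μ_2 - 2} e^Θ ⋯ ψ_{μ_ℓ - ℓ} e^Θ |-ℓ⟩`, `ℓ = ℓ(μ)`. -/
def fermionicVEV (β : k) (μ : YoungDiagram) (n : ℕ) : MvPowerSeries (Fin n) k :=
  vacuumPairing (expOp Hamiltonian
    ((List.range (μ.colLen 0)).foldr
      (fun i v => psi ((μ.rowLen i : ℤ) - ((i : ℤ) + 1)) (expOp (Theta β) v))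
      (ketNeg (μ.colLen 0))))

/-- `F` is the element `⟨0| e^{H(x)} ψ_{μ_1 - 1} e^Θ ⋯ ψ_{μ_ℓ - ℓ} e^Θ |-ℓ⟩` of `Λ̂`: for every `n`,
its specialization `F(x_1, …, x_n, 0, 0, …)` is the expectation value with `x_1, …, x_n` as the only
variables. -/
def IsFermionicVEV (β : k) (μ : YoungDiagram) (F : SymFunHat k) : Prop :=
  ∀ n : ℕ, specializeHat k n F = fermionicVEV β μ n

end Fermions

end

end StableGrothendieck

open StableGrothendieck

/-! Work first with n ≥ ℓ variables. The operators act on fermions by conjugation. With T the shift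
of the index by one, ad Θ acts on the ψ_j as log(1 + βT), hence e^Θ ψ_j = (ψ_j + βψ_{j+1}) e^Θ
(`expTheta_psi`); ad H acts on the ψ*_j as log ∏(1 - x_i T), and on the ψ_j with opposite sign and
opposite shift (`expHamiltonian_psiStar`, `expHamiltonian_psi`). All exponentials are infinite sums,
so these identities are proved modulo each step of a filtration, where the operators are nilpotent
(`IsFilteredExp`).

Since ψ_{-N-1} e^Θ |-N-1⟩ = |-N⟩, which uses that β is invertible, the partition may be padded with
zeros to length n (`fermionicKet_eq`). Encode ∑ f_i ψ_{i-n} by the polynomial f. Moving e^Θ to the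
right across a fermion multiplies its polynomial by 1 + βX, and e^Θ |-n⟩ differs from |-n⟩ only in
configurations with a hole below -n (`foldr_fermionField_sub_mem`). In n variables ⟨0|e^H does not
see such configurations, because it annihilates the image of ψ*_b for b < -n
(`vevLin_eq_zero_of_mem_unfilled`).

What remains is ⟨0|e^H ψ(g_1)⋯ψ(g_n)|-n⟩ with g_j = (1 + βX)^{j-1} X^{λ_j+n-j}. It is alternating in
the g_j, vanishes when some g_j is divisible by ∏(X - x_i), and equals 1 on the staircase X^{n-1},
…, X, 1. Alternating n-forms on a free module of rank n are unique up to a scalar, so the value is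
det(g_j(x_i)) divided by the Vandermonde product (`vevForm_mul_vandermonde`): this is G_λ.

To pass to Λ̂, G_λ(x_1, …, x_n) is lifted to a symmetric function by a generalized Jacobi–Trudi
determinant (`grothendieckSym`). Expectation values are compatible with setting variables to zero
(`killCompl_fermionicVEV`), which also covers fewer than ℓ variables. The kernel of specialization
to n variables is exactly M_{n+1} (`mem_lengthFiltration_of_specialize_eq_zero`), so compatible
lifts define an element of Λ̂, and an element is determined by its specializations for large n
(`symFunHat_ext`). -/

namespace StableGrothendieck

noncomputable section

/-! ### Anticommutation relations on the completed Fock space. -/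

section FermionAlgebra

variable {k : Type*} [Field k] {σ : Type*}

theorem Maya.ext {S T : Maya} (h : ∀ j, j ∈ S.1 ↔ j ∈ T.1) : S = T :=
  Subtype.ext (Set.ext h)

@[simp] theorem Maya.mem_erase {n j : ℤ} {S : Maya} : j ∈ (S.erase n).1 ↔ j ∈ S.1 ∧ j ≠ n :=
  Iff.rfl

@[simp] theorem Maya.mem_insert {n j : ℤ} {S : Maya} : j ∈ (S.insert n).1 ↔ j ∈ S.1 ∨ j = n :=
  Iff.rfl

theorem Maya.finite_gt (n : ℤ) (S : Maya) : {m | m ∈ S.1 ∧ n < m}.Finite := by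
  refine (S.2.1.union (Set.finite_Ioo n 0)).subset ?_
  rintro m ⟨hm, hn⟩
  rcases le_or_gt 0 m with h | h
  · exact Or.inl ⟨hm, h⟩
  · exact Or.inr ⟨hn, h⟩

theorem Maya.sign_mul_self (n : ℤ) (S : Maya) : S.sign n * S.sign n = 1 := by
  rw [Maya.sign, ← mul_pow]
  simp

theorem Maya.sign_congr {n : ℤ} {S T : Maya} (h : ∀ j, n < j → (j ∈ S.1 ↔ j ∈ T.1)) :
    S.sign n = T.sign n := by
  rw [Maya.sign, Maya.sign]
  congr 2
  ext j
  exact ⟨fun hj => ⟨(h j hj.2).1 hj.1, hj.2⟩, fun hj => ⟨(h j hj.2).2 hj.1, hj.2⟩⟩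

theorem Maya.sign_insert {m n : ℤ} {S : Maya} (hm : m ∉ S.1) :
    (S.insert m).sign n = if n < m then - S.sign n else S.sign n := by
  split_ifs with h
  · rw [Maya.sign, Maya.sign]
    have : {j | j ∈ (S.insert m).1 ∧ n < j} = Insert.insert m {j | j ∈ S.1 ∧ n < j} := by
      ext j
      simp only [Maya.mem_insert, Set.mem_ofPred_eq, Set.mem_insert_iff]
      constructor
      · rintro ⟨h1 | h1, h2⟩
        · exact Or.inr ⟨h1, h2⟩
        · exact Or.inl h1
      · rintro (h1 | ⟨h1, h2⟩)
        · exact ⟨Or.inr h1, h1 ▸ h⟩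
        · exact ⟨Or.inl h1, h2⟩
    rw [this, Set.ncard_insert_of_notMem (fun h' => hm h'.1) (S.finite_gt n), pow_succ]
    ring
  · refine Maya.sign_congr fun j hj => ?_
    simp only [Maya.mem_insert]
    refine ⟨fun h' => h'.resolve_right (by omega), Or.inl⟩

theorem Maya.insert_erase {m : ℤ} {S : Maya} (hm : m ∈ S.1) : (S.erase m).insert m = S := by
  refine Maya.ext fun j => ?_
  simp only [Maya.mem_insert, Maya.mem_erase]
  by_cases h : j = m
  · simp [h, hm]
  · simp [h]

theorem Maya.erase_insert {m : ℤ} {S : Maya} (hm : m ∉ S.1) : (S.insert m).erase m = S := by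
  refine Maya.ext fun j => ?_
  simp only [Maya.mem_insert, Maya.mem_erase]
  by_cases h : j = m
  · simp [h, hm]
  · simp [h]

theorem Maya.sign_erase {m n : ℤ} {S : Maya} (hm : m ∈ S.1) :
    (S.erase m).sign n = if n < m then - S.sign n else S.sign n := by
  have h := Maya.sign_insert (n := n) (show m ∉ (S.erase m).1 by simp)
  rw [Maya.insert_erase hm] at h
  rw [h]
  split_ifs <;> simp

theorem Maya.erase_comm (m n : ℤ) (S : Maya) : (S.erase m).erase n = (S.erase n).erase m :=
  Maya.ext fun j => by simp only [Maya.mem_erase]; tauto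

theorem Maya.insert_comm (m n : ℤ) (S : Maya) : (S.insert m).insert n = (S.insert n).insert m :=
  Maya.ext fun j => by simp only [Maya.mem_insert]; tauto

theorem Maya.insert_erase_comm {m n : ℤ} (h : m ≠ n) (S : Maya) :
    (S.erase m).insert n = (S.insert n).erase m := by
  refine Maya.ext fun j => ?_
  simp only [Maya.mem_erase, Maya.mem_insert]
  by_cases hj : j = m
  · subst hj; simp [h]
  · simp [hj]

theorem psi_apply_of_mem {n : ℤ} {S : Maya} (h : n ∈ S.1) (v : Fock k σ) :
    psi n v S = S.sign n • v (S.erase n) := if_pos h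

theorem psi_apply_of_notMem {n : ℤ} {S : Maya} (h : n ∉ S.1) (v : Fock k σ) :
    psi n v S = 0 := if_neg h

theorem psiStar_apply_of_mem {n : ℤ} {S : Maya} (h : n ∈ S.1) (v : Fock k σ) :
    psiStar n v S = 0 := if_pos h

theorem psiStar_apply_of_notMem {n : ℤ} {S : Maya} (h : n ∉ S.1) (v : Fock k σ) :
    psiStar n v S = S.sign n • v (S.insert n) := if_neg h

/-- `ψ_n` as a linear map. -/
def psiLin (n : ℤ) : Fock k σ →ₗ[MvPowerSeries σ k] Fock k σ where
  toFun := psi n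
  map_add' v w := by
    funext S
    by_cases h : n ∈ S.1
    · simp only [psi_apply_of_mem h, Pi.add_apply, smul_add]
    · simp only [psi_apply_of_notMem h, Pi.add_apply, add_zero]
  map_smul' r v := by
    funext S
    by_cases h : n ∈ S.1
    · simp only [psi_apply_of_mem h, Pi.smul_apply, RingHom.id_apply]
      rw [smul_comm]
    · simp only [psi_apply_of_notMem h, Pi.smul_apply, smul_zero]

/-- `ψ*_n` as a linear map. -/
def psiStarLin (n : ℤ) : Fock k σ →ₗ[MvPowerSeries σ k] Fock k σ where
  toFun := psiStar n
  map_add' v w := by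
    funext S
    by_cases h : n ∈ S.1
    · simp only [psiStar_apply_of_mem h, Pi.add_apply, add_zero]
    · simp only [psiStar_apply_of_notMem h, Pi.add_apply, smul_add]
  map_smul' r v := by
    funext S
    by_cases h : n ∈ S.1
    · simp only [psiStar_apply_of_mem h, Pi.smul_apply, smul_zero]
    · simp only [psiStar_apply_of_notMem h, Pi.smul_apply, RingHom.id_apply]
      rw [smul_comm]

@[simp] theorem psiLin_apply (n : ℤ) (v : Fock k σ) : psiLin n v = psi n v := rfl

@[simp] theorem psiStarLin_apply (n : ℤ) (v : Fock k σ) : psiStarLin n v = psiStar n v := rfl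

theorem psi_psi_self (n : ℤ) (v : Fock k σ) : psi n (psi n v) = 0 := by
  funext S
  by_cases h : n ∈ S.1
  · rw [psi_apply_of_mem h, psi_apply_of_notMem (by simp), smul_zero, Pi.zero_apply]
  · rw [psi_apply_of_notMem h, Pi.zero_apply]

/-- Both orders remove the same two particles. Only the upper particle is counted in the sign of the
lower one, so exactly one of the four signs flips. -/
theorem psi_psi (m n : ℤ) (v : Fock k σ) : psi m (psi n v) = - psi n (psi m v) := by
  wlog hmn : m < n generalizing m n
  · rcases eq_or_ne m n with rfl | h
    · rw [psi_psi_self, neg_zero]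
    · rw [this n m (by omega), neg_neg]
  funext S
  rw [Pi.neg_apply]
  by_cases hm : m ∈ S.1 <;> by_cases hn : n ∈ S.1
  · rw [psi_apply_of_mem hm, psi_apply_of_mem (Maya.mem_erase.2 ⟨hn, hmn.ne'⟩),
      psi_apply_of_mem hn, psi_apply_of_mem (Maya.mem_erase.2 ⟨hm, hmn.ne⟩),
      Maya.sign_erase hm, Maya.sign_erase hn, if_pos hmn, if_neg hmn.not_gt,
      Maya.erase_comm, smul_smul, smul_smul, ← neg_smul]
    congr 1
    ring
  · rw [psi_apply_of_mem hm, psi_apply_of_notMem (fun h => hn (Maya.mem_erase.1 h).1), psi_apply_of_notMem hn,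
      smul_zero, neg_zero]
  · rw [psi_apply_of_mem hn, psi_apply_of_notMem hm, psi_apply_of_notMem (fun h => hm (Maya.mem_erase.1 h).1),
      smul_zero, neg_zero]
  · rw [psi_apply_of_notMem hn, psi_apply_of_notMem hm, neg_zero]

theorem psiStar_psiStar (m n : ℤ) (v : Fock k σ) :
    psiStar m (psiStar n v) = - psiStar n (psiStar m v) := by
  wlog hmn : m < n generalizing m n
  · rcases eq_or_ne m n with rfl | h
    · have : psiStar m (psiStar m v) = 0 := by
        funext S
        by_cases h : m ∈ S.1
        · rw [psiStar_apply_of_mem h, Pi.zero_apply]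
        · rw [psiStar_apply_of_notMem h, psiStar_apply_of_mem (by simp), smul_zero, Pi.zero_apply]
      rw [this, neg_zero]
    · rw [this n m (by omega), neg_neg]
  funext S
  rw [Pi.neg_apply]
  by_cases hm : m ∈ S.1 <;> by_cases hn : n ∈ S.1
  · rw [psiStar_apply_of_mem hn, psiStar_apply_of_mem hm, neg_zero]
  · rw [psiStar_apply_of_notMem hn, psiStar_apply_of_mem hm, psiStar_apply_of_mem (Or.inl hm),
      smul_zero, neg_zero]
  · rw [psiStar_apply_of_notMem hm, psiStar_apply_of_mem (Or.inl hn), psiStar_apply_of_mem hn,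
      smul_zero, neg_zero]
  · have h1 : n ∉ (S.insert m).1 := by simp [hn, hmn.ne']
    have h2 : m ∉ (S.insert n).1 := by simp [hm, hmn.ne]
    rw [psiStar_apply_of_notMem hm, psiStar_apply_of_notMem h1,
      psiStar_apply_of_notMem hn, psiStar_apply_of_notMem h2,
      Maya.sign_insert hm, Maya.sign_insert hn, if_pos hmn, if_neg hmn.not_gt,
      Maya.insert_comm, smul_smul, smul_smul, ← neg_smul]
    congr 1
    ring

theorem psi_psiStar_of_ne {m n : ℤ} (hmn : m ≠ n) (v : Fock k σ) :
    psi m (psiStar n v) = - psiStar n (psi m v) := by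
  funext S
  rw [Pi.neg_apply]
  by_cases hm : m ∈ S.1 <;> by_cases hn : n ∈ S.1
  · rw [psi_apply_of_mem hm, psiStar_apply_of_mem (Maya.mem_erase.2 ⟨hn, hmn.symm⟩),
      psiStar_apply_of_mem hn, smul_zero, neg_zero]
  · have h1 : n ∉ (S.erase m).1 := by simp [hn]
    rw [psi_apply_of_mem hm, psiStar_apply_of_notMem h1, psiStar_apply_of_notMem hn,
      psi_apply_of_mem (Or.inl hm), Maya.sign_erase hm, Maya.sign_insert hn,
      Maya.insert_erase_comm hmn, smul_smul, smul_smul, ← neg_smul]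
    congr 1
    rcases lt_or_gt_of_ne hmn with h | h
    · rw [if_neg h.not_gt, if_pos h]; ring
    · rw [if_pos h, if_neg h.not_gt]; ring
  · rw [psi_apply_of_notMem hm, psiStar_apply_of_mem hn, neg_zero]
  · have h1 : m ∉ (S.insert n).1 := by simp [hm, hmn]
    rw [psi_apply_of_notMem hm, psiStar_apply_of_notMem hn, psi_apply_of_notMem h1, smul_zero,
      neg_zero]

theorem psi_psiStar_self_apply (n : ℤ) (v : Fock k σ) (S : Maya) [Decidable (n ∈ S.1)] :
    psi n (psiStar n v) S = if n ∈ S.1 then v S else 0 := by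
  split_ifs with h
  · have h1 : n ∉ (S.erase n).1 := by simp
    rw [psi_apply_of_mem h, psiStar_apply_of_notMem h1, Maya.insert_erase h, Maya.sign_erase h,
      if_neg (lt_irrefl n), smul_smul, Maya.sign_mul_self, one_smul]
  · rw [psi_apply_of_notMem h]

theorem psiStar_psi_self_apply (n : ℤ) (v : Fock k σ) (S : Maya) [Decidable (n ∈ S.1)] :
    psiStar n (psi n v) S = if n ∈ S.1 then 0 else v S := by
  split_ifs with h
  · rw [psiStar_apply_of_mem h]
  · rw [psiStar_apply_of_notMem h, psi_apply_of_mem (Or.inr rfl), Maya.erase_insert h,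
      Maya.sign_insert h, if_neg (lt_irrefl n), smul_smul, Maya.sign_mul_self, one_smul]

theorem psi_psiStar_add_psiStar_psi_self (n : ℤ) (v : Fock k σ) :
    psi n (psiStar n v) + psiStar n (psi n v) = v := by
  classical
  funext S
  rw [Pi.add_apply, psi_psiStar_self_apply, psiStar_psi_self_apply]
  split_ifs <;> simp

theorem psi_psiStar (m n : ℤ) (v : Fock k σ) :
    psi m (psiStar n v) + psiStar n (psi m v) = if m = n then v else 0 := by
  split_ifs with h
  · subst h; exact psi_psiStar_add_psiStar_psi_self m v
  · rw [psi_psiStar_of_ne h, neg_add_cancel]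

end FermionAlgebra

/-! ### The currents a_m and their commutators with the fermions. -/

section Currents

variable {k : Type*} [Field k] {σ : Type*}

/-- The particles of `S` that can be moved by `m`. -/
def Maya.movable (m : ℤ) (S : Maya) : Set ℤ := {j | j ∈ S.1 ∧ j + m ∉ S.1}

/-- The configuration obtained from `S` by moving the particle at `j` by `m`. -/
def Maya.move (m j : ℤ) (S : Maya) : Maya := (S.erase j).insert (j + m)

theorem Maya.exists_bounds (S : Maya) : ∃ N : ℕ, (∀ j ∈ S.1, j < N) ∧ ∀ j, j < -(N : ℤ) → j ∈ S.1 := by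
  obtain ⟨a, ha⟩ := S.2.1.bddAbove
  obtain ⟨b, hb⟩ := S.2.2.bddBelow
  refine ⟨a.toNat + b.natAbs + 1, fun j hj => ?_, fun j hj => ?_⟩
  · by_contra h
    have := ha (⟨hj, by omega⟩ : j ∈ {n | n ∈ S.1 ∧ 0 ≤ n})
    omega
  · by_contra h
    have := hb (⟨h, by omega⟩ : j ∈ {n | n ∉ S.1 ∧ n < 0})
    omega

/-- Sites far above are vacant and sites far below are occupied, so a jump by a fixed amount from an
occupied to a vacant site starts in a bounded window. Hence each coordinate of `current m v` is a
finite sum. -/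
theorem Maya.finite_movable {m : ℤ} (S : Maya) : (S.movable m).Finite := by
  obtain ⟨N, h1, h2⟩ := S.exists_bounds
  refine (Set.finite_Ioo (-(N : ℤ) - |m| - 1) N).subset ?_
  rintro j ⟨hj, hjm⟩
  refine ⟨?_, h1 j hj⟩
  by_contra h
  apply hjm
  apply h2
  have := le_abs_self m
  omega

/-- A long jump downwards lands in the filled sea. This makes the sum over m in Θ finite in each
coordinate. -/
theorem Maya.movable_neg_eq_empty (S : Maya) :
    ∃ N : ℕ, ∀ m : ℕ, N < m → S.movable (-(m : ℤ)) = ∅ := by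
  obtain ⟨N, h1, h2⟩ := S.exists_bounds
  refine ⟨2 * N, fun m hm => Set.eq_empty_of_forall_notMem ?_⟩
  rintro j ⟨hj, hjm⟩
  have := h1 j hj
  exact hjm (h2 _ (by omega))

theorem psi_psiStar_apply_eq_zero {m j : ℤ} (hm : m ≠ 0) {S : Maya} (hj : j ∉ S.movable m)
    (v : Fock k σ) : psi j (psiStar (j + m) v) S = 0 := by
  by_cases h : j ∈ S.1
  · rw [psi_apply_of_mem h, psiStar_apply_of_mem, smul_zero]
    rw [Maya.mem_erase]
    refine ⟨not_not.1 fun h' => hj ⟨h, h'⟩, by omega⟩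
  · rw [psi_apply_of_notMem h]

theorem psi_psiStar_apply_of_movable {m j : ℤ} {S : Maya} (hj : j ∈ S.movable m)
    (v : Fock k σ) : psi j (psiStar (j + m) v) S =
      (S.sign j * (S.erase j).sign (j + m)) • v (S.move m j) := by
  rw [psi_apply_of_mem hj.1, psiStar_apply_of_notMem (fun h => hj.2 (Maya.mem_erase.1 h).1), smul_smul]
  rfl

theorem finite_support_psi_psiStar {m : ℤ} (hm : m ≠ 0) (v : Fock k σ) (S : Maya) :
    (Function.support fun j => psi j (psiStar (j + m) v) S).Finite :=
  (S.finite_movable).subset fun j hj => by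
    by_contra h
    exact hj (psi_psiStar_apply_eq_zero hm h v)

/-- For m ≠ 0 the two factors anticommute, so normal ordering changes nothing. -/
theorem normalOrdered_eq {m : ℤ} (hm : m ≠ 0) (j : ℤ) (v : Fock k σ) :
    normalOrdered j (j + m) v = psi j (psiStar (j + m) v) := by
  rw [normalOrdered, psi_psiStar_of_ne (by omega)]
  split_ifs <;> rfl

theorem finsum_coeff {ι : Type*} (u : ι → MvPowerSeries σ k) (hu : (Function.support u).Finite)
    (d : σ →₀ ℕ) : ∑ᶠ i, MvPowerSeries.coeff d (u i) = MvPowerSeries.coeff d (∑ᶠ i, u i) :=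
  ((MvPowerSeries.coeff (R := k) d).toAddMonoidHom.map_finsum hu).symm

theorem formalSum_apply {ι : Type*} (u : ι → Fock k σ) (S : Maya)
    (hu : (Function.support fun i => u i S).Finite) : formalSum u S = ∑ᶠ i, u i S := by
  ext d
  rw [← finsum_coeff _ hu]
  rfl

theorem current_apply {m : ℤ} (hm : m ≠ 0) (v : Fock k σ) (S : Maya) :
    current m v S = ∑ᶠ j, psi j (psiStar (j + m) v) S := by
  simp only [current, normalOrdered_eq hm]
  exact formalSum_apply _ _ (finite_support_psi_psiStar hm v S)

theorem current_apply_eq_zero {m : ℤ} (hm : m ≠ 0) {v : Fock k σ} {S : Maya}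
    (h : ∀ j ∈ S.movable m, v (S.move m j) = 0) : current m v S = 0 := by
  rw [current_apply hm]
  refine finsum_eq_zero_of_forall_eq_zero fun j => ?_
  by_cases hj : j ∈ S.movable m
  · rw [psi_psiStar_apply_of_movable hj, h j hj, smul_zero]
  · exact psi_psiStar_apply_eq_zero hm hj v

/-- The current `a_m`, for `m ≠ 0`, as a linear map. -/
def currentLin (m : ℤ) (hm : m ≠ 0) : Fock k σ →ₗ[MvPowerSeries σ k] Fock k σ where
  toFun := current m
  map_add' v w := by
    funext S
    rw [Pi.add_apply, current_apply hm, current_apply hm, current_apply hm,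
      ← finsum_add_distrib (finite_support_psi_psiStar hm v S) (finite_support_psi_psiStar hm w S)]
    refine finsum_congr fun j => ?_
    exact congrFun ((psiLin j ∘ₗ psiStarLin (j + m)).map_add v w) S
  map_smul' r v := by
    funext S
    rw [Pi.smul_apply, current_apply hm, current_apply hm, RingHom.id_apply,
      smul_finsum' _ (finite_support_psi_psiStar hm v S)]
    refine finsum_congr fun j => ?_
    exact congrFun ((psiLin j ∘ₗ psiStarLin (j + m)).map_smul r v) S

@[simp] theorem currentLin_apply (m : ℤ) (hm : m ≠ 0) (v : Fock k σ) :
    currentLin m hm v = current m v := rfl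

/-- The commutator of ψ_j ψ*_{j+m} with ψ_n is ψ_j if j + m = n and zero otherwise. -/
theorem current_psi {m : ℤ} (hm : m ≠ 0) (n : ℤ) (v : Fock k σ) :
    current m (psi n v) = psi n (current m v) + psi (n - m) v := by
  have key : ∀ j, psi j (psiStar (j + m) (psi n v)) = psi n (psi j (psiStar (j + m) v)) +
      if j = n - m then psi j v else 0 := by
    intro j
    have h1 : psiStar (j + m) (psi n v) = (if n = j + m then v else 0) -
        psi n (psiStar (j + m) v) := by
      rw [← psi_psiStar n (j + m) v]; abel
    rw [h1, ← psiLin_apply j, map_sub, psiLin_apply, psiLin_apply, psi_psi j n, sub_neg_eq_add,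
      add_comm]
    congr 1
    by_cases h : j = n - m
    · rw [if_pos (by omega), if_pos h]
    · rw [if_neg (by omega), if_neg h]
      exact map_zero (psiLin j)
  funext S
  have h2 : (Function.support fun j => psi n (psi j (psiStar (j + m) v)) S).Finite := by
    by_cases hn : n ∈ S.1
    · refine (finite_support_psi_psiStar hm v (S.erase n)).subset fun j hj h0 => hj ?_
      simp only at h0
      simp only [psi_apply_of_mem hn, h0, smul_zero]
    · refine Set.finite_empty.subset fun j hj => hj ?_
      simp only [psi_apply_of_notMem hn]
  have h3 : (Function.support fun j => (if j = n - m then psi j v else 0) S).Finite := by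
    refine (Set.finite_singleton (n - m)).subset fun j hj => ?_
    by_contra h
    exact hj (by simp only [if_neg (Set.mem_singleton_iff.not.1 h), Pi.zero_apply])
  rw [current_apply hm, Pi.add_apply]
  simp only [key, Pi.add_apply]
  rw [finsum_add_distrib h2 h3]
  congr 1
  · by_cases hn : n ∈ S.1
    · simp only [psi_apply_of_mem hn, current_apply hm]
      rw [smul_finsum' _ (finite_support_psi_psiStar hm v (S.erase n))]
    · simp only [psi_apply_of_notMem hn, finsum_zero]
  · rw [finsum_eq_single _ (n - m) fun j hj => by simp only [if_neg hj, Pi.zero_apply]]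
    rw [if_pos rfl]

/-- The commutator of ψ_j ψ*_{j+m} with ψ*_n is -ψ*_{j+m} if j = n and zero otherwise. -/
theorem current_psiStar {m : ℤ} (hm : m ≠ 0) (n : ℤ) (v : Fock k σ) :
    current m (psiStar n v) = psiStar n (current m v) - psiStar (n + m) v := by
  have key : ∀ j, psi j (psiStar (j + m) (psiStar n v)) = psiStar n (psi j (psiStar (j + m) v)) +
      if j = n then - psiStar (j + m) v else 0 := by
    intro j
    have h1 : psi j (psiStar n (psiStar (j + m) v)) =
        (if j = n then psiStar (j + m) v else 0) - psiStar n (psi j (psiStar (j + m) v)) := by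
      rw [← psi_psiStar j n]; abel
    rw [psiStar_psiStar, ← psiLin_apply j, map_neg, psiLin_apply, h1, neg_sub, sub_eq_add_neg]
    congr 1
    split_ifs <;> simp
  funext S
  have h2 : (Function.support fun j => psiStar n (psi j (psiStar (j + m) v)) S).Finite := by
    by_cases hn : n ∈ S.1
    · refine Set.finite_empty.subset fun j hj => hj ?_
      simp only [psiStar_apply_of_mem hn]
    · refine (finite_support_psi_psiStar hm v (S.insert n)).subset fun j hj h0 => hj ?_
      simp only at h0
      simp only [psiStar_apply_of_notMem hn, h0, smul_zero]
  have h3 : (Function.support fun j => (if j = n then - psiStar (j + m) v else 0) S).Finite := by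
    refine (Set.finite_singleton n).subset fun j hj => ?_
    by_contra h
    exact hj (by simp only [if_neg (Set.mem_singleton_iff.not.1 h), Pi.zero_apply])
  rw [current_apply hm, Pi.sub_apply]
  simp only [key, Pi.add_apply]
  rw [finsum_add_distrib h2 h3, sub_eq_add_neg]
  congr 1
  · by_cases hn : n ∈ S.1
    · simp only [psiStar_apply_of_mem hn, finsum_zero]
    · simp only [psiStar_apply_of_notMem hn, current_apply hm]
      rw [smul_finsum' _ (finite_support_psi_psiStar hm v (S.insert n))]
  · rw [finsum_eq_single _ n fun j hj => by simp only [if_neg hj, Pi.zero_apply]]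
    rw [if_pos rfl, Pi.neg_apply]

end Currents

end

end StableGrothendieck

namespace StableGrothendieck

noncomputable section

/-! ### Exponentials of nilpotent elements and truncated logarithms. -/

section Exponentials

open Polynomial

/-- If `ad A` acts on the image of `χ` as multiplication by `c`, then conjugation by `exp A` acts as
multiplication by `exp c`. -/
theorem exp_mul_of_commutator {E S : Type*} [Ring E] [Algebra ℚ E] [CommRing S] {A : E}
    (hA : IsNilpotent A) (c : S) (χ : S →+ E) (h : ∀ f, A * χ f - χ f * A = χ (c * f)) :
    ∃ P₀, ∀ P, P₀ ≤ P → IsNilpotent.exp A * χ 1 =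
      (∑ i ∈ Finset.range P, (i.factorial : ℚ)⁻¹ • χ (c ^ i)) * IsNilpotent.exp A := by
  -- Left multiplication by A is right multiplication plus ad A. The two commute and are nilpotent,
  -- so exp L = exp T · exp (L - T); on `χ 1` the powers of ad A are the `χ (c ^ i)`.
  set L := LinearMap.mulLeft ℚ A with hL
  set T := LinearMap.mulRight ℚ A with hT
  have hLT : Commute L T := LinearMap.commute_mulLeft_right (R := ℚ) A A
  have hLn : IsNilpotent L := (LinearMap.isNilpotent_mulLeft_iff ℚ A).2 hA
  have hTn : IsNilpotent T := (LinearMap.isNilpotent_mulRight_iff ℚ A).2 hA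
  have hDn : IsNilpotent (L - T) := hLT.isNilpotent_sub hLn hTn
  have hTD : Commute T (L - T) := hLT.symm.sub_right (Commute.refl T)
  have hexpL : ∀ x, IsNilpotent.exp L x = IsNilpotent.exp A * x := by
    intro x
    obtain ⟨p, hp⟩ := hA
    have hp' : L ^ p = 0 := by rw [hL, LinearMap.pow_mulLeft, hp, LinearMap.mulLeft_zero_eq_zero]
    rw [IsNilpotent.exp_eq_sum hp, IsNilpotent.exp_eq_sum hp', LinearMap.sum_apply,
      Finset.sum_mul]
    refine Finset.sum_congr rfl fun i _ => ?_
    rw [LinearMap.smul_apply, hL, LinearMap.pow_mulLeft, LinearMap.mulLeft_apply, smul_mul_assoc]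
  have hexpT : ∀ x, IsNilpotent.exp T x = x * IsNilpotent.exp A := by
    intro x
    obtain ⟨p, hp⟩ := hA
    have hp' : T ^ p = 0 := by rw [hT, LinearMap.pow_mulRight, hp, LinearMap.mulRight_zero_eq_zero]
    rw [IsNilpotent.exp_eq_sum hp, IsNilpotent.exp_eq_sum hp', LinearMap.sum_apply,
      Finset.mul_sum]
    refine Finset.sum_congr rfl fun i _ => ?_
    rw [LinearMap.smul_apply, hT, LinearMap.pow_mulRight, LinearMap.mulRight_apply,
      mul_smul_comm]
  have hpow : ∀ i, ((L - T) ^ i) (χ 1) = χ (c ^ i) := by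
    intro i
    induction i with
    | zero => simp
    | succ i ih =>
      rw [pow_succ', Module.End.mul_apply, ih, LinearMap.sub_apply, hL, hT,
        LinearMap.mulLeft_apply, LinearMap.mulRight_apply, h, pow_succ']
  obtain ⟨P₀, hP₀⟩ := hDn
  refine ⟨P₀, fun P hP => ?_⟩
  have hP' : (L - T) ^ P = 0 := pow_eq_zero_of_le hP hP₀
  have key := IsNilpotent.exp_add_of_commute hTD hTn ⟨P₀, hP₀⟩
  rw [add_sub_cancel] at key
  rw [← hexpL, key, Module.End.mul_apply, hexpT, IsNilpotent.exp_eq_sum hP', LinearMap.sum_apply]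
  simp only [LinearMap.smul_apply, hpow]

variable {S : Type*} [CommRing S]

theorem coeff_pow_mul_eq_zero {c : S[X]} (hc : c.coeff 0 = 0) (d : S[X]) {m i : ℕ} (h : m < i) :
    (d * c ^ i).coeff m = 0 := by
  have h1 : X ^ i ∣ d * c ^ i := (pow_dvd_pow_of_dvd (X_dvd_iff.2 hc) i).mul_left d
  exact X_pow_dvd_iff.1 h1 m h

variable [Algebra ℚ S]

/-- A polynomial that satisfies `E' = c' E` modulo `X ^ (p - 1)` is `exp c` modulo `X ^ p`. -/
theorem coeff_exp_eq {c E : S[X]} {p P : ℕ} (hc : c.coeff 0 = 0) (hE : E.coeff 0 = 1)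
    (h : ∀ m, m + 1 < p → (derivative E).coeff m = (derivative c * E).coeff m) (hP : p ≤ P)
    {m : ℕ} (hm : m < p) :
    (∑ i ∈ Finset.range P, (i.factorial : ℚ)⁻¹ • c ^ i).coeff m = E.coeff m := by
  obtain ⟨Q, rfl⟩ : ∃ Q, P = Q + 1 := ⟨P - 1, by omega⟩
  set F : ℕ → S[X] := fun n => ∑ i ∈ Finset.range n, (i.factorial : ℚ)⁻¹ • c ^ i with hF
  have hder : derivative (F (Q + 1)) = derivative c * F Q := by
    simp only [hF]
    rw [Finset.sum_range_succ', derivative_add, derivative_sum, Finset.mul_sum]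
    have h0 : derivative (((Nat.factorial 0 : ℕ) : ℚ)⁻¹ • c ^ 0) = 0 := by simp
    rw [h0, add_zero]
    refine Finset.sum_congr rfl fun i _ => ?_
    rw [derivative_smul, derivative_pow_succ, mul_smul_comm, Nat.factorial_succ]
    have : ((i : S[X]) + 1) * c ^ i * derivative c = ((i + 1 : ℚ)) • (derivative c * c ^ i) := by
      rw [Algebra.smul_def]
      simp only [map_add, map_natCast, map_one]
      ring
    have h2 : (C ((i : S) + 1) : S[X]) = (i : S[X]) + 1 := by simp
    rw [h2, this, smul_smul]
    congr 1
    push_cast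
    have : (i : ℚ) + 1 ≠ 0 := by positivity
    field_simp
  change (F (Q + 1)).coeff m = E.coeff m
  -- The differential equation determines (m + 1) times the coefficient of X^{m+1} from lower
  -- coefficients, and m + 1 is invertible over ℚ.
  induction m using Nat.strong_induction_on with
  | _ m ih =>
    rcases m with _ | m
    · simp only [hF]
      rw [hE, finsetSum_coeff, Finset.sum_range_succ', Finset.sum_eq_zero]
      · simp
      · intro i _
        rw [coeff_smul, coeff_zero_eq_eval_zero, eval_pow, ← coeff_zero_eq_eval_zero, hc]
        simp
    · have h1 : (derivative (F (Q + 1))).coeff m = (derivative E).coeff m := by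
        rw [h m hm, hder]
        -- Differentiation loses the last term, a multiple of c^Q. As c has no constant term, this
        -- term has no coefficients below degree Q.
        have h3 : F Q = F (Q + 1) - (Q.factorial : ℚ)⁻¹ • c ^ Q := by
          simp only [hF]
          rw [Finset.sum_range_succ, add_sub_cancel_right]
        rw [h3, mul_sub, coeff_sub, mul_smul_comm, coeff_smul,
          coeff_pow_mul_eq_zero hc _ (by omega : m < Q), smul_zero, sub_zero, coeff_mul, coeff_mul]
        refine Finset.sum_congr rfl fun x hx => ?_
        have := Finset.HasAntidiagonal.mem_antidiagonal.1 hx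
        rw [ih x.2 (by omega) (by omega)]
      rw [coeff_derivative, coeff_derivative] at h1
      have h2 : IsUnit ((m : S) + 1) := by
        have := (IsUnit.mk0 ((m : ℚ) + 1) (by positivity)).map (algebraMap ℚ S)
        simpa using this
      exact h2.mul_right_cancel h1

variable {ι : Type*} [Fintype ι]

/-- The polynomial `∏ i, (1 - y_i X)`. -/
def reverseProd (y : ι → S) : S[X] := ∏ i, (1 - C (y i) * X)

/-- The truncation of `log ∏ i, (1 - y_i X)` at degree `p`. -/
def logReverseProd (y : ι → S) (p : ℕ) : S[X] :=
  - ∑ m ∈ Finset.Ico 1 p, C ((m : ℚ)⁻¹ • ∑ i, y i ^ m) * X ^ m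

theorem coeff_logReverseProd (y : ι → S) (p m : ℕ) : (logReverseProd y p).coeff m =
    if m ∈ Finset.Ico 1 p then -((m : ℚ)⁻¹ • ∑ i, y i ^ m) else 0 := by
  simp only [logReverseProd, coeff_neg, finsetSum_coeff, coeff_C_mul_X_pow, Finset.sum_ite_eq]
  split_ifs <;> simp

theorem coeff_exp_logReverseProd (y : ι → S) {p P m : ℕ} (hP : p ≤ P) (hm : m < p) :
    (∑ i ∈ Finset.range P, (i.factorial : ℚ)⁻¹ • logReverseProd y p ^ i).coeff m =
      (reverseProd y).coeff m := by
  classical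
  refine coeff_exp_eq ?_ ?_ ?_ hP hm
  · rw [coeff_logReverseProd, if_neg (by simp)]
  · rw [reverseProd, coeff_zero_eq_eval_zero, eval_prod]
    simp
  · intro q hq
    have hderc : derivative (logReverseProd y p) =
        - ∑ i, C (y i) * ∑ m ∈ Finset.range (p - 1), (C (y i) * X) ^ m := by
      have h1 : derivative (logReverseProd y p) =
          - ∑ m ∈ Finset.range (p - 1), ∑ i, C (y i) * (C (y i) * X) ^ m := by
        rw [logReverseProd, derivative_neg, derivative_sum, Finset.sum_Ico_eq_sum_range]
        congr 1
        refine Finset.sum_congr rfl fun m _ => ?_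
        rw [derivative_C_mul_X_pow, add_comm 1 m, Nat.add_sub_cancel, smul_mul_assoc,
          Finset.sum_mul, Finset.smul_sum, map_sum, Finset.sum_mul]
        refine Finset.sum_congr rfl fun i _ => ?_
        have h2 : (((m + 1 : ℕ) : ℚ)⁻¹ • (y i ^ (m + 1) * ((m + 1 : ℕ) : S))) = y i ^ (m + 1) := by
          rw [mul_comm, ← nsmul_eq_mul, ← Nat.cast_smul_eq_nsmul ℚ, smul_smul, inv_mul_cancel₀,
            one_smul]
          positivity
        rw [h2, C_pow]
        ring
      rw [h1, Finset.sum_comm]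
      simp only [Finset.mul_sum]
    have hderE : derivative (reverseProd y) =
        ∑ i, (∏ j ∈ Finset.univ.erase i, (1 - C (y j) * X)) * (- C (y i)) := by
      rw [reverseProd, derivative_prod_finset]
      refine Finset.sum_congr rfl fun i _ => ?_
      simp
    -- By the finite geometric sum, (1 - yX) ∑_{m<p-1} (yX)^m = 1 - (yX)^{p-1}, so the truncation
    -- error is a multiple of X^{p-1}, beyond the coefficients compared.
    have hprod : derivative (logReverseProd y p) * reverseProd y = derivative (reverseProd y) +
        (∑ i, (∏ j ∈ Finset.univ.erase i, (1 - C (y j) * X)) * C (y i) * C (y i) ^ (p - 1)) *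
          X ^ (p - 1) := by
      rw [hderc, hderE, neg_mul, Finset.sum_mul, Finset.sum_mul, ← Finset.sum_neg_distrib,
        ← Finset.sum_add_distrib]
      refine Finset.sum_congr rfl fun i _ => ?_
      rw [reverseProd, ← Finset.mul_prod_erase _ _ (Finset.mem_univ i)]
      have hg := mul_neg_geom_sum (C (y i) * X) (p - 1)
      rw [mul_pow] at hg
      linear_combination (-(C (y i)) * ∏ j ∈ Finset.univ.erase i, (1 - C (y j) * X)) * hg
    rw [hprod, coeff_add, coeff_mul_X_pow', if_neg (by omega), add_zero]

end Exponentials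

end

end StableGrothendieck

namespace StableGrothendieck

noncomputable section

/-! ### Exponentials and conjugation with respect to a filtration. -/

section FilteredExponential

open Polynomial

variable {R : Type*} [CommRing R] {ι : Type*} [Fintype ι]

/-- The Rees algebra records that the i-th coefficient lies in J^i; this is what allows terms of
high degree to be discarded in `exp_mul_family`. -/
theorem reverseProd_mem_reesAlgebra {J : Ideal R} {y : ι → R} (hy : ∀ i, y i ∈ J) :
    reverseProd y ∈ reesAlgebra J := by
  refine prod_mem fun i _ => sub_mem (one_mem _) ?_
  rw [← monomial_one_one_eq_X, C_mul_monomial, mul_one]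
  exact reesAlgebra.monomial_mem.2 (by simpa using hy i)

variable [Algebra ℚ R]

theorem logReverseProd_mem_reesAlgebra {J : Ideal R} {y : ι → R} (hy : ∀ i, y i ∈ J) (p : ℕ) :
    logReverseProd y p ∈ reesAlgebra J := by
  refine (mem_reesAlgebra_iff _ _).2 fun m => ?_
  rw [coeff_logReverseProd]
  split_ifs
  · exact neg_mem (Submodule.smul_of_tower_mem _ _
      (sum_mem fun i _ => Ideal.pow_mem_pow (hy i) m))
  · exact zero_mem _

/-- Conjugation of a family `X_i` by the exponential of an element that acts on it as
`log ∏ (1 - y_i T)`, where `T` is the shift. -/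
theorem exp_mul_family {E : Type*} [Ring E] [Algebra ℚ E] [Algebra R E] [IsScalarTower ℚ R E]
    {A : E} (hA : IsNilpotent A) (Y : ℕ → E) (y : ι → R) {J : Ideal R} (hy : ∀ i, y i ∈ J)
    (p : ℕ)
    (hcomm : ∀ i, A * Y i - Y i * A =
      - ∑ m ∈ Finset.Ico 1 p, ((m : ℚ)⁻¹ • ∑ i, y i ^ m) • Y (i + m))
    (hkill : ∀ i, p ≤ i → ∀ r ∈ J ^ i, r • Y i = 0) :
    IsNilpotent.exp A * Y 0 =
      ((reverseProd y).sum fun i r => r • Y i) * IsNilpotent.exp A := by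
  -- `χ` sends the i-th power of the variable to `Y i`, which turns the shift of the family into
  -- multiplication by the variable and ad A into multiplication by the truncated logarithm.
  set χ : R[X] →ₗ[R] E := Polynomial.lsum fun i => LinearMap.toSpanSingleton R E (Y i) with hχ
  have hχ' : ∀ f : R[X], χ f = f.sum fun i r => r • Y i := fun f => rfl
  have hmon : ∀ i r, χ (monomial i r) = r • Y i := by
    intro i r
    rw [hχ', sum_monomial_index _ _ (zero_smul R _)]
  have hc : ∀ f, A * χ f - χ f * A = χ (logReverseProd y p * f) := by
    intro f
    induction f using Polynomial.induction_on' with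
    | add f g hf hg =>
      rw [mul_add, map_add, map_add, ← hf, ← hg, mul_add, add_mul]
      abel
    | monomial i r =>
      rw [logReverseProd, neg_mul, Finset.sum_mul, map_neg, map_sum, hmon, mul_smul_comm,
        smul_mul_assoc, ← smul_sub, hcomm, smul_neg, Finset.smul_sum]
      congr 1
      refine Finset.sum_congr rfl fun m _ => ?_
      rw [C_mul_X_pow_eq_monomial, monomial_mul_monomial, hmon, smul_smul, mul_comm r, add_comm m]
  obtain ⟨P₀, hP₀⟩ := exp_mul_of_commutator hA (logReverseProd y p) χ.toAddMonoidHom hc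
  have h := hP₀ (max P₀ p) (le_max_left _ _)
  have h1 : χ 1 = Y 0 := by
    rw [← monomial_zero_one, hmon, one_smul]
  simp only [LinearMap.toAddMonoidHom_coe] at h
  rw [h1] at h
  rw [h, ← hχ']
  congr 1
  have h2 : ∑ i ∈ Finset.range (max P₀ p), (i.factorial : ℚ)⁻¹ • χ (logReverseProd y p ^ i) =
      χ (∑ i ∈ Finset.range (max P₀ p), (i.factorial : ℚ)⁻¹ • logReverseProd y p ^ i) := by
    rw [map_sum]
    refine Finset.sum_congr rfl fun i _ => ?_
    rw [map_rat_smul]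
  rw [h2, ← sub_eq_zero, ← map_sub, hχ', Polynomial.sum]
  refine Finset.sum_eq_zero fun i _ => ?_
  -- Below degree p the exponential of the truncated logarithm is ∏(1 - y_i T). From degree p on,
  -- both sides have coefficients in J^i, which annihilate `Y i`.
  rcases lt_or_ge i p with hi | hi
  · rw [coeff_sub, coeff_exp_logReverseProd y (le_max_right _ _) hi, sub_self, zero_smul]
  · refine hkill i hi _ ?_
    refine (mem_reesAlgebra_iff _ _).1 (sub_mem (sum_mem fun j _ => ?_)
      (reverseProd_mem_reesAlgebra hy)) i
    have := pow_mem (logReverseProd_mem_reesAlgebra hy p) j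
    rw [Algebra.smul_def, IsScalarTower.algebraMap_apply ℚ R R[X]]
    exact mul_mem (Subalgebra.algebraMap_mem _ _) this

variable {V : Type*} [AddCommGroup V] [Module R V] [Module ℚ V] [IsScalarTower ℚ R V]

/-- `e` is the exponential of `A` with respect to a filtration that is shifted by `A`. -/
structure IsFilteredExp (Fil : ℕ → Submodule R V) (A : V →ₗ[R] V) (e : V → V) : Prop where
  zero : Fil 0 = ⊤
  map_mem : ∀ p v, v ∈ Fil p → A v ∈ Fil (p + 1)
  anti : ∀ p, Fil (p + 1) ≤ Fil p
  exp_sub_mem : ∀ p v, e v - ∑ j ∈ Finset.range p, (j.factorial : ℚ)⁻¹ • (A ^ j) v ∈ Fil p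

variable {Fil : ℕ → Submodule R V} {A : V →ₗ[R] V} {e : V → V}

namespace IsFilteredExp

theorem le_comap (h : IsFilteredExp Fil A e) (p : ℕ) : Fil p ≤ (Fil p).comap A :=
  fun v hv => h.anti p (h.map_mem p v hv)

theorem pow_mem (h : IsFilteredExp Fil A e) (p : ℕ) (v : V) : (A ^ p) v ∈ Fil p := by
  induction p with
  | zero => rw [h.zero]; trivial
  | succ p ih => rw [pow_succ', Module.End.mul_apply]; exact h.map_mem p _ ih

/-- The operator induced by `A` on a quotient of the filtration. -/
def bar (h : IsFilteredExp Fil A e) (p : ℕ) : Module.End R (V ⧸ Fil p) :=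
  (Fil p).mapQ (Fil p) A (h.le_comap p)

theorem bar_mk (h : IsFilteredExp Fil A e) (p : ℕ) (v : V) :
    h.bar p ((Fil p).mkQ v) = (Fil p).mkQ (A v) := rfl

theorem bar_pow_mk (h : IsFilteredExp Fil A e) (p j : ℕ) (v : V) :
    (h.bar p ^ j) ((Fil p).mkQ v) = (Fil p).mkQ ((A ^ j) v) := by
  induction j with
  | zero => rfl
  | succ j ih => rw [pow_succ', Module.End.mul_apply, ih, bar_mk, pow_succ', Module.End.mul_apply]

/-- `A` raises the filtration by one step and `Fil 0` is everything, so `A ^ p` maps into `Fil p`.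
-/
theorem bar_pow_eq_zero (h : IsFilteredExp Fil A e) (p : ℕ) : h.bar p ^ p = 0 := by
  refine LinearMap.ext fun x => ?_
  obtain ⟨v, rfl⟩ := (Fil p).mkQ_surjective x
  rw [bar_pow_mk, LinearMap.zero_apply, Submodule.mkQ_apply, Submodule.Quotient.mk_eq_zero]
  exact h.pow_mem p v

theorem isNilpotent_bar (h : IsFilteredExp Fil A e) (p : ℕ) : IsNilpotent (h.bar p) :=
  ⟨p, h.bar_pow_eq_zero p⟩

theorem mk_exp (h : IsFilteredExp Fil A e) (p : ℕ) (v : V) :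
    (Fil p).mkQ (e v) = IsNilpotent.exp (h.bar p) ((Fil p).mkQ v) := by
  rw [IsNilpotent.exp_eq_sum (h.bar_pow_eq_zero p), LinearMap.sum_apply]
  have := (Submodule.Quotient.eq (Fil p)).2 (h.exp_sub_mem p v)
  rw [Submodule.mkQ_apply, this, ← Submodule.mkQ_apply, map_sum]
  refine Finset.sum_congr rfl fun j _ => ?_
  rw [LinearMap.smul_apply, bar_pow_mk, map_rat_smul]

variable (Y : ℕ → V →ₗ[R] V) (y : ι → R) {J : Ideal R}

/-- The operators induced by a family on a quotient of the filtration. -/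
def barFamily (p : ℕ) (hY : ∀ i v, v ∈ Fil p → Y i v ∈ Fil p) (i : ℕ) :
    Module.End R (V ⧸ Fil p) :=
  (Fil p).mapQ (Fil p) (Y i) (hY i)

theorem barFamily_mk (p : ℕ) (hY : ∀ i v, v ∈ Fil p → Y i v ∈ Fil p) (i : ℕ) (v : V) :
    barFamily Y p hY i ((Fil p).mkQ v) = (Fil p).mkQ (Y i v) := rfl

/-- On `V ⧸ Fil p` the map induced by `e` is the exponential of a nilpotent operator and
`exp_mul_family` applies there; the commutator is therefore only needed modulo `Fil p`. -/
theorem exp_conj (h : IsFilteredExp Fil A e) (hy : ∀ i, y i ∈ J) (p : ℕ)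
    (hY : ∀ i v, v ∈ Fil p → Y i v ∈ Fil p)
    (hcomm : ∀ i v, A (Y i v) - Y i (A v) +
      ∑ m ∈ Finset.Ico 1 p, ((m : ℚ)⁻¹ • ∑ i, y i ^ m) • Y (i + m) v ∈ Fil p)
    (hkill : ∀ i, p ≤ i → ∀ r ∈ J ^ i, ∀ v, r • Y i v ∈ Fil p) (v : V) :
    e (Y 0 v) - ((reverseProd y).sum fun i r => r • Y i (e v)) ∈ Fil p := by
  have key := exp_mul_family (h.isNilpotent_bar p) (barFamily Y p hY) y hy p
    (fun i => by
      refine LinearMap.ext fun x => ?_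
      obtain ⟨v, rfl⟩ := (Fil p).mkQ_surjective x
      have h1 := (Submodule.Quotient.mk_eq_zero _).2 (hcomm i v)
      rw [← Submodule.mkQ_apply, map_add, map_sub, map_sum] at h1
      rw [LinearMap.sub_apply, LinearMap.neg_apply, LinearMap.sum_apply]
      simp only [Module.End.mul_apply, LinearMap.smul_apply, barFamily_mk, bar_mk]
      simp only [map_smul] at h1
      exact eq_neg_of_add_eq_zero_left h1)
    (fun i hi r hr => by
      refine LinearMap.ext fun x => ?_
      obtain ⟨v, rfl⟩ := (Fil p).mkQ_surjective x
      rw [LinearMap.smul_apply, barFamily_mk, ← map_smul, LinearMap.zero_apply,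
        Submodule.mkQ_apply, Submodule.Quotient.mk_eq_zero]
      exact hkill i hi r hr v)
  rw [← Submodule.Quotient.mk_eq_zero, ← Submodule.mkQ_apply, map_sub, h.mk_exp, sub_eq_zero,
    ← barFamily_mk Y p hY]
  refine (LinearMap.congr_fun key ((Fil p).mkQ v)).trans ?_
  rw [Module.End.mul_apply, ← h.mk_exp, Polynomial.sum, Polynomial.sum, LinearMap.sum_apply,
    map_sum]
  rfl

/-- With the opposite sign of the commutator, `exp_mul_family` applies to -A. Multiplying its
conclusion by exp A on both sides moves the product ∏(1 - y_i T) inside `e`. -/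
theorem exp_conj' (h : IsFilteredExp Fil A e) (hy : ∀ i, y i ∈ J) (p : ℕ)
    (hY : ∀ i v, v ∈ Fil p → Y i v ∈ Fil p)
    (hcomm : ∀ i v, A (Y i v) - Y i (A v) -
      ∑ m ∈ Finset.Ico 1 p, ((m : ℚ)⁻¹ • ∑ i, y i ^ m) • Y (i + m) v ∈ Fil p)
    (hkill : ∀ i, p ≤ i → ∀ r ∈ J ^ i, ∀ v, r • Y i v ∈ Fil p) (v : V) :
    e ((reverseProd y).sum fun i r => r • Y i v) - Y 0 (e v) ∈ Fil p := by
  have key := exp_mul_family (h.isNilpotent_bar p).neg (barFamily Y p hY) y hy p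
    (fun i => by
      refine LinearMap.ext fun x => ?_
      obtain ⟨v, rfl⟩ := (Fil p).mkQ_surjective x
      have h1 := (Submodule.Quotient.mk_eq_zero _).2 (hcomm i v)
      rw [← Submodule.mkQ_apply, map_sub, map_sub, map_sum] at h1
      rw [LinearMap.sub_apply, Module.End.mul_apply, Module.End.mul_apply, LinearMap.neg_apply,
        LinearMap.neg_apply, LinearMap.neg_apply, map_neg, sub_neg_eq_add, ← sub_eq_neg_add,
        ← neg_sub, neg_inj, LinearMap.sum_apply]
      simp only [LinearMap.smul_apply, barFamily_mk, bar_mk]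
      simp only [map_smul] at h1
      exact sub_eq_zero.1 h1)
    (fun i hi r hr => by
      refine LinearMap.ext fun x => ?_
      obtain ⟨v, rfl⟩ := (Fil p).mkQ_surjective x
      rw [LinearMap.smul_apply, barFamily_mk, ← map_smul, LinearMap.zero_apply,
        Submodule.mkQ_apply, Submodule.Quotient.mk_eq_zero]
      exact hkill i hi r hr v)
  have key2 : barFamily Y p hY 0 * IsNilpotent.exp (h.bar p) = IsNilpotent.exp (h.bar p) *
      ((reverseProd y).sum fun i r => r • barFamily Y p hY i) := by
    calc _ = IsNilpotent.exp (h.bar p) * (IsNilpotent.exp (- h.bar p) *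
          barFamily Y p hY 0) * IsNilpotent.exp (h.bar p) := by
            rw [← mul_assoc, IsNilpotent.exp_mul_exp_neg_self (h.isNilpotent_bar p), one_mul]
      _ = _ := by
            rw [key, mul_assoc, mul_assoc, IsNilpotent.exp_neg_mul_exp_self (h.isNilpotent_bar p),
              mul_one]
  rw [← Submodule.Quotient.mk_eq_zero, ← Submodule.mkQ_apply, map_sub, h.mk_exp, sub_eq_zero,
    ← barFamily_mk Y p hY, h.mk_exp]
  refine Eq.trans ?_ (LinearMap.congr_fun key2 ((Fil p).mkQ v)).symm
  rw [Module.End.mul_apply, Polynomial.sum, Polynomial.sum, LinearMap.sum_apply, map_sum]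
  rfl

theorem exp_add_sub_mem (h : IsFilteredExp Fil A e) (p : ℕ) (v w : V) :
    e (v + w) - (e v + e w) ∈ Fil p := by
  rw [← Submodule.Quotient.mk_eq_zero, ← Submodule.mkQ_apply, map_sub, map_add, h.mk_exp, h.mk_exp,
    h.mk_exp, map_add, map_add, sub_self]

theorem exp_smul_sub_mem (h : IsFilteredExp Fil A e) (p : ℕ) (r : R) (v : V) :
    e (r • v) - r • e v ∈ Fil p := by
  rw [← Submodule.Quotient.mk_eq_zero, ← Submodule.mkQ_apply, map_sub, map_smul, h.mk_exp,
    h.mk_exp, map_smul, map_smul, sub_self]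

end IsFilteredExp

end FilteredExponential

end

end StableGrothendieck

namespace StableGrothendieck

noncomputable section

/-! ### Coordinatewise filtrations of the Fock space. -/

section FockExponentials

variable {k : Type*} [Field k] {σ : Type*}

/-- The vectors whose coefficients at the coordinates in `C` vanish. -/
def coordFil (C : Maya → (σ →₀ ℕ) → Prop) (hC : ∀ S d d', d' ≤ d → C S d → C S d') :
    Submodule (MvPowerSeries σ k) (Fock k σ) where
  carrier := {v | ∀ S d, C S d → MvPowerSeries.coeff d (v S) = 0}
  zero_mem' S d _ := by simp
  add_mem' {v w} hv hw S d h := by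
    rw [Pi.add_apply, map_add, hv S d h, hw S d h, add_zero]
  smul_mem' r v hv S d h := by
    classical
    rw [Pi.smul_apply, smul_eq_mul, MvPowerSeries.coeff_mul]
    refine Finset.sum_eq_zero fun x hx => ?_
    rw [hv S x.2 (hC S d x.2 ?_ h), mul_zero]
    rw [← Finset.HasAntidiagonal.mem_antidiagonal.1 hx]
    exact le_add_self

theorem natCast_inv_smul [CharZero k] {M : Type*} [AddCommGroup M] [Module k M] [Module ℚ M]
    (m : ℕ) (x : M) : ((m : k)⁻¹) • x = ((m : ℚ)⁻¹) • x := by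
  have := map_inv_natCast_smul (AddMonoidHom.id M) k ℚ m x
  exact this

/-- Since `A ^ j` maps everything into the j-th step, only the terms j < p contribute at a
coordinate in `C p`; there the formal exponential is a finite sum. -/
theorem isFilteredExp_expOp [CharZero k] {C : ℕ → Maya → (σ →₀ ℕ) → Prop}
    (hC : ∀ p S d d', d' ≤ d → C p S d → C p S d') (h0 : ∀ S d, ¬ C 0 S d)
    (hanti : ∀ p S d, C p S d → C (p + 1) S d)
    (A : Fock k σ →ₗ[MvPowerSeries σ k] Fock k σ)
    (hA : ∀ p, ∀ v ∈ coordFil (k := k) (C p) (hC p), A v ∈ coordFil (C (p + 1)) (hC (p + 1))) :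
    IsFilteredExp (fun p => coordFil (C p) (hC p)) A (expOp A) where
  zero := by
    rw [eq_top_iff]
    exact fun v _ S d h => absurd h (h0 S d)
  map_mem := hA
  anti p v hv S d h := hv S d (hanti p S d h)
  exp_sub_mem p v := by
    intro S d h
    have hle : ∀ q, p ≤ q → C q S d := by
      intro q hq
      induction hq with
      | refl => exact h
      | step _ ih => exact hanti _ S d ih
    have hpow : ∀ j, (A ^ j) v ∈ coordFil (k := k) (C j) (hC j) := by
      intro j
      induction j with
      | zero => exact fun S d h => absurd h (h0 S d)
      | succ j ih => rw [pow_succ', Module.End.mul_apply]; exact hA j _ ih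
    have h1 : MvPowerSeries.coeff d (expOp A v S) =
        ∑ j ∈ Finset.range p, MvPowerSeries.coeff d
          ((((j.factorial : k)⁻¹) • (⇑A)^[j] v) S) := by
      refine finsum_eq_sum_of_support_subset _ fun j hj => ?_
      rw [Finset.coe_range, Set.mem_Iio]
      by_contra hjp
      refine hj ?_
      have h2 := hpow j S d (hle j (not_lt.1 hjp))
      rw [Module.End.pow_apply] at h2
      simp only [Pi.smul_apply, map_smul, h2, smul_zero]
    rw [Pi.sub_apply, map_sub, h1, Finset.sum_apply, map_sum, sub_eq_zero]
    refine Finset.sum_congr rfl fun j _ => ?_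
    rw [natCast_inv_smul, Module.End.pow_apply]

/-- Vectors that vanish at the coordinates in `P` are preserved by `expOp A` if they are preserved
by `A`. -/
theorem coeff_expOp_eq_zero {P : Maya → (σ →₀ ℕ) → Prop} {A : Fock k σ → Fock k σ}
    (hA : ∀ v, (∀ S d, P S d → MvPowerSeries.coeff d (v S) = 0) →
      ∀ S d, P S d → MvPowerSeries.coeff d (A v S) = 0)
    {v : Fock k σ} (hv : ∀ S d, P S d → MvPowerSeries.coeff d (v S) = 0) (S : Maya) (d : σ →₀ ℕ)
    (h : P S d) : MvPowerSeries.coeff d (expOp A v S) = 0 := by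
  have hpow : ∀ j, ∀ S d, P S d → MvPowerSeries.coeff d (A^[j] v S) = 0 := by
    intro j
    induction j with
    | zero => exact hv
    | succ j ih => rw [Function.iterate_succ', Function.comp_apply]; exact hA _ ih
  refine finsum_eq_zero_of_forall_eq_zero fun j => ?_
  change MvPowerSeries.coeff d (((j.factorial : k)⁻¹) • A^[j] v S) = 0
  rw [map_smul, hpow j S d h, smul_zero]

theorem finsum_pnat {M : Type*} [AddCommMonoid M] (f : ℕ → M) {p : ℕ}
    (hf : ∀ m, p ≤ m → f m = 0) : ∑ᶠ m : ℕ+, f m = ∑ m ∈ Finset.Ico 1 p, f m := by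
  have h1 : ∑ᶠ m : ℕ+, f m = ∑ᶠ n : ℕ, f (n + 1) := by
    rw [← finsum_comp_equiv Equiv.pnatEquivNat]
    refine finsum_congr fun m => ?_
    congr 1
    exact (PNat.natPred_add_one m).symm
  rw [h1, Finset.sum_Ico_eq_sum_range]
  rw [finsum_eq_sum_of_support_subset (s := Finset.range (p - 1))]
  · exact Finset.sum_congr rfl fun n _ => by rw [add_comm]
  · intro n hn
    rw [Finset.coe_range, Set.mem_Iio]
    by_contra h
    exact hn (hf _ (by omega))

/-! ### Conjugation by e^Θ. -/

section Theta

variable (β : k)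

/-- The coefficient `(-1)^{m-1} β^m / m` of `a_{-m}` in `Θ`. -/
def thetaCoeff (m : ℕ) : k := (-1) ^ (m - 1) * β ^ m / m

/-- `a_{-m}` is linear. -/
def lowerLin (m : ℕ) : Fock k σ →ₗ[MvPowerSeries σ k] Fock k σ :=
  if h : m = 0 then 0 else currentLin (-(m : ℤ)) (by omega)

theorem lowerLin_apply {m : ℕ} (h : 1 ≤ m) (v : Fock k σ) :
    lowerLin m v = current (-(m : ℤ)) v := by
  rw [lowerLin, dif_neg (by omega), currentLin_apply]

theorem Theta_apply (v : Fock k σ) (S : Maya) {p : ℕ}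
    (h : ∀ m : ℕ, p ≤ m → S.movable (-(m : ℤ)) = ∅) :
    Theta β v S = ∑ m ∈ Finset.Ico 1 p, thetaCoeff β m • lowerLin m v S := by
  ext d
  have h1 := finsum_pnat
    (fun m => MvPowerSeries.coeff d (thetaCoeff β m • lowerLin m v S)) (p := p) (by
      intro m hm
      rcases Nat.eq_zero_or_pos m with rfl | hm0
      · simp [lowerLin]
      · rw [lowerLin_apply hm0, current_apply_eq_zero (by omega), smul_zero, map_zero]
        intro j hj
        rw [h m hm] at hj
        exact absurd hj (Set.notMem_empty j))
  rw [map_sum, ← h1]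
  refine finsum_congr fun m => ?_
  rw [lowerLin_apply (m := m) m.2]
  rfl

/-- `Θ` as a linear map. -/
def ThetaLin : Fock k σ →ₗ[MvPowerSeries σ k] Fock k σ where
  toFun := Theta β
  map_add' v w := by
    funext S
    obtain ⟨N, hN⟩ := S.movable_neg_eq_empty
    have h : ∀ m : ℕ, N + 1 ≤ m → S.movable (-(m : ℤ)) = ∅ := fun m hm => hN m hm
    rw [Pi.add_apply, Theta_apply β _ S h, Theta_apply β _ S h, Theta_apply β _ S h,
      ← Finset.sum_add_distrib]
    refine Finset.sum_congr rfl fun m _ => ?_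
    rw [map_add, Pi.add_apply, smul_add]
  map_smul' r v := by
    funext S
    obtain ⟨N, hN⟩ := S.movable_neg_eq_empty
    have h : ∀ m : ℕ, N + 1 ≤ m → S.movable (-(m : ℤ)) = ∅ := fun m hm => hN m hm
    rw [Pi.smul_apply, Theta_apply β _ S h, Theta_apply β _ S h, Finset.smul_sum]
    refine Finset.sum_congr rfl fun m _ => ?_
    rw [map_smul, Pi.smul_apply, RingHom.id_apply, smul_comm]

@[simp] theorem ThetaLin_apply (v : Fock k σ) : ThetaLin β v = Theta β v := rfl

/-- `S` contains all integers below `-M`. -/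
def Maya.IsFilled (M : ℕ) (S : Maya) : Prop := ∀ j, j < -(M : ℤ) → j ∈ S.1

/-- The total height of the particles of `S` above the level `-M`. -/
def Maya.weight (M : ℕ) (S : Maya) : ℕ :=
  ∑ j ∈ (S.finite_gt (-(M : ℤ) - 1)).toFinset, (j + M).toNat

theorem Maya.weight_insert {M : ℕ} {S : Maya} {i : ℤ} (hi : i ∉ S.1) (hM : -(M : ℤ) ≤ i) :
    (S.insert i).weight M = S.weight M + (i + M).toNat := by
  rw [Maya.weight, Maya.weight]
  have : ((S.insert i).finite_gt (-(M : ℤ) - 1)).toFinset =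
      Insert.insert i (S.finite_gt (-(M : ℤ) - 1)).toFinset := by
    ext j
    simp only [Set.Finite.mem_toFinset, Set.mem_ofPred_eq, Maya.mem_insert, Finset.mem_insert]
    constructor
    · rintro ⟨h | h, h'⟩
      · exact Or.inr ⟨h, h'⟩
      · exact Or.inl h
    · rintro (h | ⟨h, h'⟩)
      · exact ⟨Or.inr h, by omega⟩
      · exact ⟨Or.inl h, h'⟩
  rw [this, Finset.sum_insert, add_comm]
  simp [hi]

theorem Maya.weight_erase {M : ℕ} {S : Maya} {i : ℤ} (hi : i ∈ S.1) (hM : -(M : ℤ) ≤ i) :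
    (S.erase i).weight M + (i + M).toNat = S.weight M := by
  rw [← Maya.weight_insert (by simp) hM, Maya.insert_erase hi]

theorem Maya.IsFilled.erase {M : ℕ} {S : Maya} (hS : S.IsFilled M) {i : ℤ}
    (hM : -(M : ℤ) ≤ i) : (S.erase i).IsFilled M :=
  fun j hj => ⟨hS j hj, by rw [Set.mem_singleton_iff]; omega⟩

theorem Maya.IsFilled.le_of_notMem {M : ℕ} {S : Maya} (hS : S.IsFilled M) {i : ℤ} (hi : i ∉ S.1) :
    -(M : ℤ) ≤ i := not_lt.1 fun h => hi (hS i h)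

theorem Maya.IsFilled.move {M : ℕ} {S : Maya} (hS : S.IsFilled M) {m j : ℤ} (hm : m ≤ 0)
    (hj : j ∈ S.movable m) : (S.move m j).IsFilled M := by
  intro i hi
  have := hS.le_of_notMem hj.2
  exact Or.inl ⟨hS i hi, by rw [Set.mem_singleton_iff]; omega⟩

theorem Maya.IsFilled.weight_move {M : ℕ} {S : Maya} (hS : S.IsFilled M) {m : ℕ} {j : ℤ}
    (hm : 1 ≤ m) (hj : j ∈ S.movable (-(m : ℤ))) :
    (S.move (-(m : ℤ)) j).weight M + m = S.weight M := by
  have h1 := hS.le_of_notMem hj.2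
  have h2 := Maya.weight_erase (M := M) hj.1 (by omega)
  have h3 := Maya.weight_insert (M := M) (S := S.erase j)
    (fun h => hj.2 (Maya.mem_erase.1 h).1) h1
  rw [Maya.move]
  omega

theorem Maya.IsFilled.movable_eq_empty {M : ℕ} {S : Maya} (hS : S.IsFilled M) {p m : ℕ}
    (hp : S.weight M < p) (hm : p ≤ m) : S.movable (-(m : ℤ)) = ∅ := by
  refine Set.eq_empty_of_forall_notMem fun j hj => ?_
  have := hS.weight_move (by omega) hj
  omega

variable (k σ) in
/-- The filtration of the Fock space by weight. -/
def weightFil (M p : ℕ) : Submodule (MvPowerSeries σ k) (Fock k σ) :=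
  coordFil (fun S _ => S.IsFilled M ∧ S.weight M < p) fun _ _ _ _ h => h

theorem mem_weightFil {M p : ℕ} {v : Fock k σ} :
    v ∈ weightFil k σ M p ↔ ∀ S : Maya, S.IsFilled M → S.weight M < p → v S = 0 :=
  ⟨fun h S h1 h2 => MvPowerSeries.ext fun d => h S d ⟨h1, h2⟩,
    fun h S d hS => by rw [h S hS.1 hS.2, map_zero]⟩

/-- Each configuration contains all integers below -M once M is large, and then has finite weight.
No single M separates vectors, but all large M together do. -/
theorem eq_zero_of_mem_weightFil (M₀ : ℕ) {v : Fock k σ}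
    (h : ∀ M p, M₀ ≤ M → v ∈ weightFil k σ M p) : v = 0 := by
  funext S
  obtain ⟨N, -, hN⟩ := S.exists_bounds
  refine mem_weightFil.1 (h (max M₀ N) (S.weight (max M₀ N) + 1) (le_max_left _ _)) S
    (fun j hj => hN j ?_) (Nat.lt_succ_self _)
  have := le_max_right M₀ N
  omega

/-- In coordinates, a_{-m} evaluates `v` at configurations with one particle lowered by m, hence of
weight smaller by m ≥ 1. -/
theorem Theta_mem_weightFil {M p : ℕ} {v : Fock k σ} (hv : v ∈ weightFil k σ M p) :
    Theta β v ∈ weightFil k σ M (p + 1) := by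
  rw [mem_weightFil] at hv ⊢
  intro S hS hw
  rw [Theta_apply β v S fun m hm => hS.movable_eq_empty hw hm]
  refine Finset.sum_eq_zero fun m hm => ?_
  have hm1 := (Finset.mem_Ico.1 hm).1
  rw [lowerLin_apply hm1, current_apply_eq_zero (by omega), smul_zero]
  intro j hj
  have := hS.weight_move hm1 hj
  exact hv _ (hS.move (by omega) hj) (by omega)

theorem isFilteredExp_Theta [CharZero k] (M : ℕ) :
    IsFilteredExp (weightFil k σ M) (ThetaLin β) (expOp (Theta β)) :=
  isFilteredExp_expOp (C := fun p S _ => S.IsFilled M ∧ S.weight M < p) (fun _ _ _ _ _ h => h)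
    (fun _ _ h => Nat.not_lt_zero _ h.2) (fun _ _ _ h => ⟨h.1, by omega⟩) (ThetaLin β)
    fun _ _ hv => Theta_mem_weightFil β hv

/-- `e^Θ` as a linear map. -/
def expThetaLin [CharZero k] : Fock k σ →ₗ[MvPowerSeries σ k] Fock k σ where
  toFun := expOp (Theta β)
  map_add' v w := sub_eq_zero.1 (eq_zero_of_mem_weightFil 0 fun M p _ =>
    (isFilteredExp_Theta β M).exp_add_sub_mem p v w)
  map_smul' r v := sub_eq_zero.1 (eq_zero_of_mem_weightFil 0 fun M p _ =>
    (isFilteredExp_Theta β M).exp_smul_sub_mem p r v)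

@[simp] theorem expThetaLin_apply [CharZero k] (v : Fock k σ) :
    expThetaLin β v = expOp (Theta β) v := rfl

theorem psi_mem_weightFil {M p : ℕ} {n : ℤ} (hn : -(M : ℤ) ≤ n) {v : Fock k σ}
    (hv : v ∈ weightFil k σ M p) : psi n v ∈ weightFil k σ M p := by
  rw [mem_weightFil] at hv ⊢
  intro S hS hw
  by_cases h : n ∈ S.1
  · have := Maya.weight_erase h hn
    rw [psi_apply_of_mem h, hv _ (hS.erase hn) (by omega), smul_zero]
  · exact psi_apply_of_notMem h v

theorem Theta_psi {M p : ℕ} {n : ℤ} (hn : -(M : ℤ) ≤ n) {S : Maya} (hS : S.IsFilled M)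
    (hw : S.weight M < p) (v : Fock k σ) :
    Theta β (psi n v) S = psi n (Theta β v) S +
      ∑ m ∈ Finset.Ico 1 p, thetaCoeff β m • psi (n + m) v S := by
  rw [Theta_apply β _ S fun m hm => hS.movable_eq_empty hw hm]
  have h1 : psi n (Theta β v) S =
      ∑ m ∈ Finset.Ico 1 p, thetaCoeff β m • psi n (lowerLin m v) S := by
    by_cases h : n ∈ S.1
    · have := Maya.weight_erase h hn
      rw [psi_apply_of_mem h, Theta_apply β _ (S.erase n) fun m hm =>
        (hS.erase hn).movable_eq_empty (by omega : _ < p) hm, Finset.smul_sum]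
      refine Finset.sum_congr rfl fun m _ => ?_
      rw [psi_apply_of_mem h, smul_comm]
    · rw [psi_apply_of_notMem h]
      refine (Finset.sum_eq_zero fun m _ => ?_).symm
      rw [psi_apply_of_notMem h, smul_zero]
  rw [h1, ← Finset.sum_add_distrib]
  refine Finset.sum_congr rfl fun m hm => ?_
  have hm1 := (Finset.mem_Ico.1 hm).1
  rw [lowerLin_apply hm1, lowerLin_apply hm1, current_psi (by omega), Pi.add_apply, smul_add,
    sub_neg_eq_add]

/-- These are the coefficients of log(1 - yT) for the single value y = -β, which puts Θ in the form
required by `exp_conj`. -/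
theorem thetaCoeff_eq (β : k) {m : ℕ} (hm : 1 ≤ m) :
    (m : k)⁻¹ * (-β) ^ m = - thetaCoeff β m := by
  obtain ⟨q, rfl⟩ : ∃ q, m = q + 1 := ⟨m - 1, by omega⟩
  rw [thetaCoeff, Nat.add_sub_cancel, neg_pow, pow_succ (-1 : k) q]
  ring

theorem inv_smul_C_pow [CharZero k] {m : ℕ} (hm : 1 ≤ m) :
    ((m : ℚ)⁻¹ • (MvPowerSeries.C (-β) : MvPowerSeries σ k) ^ m) =
      MvPowerSeries.C (- thetaCoeff β m) := by
  rw [← natCast_inv_smul (k := k), ← map_pow, MvPowerSeries.smul_eq_C_mul, ← map_mul,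
    thetaCoeff_eq β hm]

/-- By `current_psi`, ad Θ acts on ψ_n as log(1 + βT) with T raising the index by one, so
conjugation by e^Θ acts as 1 + βT. -/
theorem expTheta_psi [CharZero k] (n : ℤ) (v : Fock k σ) :
    expOp (Theta β) (psi n v) = psi n (expOp (Theta β) v) +
      (MvPowerSeries.C β : MvPowerSeries σ k) • psi (n + 1) (expOp (Theta β) v) := by
  -- M ≥ |n| ensures that every ψ_{n+i} acts at a site not below -M and so preserves the weight
  -- filtration.
  refine sub_eq_zero.1 (eq_zero_of_mem_weightFil n.natAbs fun M p hM => ?_)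
  have key := (isFilteredExp_Theta (σ := σ) β M).exp_conj (fun i => psiLin (n + i))
    (fun _ : Unit => MvPowerSeries.C (-β)) (J := ⊤) (fun _ => trivial) p
    (fun i w hw => psi_mem_weightFil (by omega) hw)
    (fun i w => by
      refine mem_weightFil.2 fun S hS hw => ?_
      simp only [Pi.add_apply, Pi.sub_apply, ThetaLin_apply, psiLin_apply]
      rw [Theta_psi β (p := p) (by omega) hS hw, add_sub_cancel_left, Finset.sum_apply,
        ← Finset.sum_add_distrib]
      refine Finset.sum_eq_zero fun m hm => ?_
      rw [Pi.smul_apply, Finset.univ_unique, Finset.sum_singleton, inv_smul_C_pow β (Finset.mem_Ico.1 hm).1, smul_eq_mul,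
        ← MvPowerSeries.smul_eq_C_mul, Nat.cast_add, ← add_assoc, ← add_smul, add_neg_cancel,
        zero_smul])
    -- Here β is not small and J is the whole ring: the terms i ≥ p vanish because a particle at n +
    -- i has height n + i + M ≥ p, too much for a configuration of weight less than p.
    (fun i hi r _ w => by
      refine Submodule.smul_mem _ _ (mem_weightFil.2 fun S hS hw => psi_apply_of_notMem ?_ _)
      intro h
      have := Maya.weight_erase (M := M) h (by omega)
      omega) v
  rw [Polynomial.sum_over_range' (f := fun i r => r • (psiLin (n + (i : ℕ)))
    (expOp (Theta β) v)) _ (fun _ => zero_smul _ _) 2 (by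
    rw [reverseProd, Finset.univ_unique, Finset.prod_singleton]
    refine Nat.lt_succ_of_le ?_
    compute_degree)] at key
  have h0 : (reverseProd fun _ : Unit =>
      (MvPowerSeries.C (-β) : MvPowerSeries σ k)).coeff 0 = 1 := by
    simp [reverseProd]
  have h1 : (reverseProd fun _ : Unit =>
      (MvPowerSeries.C (-β) : MvPowerSeries σ k)).coeff 1 = MvPowerSeries.C β := by
    simp [reverseProd, Polynomial.coeff_one]
  rw [Finset.sum_range_succ, Finset.sum_range_one, h0, h1, one_smul] at key
  simpa using key

end Theta

end FockExponentials

end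

end StableGrothendieck

namespace StableGrothendieck

noncomputable section

/-! ### Conjugation by e^H. -/

section Hamiltonian

variable {k : Type*} [Field k] {n : ℕ}

variable (k n) in
/-- The ideal of `k[[x_1, …, x_n]]` generated by the variables. -/
def varIdeal : Ideal (MvPowerSeries (Fin n) k) := Ideal.span (Set.range MvPowerSeries.X)

theorem X_mem_varIdeal (i : Fin n) : (MvPowerSeries.X i : MvPowerSeries (Fin n) k) ∈ varIdeal k n :=
  Ideal.subset_span ⟨i, rfl⟩

theorem coeff_mul_eq_zero_of_degree_lt {a b : MvPowerSeries (Fin n) k} {p q : ℕ}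
    (ha : ∀ d, d.degree < p → MvPowerSeries.coeff d a = 0)
    (hb : ∀ d, d.degree < q → MvPowerSeries.coeff d b = 0) (d : Fin n →₀ ℕ)
    (hd : d.degree < p + q) : MvPowerSeries.coeff d (a * b) = 0 := by
  classical
  rw [MvPowerSeries.coeff_mul]
  refine Finset.sum_eq_zero fun x hx => ?_
  have h : x.1.degree + x.2.degree = d.degree := by
    rw [← map_add, Finset.HasAntidiagonal.mem_antidiagonal.1 hx]
  rcases lt_or_ge x.1.degree p with h1 | h1
  · rw [ha _ h1, zero_mul]
  · rw [hb _ (by omega), mul_zero]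

theorem coeff_eq_zero_of_mem_varIdeal_pow {p : ℕ} {r : MvPowerSeries (Fin n) k}
    (hr : r ∈ varIdeal k n ^ p) (d : Fin n →₀ ℕ) (hd : d.degree < p) :
    MvPowerSeries.coeff d r = 0 := by
  induction p generalizing r d with
  | zero => exact absurd hd (Nat.not_lt_zero _)
  | succ p ih =>
    rw [pow_succ] at hr
    induction hr using Submodule.mul_induction_on' with
    | mem_mul_mem a ha b hb =>
      refine coeff_mul_eq_zero_of_degree_lt (fun d hd => ih ha d hd) (q := 1) ?_ d hd
      have h1 : varIdeal k n ≤ RingHom.ker (MvPowerSeries.constantCoeff (R := k)) := by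
        rw [varIdeal, Ideal.span_le]
        rintro _ ⟨i, rfl⟩
        exact MvPowerSeries.constantCoeff_X i
      intro e he
      have h2 : e = 0 := by
        rw [← Finsupp.degree_eq_zero_iff]
        omega
      rw [h2]
      exact h1 hb
    | add a _ b _ ha hb => rw [map_add, ha, hb, add_zero]

variable (k n) in
/-- The filtration of the Fock space by the degree in `x_1, …, x_n`. -/
def degreeFil (p : ℕ) : Submodule (MvPowerSeries (Fin n) k) (Fock k (Fin n)) :=
  coordFil (fun _ d => d.degree < p) fun _ _ _ h hd =>
    (Finsupp.degree_mono h).trans_lt hd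

theorem eq_zero_of_mem_degreeFil {v : Fock k (Fin n)} (h : ∀ p, v ∈ degreeFil k n p) : v = 0 := by
  funext S
  ext d
  exact h (d.degree + 1) S d (Nat.lt_succ_self _)

theorem eq_of_sub_mem_degreeFil {v w : Fock k (Fin n)} (h : ∀ p, v - w ∈ degreeFil k n p) : v = w :=
  sub_eq_zero.1 (eq_zero_of_mem_degreeFil h)

theorem smul_mem_degreeFil {p q : ℕ} {r : MvPowerSeries (Fin n) k} (hr : r ∈ varIdeal k n ^ p)
    {v : Fock k (Fin n)} (hv : v ∈ degreeFil k n q) : r • v ∈ degreeFil k n (p + q) :=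
  fun S d hd => coeff_mul_eq_zero_of_degree_lt (coeff_eq_zero_of_mem_varIdeal_pow hr) (hv S) d hd

theorem psi_mem_degreeFil {p : ℕ} (m : ℤ) {v : Fock k (Fin n)} (hv : v ∈ degreeFil k n p) :
    psi m v ∈ degreeFil k n p := by
  intro S d hd
  by_cases h : m ∈ S.1
  · rw [psi_apply_of_mem h, map_zsmul, hv _ d hd, smul_zero]
  · rw [psi_apply_of_notMem h, map_zero]

theorem psiStar_mem_degreeFil {p : ℕ} (m : ℤ) {v : Fock k (Fin n)} (hv : v ∈ degreeFil k n p) :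
    psiStar m v ∈ degreeFil k n p := by
  intro S d hd
  by_cases h : m ∈ S.1
  · rw [psiStar_apply_of_mem h, map_zero]
  · rw [psiStar_apply_of_notMem h, map_zsmul, hv _ d hd, smul_zero]

theorem current_mem_degreeFil {p : ℕ} {m : ℤ} (hm : m ≠ 0) {v : Fock k (Fin n)}
    (hv : v ∈ degreeFil k n p) : current m v ∈ degreeFil k n p := by
  intro S d hd
  rw [current_apply hm, ← finsum_coeff _ (finite_support_psi_psiStar hm v S)]
  exact finsum_eq_zero_of_forall_eq_zero fun j =>
    psi_mem_degreeFil _ (psiStar_mem_degreeFil _ hv) S d hd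

/-- `a_m` is linear. -/
def raiseLin (m : ℕ) : Fock k (Fin n) →ₗ[MvPowerSeries (Fin n) k] Fock k (Fin n) :=
  if h : m = 0 then 0 else currentLin (m : ℤ) (by omega)

theorem raiseLin_apply {m : ℕ} (h : 1 ≤ m) (v : Fock k (Fin n)) :
    raiseLin m v = current (m : ℤ) v := by
  rw [raiseLin, dif_neg (by omega), currentLin_apply]

variable [CharZero k]

variable (k n) in
/-- The coefficient `p_m / m` of `a_m` in `H`. -/
def hamiltonianCoeff (m : ℕ) : MvPowerSeries (Fin n) k :=
  (m : ℚ)⁻¹ • ∑ i : Fin n, (MvPowerSeries.X i : MvPowerSeries (Fin n) k) ^ m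

theorem hamiltonianCoeff_mem (m : ℕ) : hamiltonianCoeff k n m ∈ varIdeal k n ^ m :=
  Submodule.smul_of_tower_mem _ _ (sum_mem fun i _ => Ideal.pow_mem_pow (X_mem_varIdeal i) m)

variable (k n) in
/-- The truncation of `H` at degree `p`. -/
def truncHamiltonian (p : ℕ) : Fock k (Fin n) →ₗ[MvPowerSeries (Fin n) k] Fock k (Fin n) :=
  ∑ m ∈ Finset.Ico 1 p, hamiltonianCoeff k n m • raiseLin m

/-- The coefficient p_m/m is homogeneous of degree m, so the terms m ≥ p are invisible below degree
p. -/
theorem Hamiltonian_sub_mem (p : ℕ) (v : Fock k (Fin n)) :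
    Hamiltonian v - truncHamiltonian k n p v ∈ degreeFil k n p := by
  intro S d hd
  have h1 := finsum_pnat
    (fun m => MvPowerSeries.coeff d ((hamiltonianCoeff k n m • raiseLin m v) S)) (p := p) (by
      intro m hm
      exact smul_mem_degreeFil (hamiltonianCoeff_mem m) (q := 0)
        (fun _ _ h => absurd h (Nat.not_lt_zero _)) S d (by omega))
  rw [Pi.sub_apply, map_sub, truncHamiltonian, LinearMap.sum_apply, Finset.sum_apply, map_sum,
    sub_eq_zero]
  refine Eq.trans ?_ h1
  refine finsum_congr fun m => ?_
  rw [raiseLin_apply (m := m) m.2, hamiltonianCoeff, ← natCast_inv_smul (k := k)]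

/-- `H` as a linear map. -/
def hamiltonianLin : Fock k (Fin n) →ₗ[MvPowerSeries (Fin n) k] Fock k (Fin n) where
  toFun := Hamiltonian
  map_add' v w := eq_of_sub_mem_degreeFil fun p => by
    have h := sub_mem (sub_mem (Hamiltonian_sub_mem p (v + w)) (Hamiltonian_sub_mem p v))
      (Hamiltonian_sub_mem p w)
    rw [map_add] at h
    convert h using 1
    abel
  map_smul' r v := eq_of_sub_mem_degreeFil fun p => by
    have h := sub_mem (Hamiltonian_sub_mem p (r • v))
      ((degreeFil k n p).smul_mem r (Hamiltonian_sub_mem p v))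
    rw [map_smul, smul_sub] at h
    convert h using 1
    rw [RingHom.id_apply]
    abel

@[simp] theorem hamiltonianLin_apply (v : Fock k (Fin n)) : hamiltonianLin v = Hamiltonian v := rfl

theorem Hamiltonian_mem_degreeFil {p : ℕ} {v : Fock k (Fin n)} (hv : v ∈ degreeFil k n p) :
    Hamiltonian v ∈ degreeFil k n (p + 1) := by
  rw [← sub_add_cancel (Hamiltonian v) (truncHamiltonian k n (p + 1) v)]
  refine add_mem (Hamiltonian_sub_mem (p + 1) v) ?_
  rw [truncHamiltonian, LinearMap.sum_apply]
  refine sum_mem fun m hm => ?_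
  have hm1 := (Finset.mem_Ico.1 hm).1
  rw [LinearMap.smul_apply, raiseLin_apply hm1]
  intro S d hd
  exact smul_mem_degreeFil (hamiltonianCoeff_mem m) (current_mem_degreeFil (by omega) hv) S d
    (by omega)

theorem isFilteredExp_Hamiltonian :
    IsFilteredExp (degreeFil k n) hamiltonianLin (expOp Hamiltonian) :=
  isFilteredExp_expOp (C := fun p _ d => d.degree < p)
    (fun _ _ _ _ h hd => (Finsupp.degree_mono h).trans_lt hd)
    (fun _ _ h => Nat.not_lt_zero _ h) (fun _ _ _ h => by omega) hamiltonianLin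
    fun _ _ hv => Hamiltonian_mem_degreeFil hv

/-- `e^H` as a linear map. -/
def expHamiltonianLin : Fock k (Fin n) →ₗ[MvPowerSeries (Fin n) k] Fock k (Fin n) where
  toFun := expOp Hamiltonian
  map_add' v w := eq_of_sub_mem_degreeFil fun p =>
    isFilteredExp_Hamiltonian.exp_add_sub_mem p v w
  map_smul' r v := eq_of_sub_mem_degreeFil fun p =>
    isFilteredExp_Hamiltonian.exp_smul_sub_mem p r v

/-- The polynomial `∏ (1 - x_i T)`. -/
abbrev elemPoly (k : Type*) [Field k] (n : ℕ) : Polynomial (MvPowerSeries (Fin n) k) :=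
  reverseProd MvPowerSeries.X

/-- By `current_psiStar`, ad H acts on ψ*_b as log ∏(1 - x_i T), T raising the index. The
exponential is a polynomial in T of degree at most n, the finiteness on which `vevLin_psiStar`
rests. -/
theorem expHamiltonian_psiStar (b : ℤ) (v : Fock k (Fin n)) :
    expOp Hamiltonian (psiStar b v) =
      (elemPoly k n).sum fun i r => r • psiStar (b + i) (expOp Hamiltonian v) := by
  refine eq_of_sub_mem_degreeFil fun p => ?_
  have key := isFilteredExp_Hamiltonian.exp_conj (fun i => psiStarLin (b + i))
    MvPowerSeries.X (X_mem_varIdeal (k := k) (n := n)) p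
    (fun i w hw => psiStar_mem_degreeFil _ hw)
    (fun i w => by
      have h1 := sub_mem (Hamiltonian_sub_mem p (psiStar (b + i) w))
        (psiStar_mem_degreeFil (b + i) (Hamiltonian_sub_mem p w))
      convert h1 using 1
      rw [← psiStarLin_apply _ (Hamiltonian w - _), map_sub, truncHamiltonian,
        LinearMap.sum_apply, LinearMap.sum_apply, map_sum, sub_sub_sub_comm, ← sub_neg_eq_add,
        hamiltonianLin_apply, hamiltonianLin_apply, psiStarLin_apply, psiStarLin_apply]
      congr 1
      rw [← Finset.sum_sub_distrib, ← Finset.sum_neg_distrib]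
      refine Finset.sum_congr rfl fun m hm => ?_
      have hm1 := (Finset.mem_Ico.1 hm).1
      rw [LinearMap.smul_apply, LinearMap.smul_apply, raiseLin_apply hm1, raiseLin_apply hm1,
        current_psiStar (by omega), map_smul, psiStarLin_apply, psiStarLin_apply, ← smul_sub,
        ← hamiltonianCoeff, Nat.cast_add, ← add_assoc, sub_sub_cancel_left, smul_neg])
    (fun i hi r hr w S d hd => smul_mem_degreeFil hr (q := 0)
      (fun _ _ h => absurd h (Nat.not_lt_zero _)) S d (by omega)) v
  simpa using key

/-- On the ψ_a the commutator has the other sign, so conjugation by e^H gives the inverse of ∏(1 -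
x_i T), T lowering the index. Placing the product inside e^H avoids this infinite series. -/
theorem expHamiltonian_psi (a : ℤ) (v : Fock k (Fin n)) :
    expOp Hamiltonian ((elemPoly k n).sum fun i r => r • psi (a - i) v) =
      psi a (expOp Hamiltonian v) := by
  refine eq_of_sub_mem_degreeFil fun p => ?_
  have key := isFilteredExp_Hamiltonian.exp_conj' (fun i => psiLin (a - i))
    MvPowerSeries.X (X_mem_varIdeal (k := k) (n := n)) p
    (fun i w hw => psi_mem_degreeFil _ hw)
    (fun i w => by
      have h1 := sub_mem (Hamiltonian_sub_mem p (psi (a - i) w))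
        (psi_mem_degreeFil (a - i) (Hamiltonian_sub_mem p w))
      convert h1 using 1
      rw [← psiLin_apply _ (Hamiltonian w - _), map_sub, truncHamiltonian,
        LinearMap.sum_apply, LinearMap.sum_apply, map_sum, sub_sub_sub_comm,
        hamiltonianLin_apply, hamiltonianLin_apply, psiLin_apply, psiLin_apply]
      congr 1
      rw [← Finset.sum_sub_distrib]
      refine Finset.sum_congr rfl fun m hm => ?_
      have hm1 := (Finset.mem_Ico.1 hm).1
      rw [LinearMap.smul_apply, LinearMap.smul_apply, raiseLin_apply hm1, raiseLin_apply hm1,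
        current_psi (by omega), map_smul, psiLin_apply, psiLin_apply, ← smul_sub,
        ← hamiltonianCoeff, Nat.cast_add, ← sub_sub, add_sub_cancel_left])
    (fun i hi r hr w S d hd => smul_mem_degreeFil hr (q := 0)
      (fun _ _ h => absurd h (Nat.not_lt_zero _)) S d (by omega)) v
  simpa using key

end Hamiltonian

end

end StableGrothendieck

namespace StableGrothendieck

noncomputable section

/-! ### The action of e^Θ on the shifted vacua. -/

section Kets

variable {k : Type*} [Field k] {σ : Type*}

theorem Maya.mem_vacuum {j : ℤ} : j ∈ Maya.vacuum.1 ↔ j < 0 := Iff.rfl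

open Classical in
theorem ketNeg_apply (l : ℕ) (S : Maya) :
    (ketNeg l : Fock k σ) S = if ∀ j, j ∈ S.1 ↔ j < -(l : ℤ) then 1 else 0 := by
  induction l generalizing S with
  | zero =>
    rw [ketNeg]
    refine if_congr ?_ rfl rfl
    constructor
    · rintro rfl j
      simp [Maya.mem_vacuum]
    · intro h
      refine Maya.ext fun j => ?_
      rw [h, Maya.mem_vacuum]
      simp
  | succ l ih =>
    rw [ketNeg]
    by_cases h : -((l : ℤ) + 1) ∈ S.1
    · rw [psiStar_apply_of_mem h, if_neg]
      intro h'
      have := (h' _).1 h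
      push_cast at this
      omega
    · rw [psiStar_apply_of_notMem h, ih]
      by_cases h' : ∀ j, j ∈ S.1 ↔ j < -((l + 1 : ℕ) : ℤ)
      · rw [if_pos h', if_pos]
        · have : S.sign (-((l : ℤ) + 1)) = 1 := by
            rw [Maya.sign]
            have h0 : {m | m ∈ S.1 ∧ -((l : ℤ) + 1) < m} = ∅ := by
              refine Set.eq_empty_of_forall_notMem fun j hj => ?_
              have h1 := (h' j).1 hj.1
              have h2 := hj.2
              push_cast at h1
              omega
            rw [h0, Set.ncard_empty, pow_zero]
          rw [this, one_smul]
        · intro j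
          rw [Maya.mem_insert, h']
          push_cast
          omega
      · rw [if_neg h', if_neg, smul_zero]
        intro h2
        refine h' fun j => ?_
        have h3 := h2 j
        rw [Maya.mem_insert] at h3
        push_cast
        by_cases hj : j = -((l : ℤ) + 1)
        · subst hj
          exact iff_of_false h (by omega)
        · constructor
          · intro h4
            have := h3.1 (Or.inl h4)
            omega
          · intro h4
            exact (h3.2 (by omega)).resolve_right hj

theorem ketNeg_apply_eq_zero {l : ℕ} {S : Maya} {j : ℤ} (h : ¬ (j ∈ S.1 ↔ j < -(l : ℤ))) :
    (ketNeg l : Fock k σ) S = 0 := by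
  classical
  rw [ketNeg_apply, if_neg fun h' => h (h' j)]

theorem psi_ketNeg_eq_zero {l : ℕ} {a : ℤ} (h : a < -(l : ℤ)) :
    psi a (ketNeg l : Fock k σ) = 0 := by
  funext S
  by_cases ha : a ∈ S.1
  · rw [psi_apply_of_mem ha, ketNeg_apply_eq_zero (j := a), smul_zero, Pi.zero_apply]
    simp [h]
  · rw [psi_apply_of_notMem ha, Pi.zero_apply]

theorem psi_ketNeg_succ (l : ℕ) :
    psi (-((l : ℤ) + 1)) (ketNeg (l + 1) : Fock k σ) = ketNeg l := by
  classical
  funext S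
  rw [ketNeg, psi_psiStar_self_apply]
  split_ifs with h
  · rfl
  · refine (ketNeg_apply_eq_zero (j := -((l : ℤ) + 1)) fun h' => h (h'.2 ?_)).symm
    omega

variable (k σ) in
/-- The vectors whose coefficients at all configurations containing the integers below `-M`
vanish. -/
def unfilled (M : ℕ) : Submodule (MvPowerSeries σ k) (Fock k σ) :=
  coordFil (fun S _ => S.IsFilled M) fun _ _ _ _ h => h

theorem mem_unfilled {M : ℕ} {v : Fock k σ} :
    v ∈ unfilled k σ M ↔ ∀ S : Maya, S.IsFilled M → v S = 0 :=
  ⟨fun h S h1 => MvPowerSeries.ext fun d => h S d h1, fun h S d hS => by rw [h S hS, map_zero]⟩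

theorem psi_mem_unfilled {M : ℕ} {a : ℤ} (ha : -(M : ℤ) ≤ a) {v : Fock k σ}
    (hv : v ∈ unfilled k σ M) : psi a v ∈ unfilled k σ M := by
  rw [mem_unfilled] at hv ⊢
  intro S hS
  by_cases h : a ∈ S.1
  · rw [psi_apply_of_mem h, hv _ (hS.erase ha), smul_zero]
  · exact psi_apply_of_notMem h v

theorem Theta_apply_eq_zero (β : k) {v : Fock k σ} {S : Maya}
    (h : ∀ m : ℕ, 1 ≤ m → ∀ j ∈ S.movable (-(m : ℤ)), v (S.move (-(m : ℤ)) j) = 0) :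
    Theta β v S = 0 := by
  obtain ⟨N, hN⟩ := S.movable_neg_eq_empty
  rw [Theta_apply β v S (p := N + 1) fun m hm => hN m hm]
  refine Finset.sum_eq_zero fun m hm => ?_
  have hm1 := (Finset.mem_Ico.1 hm).1
  rw [lowerLin_apply hm1, current_apply_eq_zero (by omega) (h m hm1), smul_zero]

theorem Theta_mem_unfilled (β : k) {M : ℕ} {v : Fock k σ} (hv : v ∈ unfilled k σ M) :
    Theta β v ∈ unfilled k σ M := by
  rw [mem_unfilled] at hv ⊢
  exact fun S hS => Theta_apply_eq_zero β fun m hm j hj => hv _ (hS.move (by omega) hj)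

theorem expTheta_mem_unfilled (β : k) {M : ℕ} {v : Fock k σ} (hv : v ∈ unfilled k σ M) :
    expOp (Theta β) v ∈ unfilled k σ M :=
  fun S d h => coeff_expOp_eq_zero (P := fun S _ => S.IsFilled M)
    (fun _ hw => Theta_mem_unfilled β hw) hv S d h

/-- If S is filled below -l, a particle lowered within S lands on a vacant site, hence at or above
-l. The new configuration has a particle there and is not that of |-l⟩. -/
theorem Theta_ketNeg_mem (β : k) (l : ℕ) : Theta β (ketNeg l : Fock k σ) ∈ unfilled k σ l := by
  rw [mem_unfilled]
  refine fun S hS => Theta_apply_eq_zero β fun m hm j hj => ?_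
  refine ketNeg_apply_eq_zero (j := j + -(m : ℤ)) fun h => ?_
  have h1 := h.1 (Or.inr rfl)
  have h2 := hS.le_of_notMem hj.2
  omega

theorem expTheta_ketNeg_sub_mem (β : k) (l : ℕ) :
    expOp (Theta β) (ketNeg l : Fock k σ) - ketNeg l ∈ unfilled k σ l := by
  have hpow : ∀ j, (Theta β)^[j + 1] (ketNeg l : Fock k σ) ∈ unfilled k σ l := by
    intro j
    induction j with
    | zero => exact Theta_ketNeg_mem β l
    | succ j ih => rw [Function.iterate_succ', Function.comp_apply]; exact Theta_mem_unfilled β ih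
  intro S d hS
  rw [Pi.sub_apply, map_sub, sub_eq_zero]
  refine (finsum_eq_single _ 0 fun j hj => ?_).trans ?_
  · obtain ⟨i, rfl⟩ : ∃ i, j = i + 1 := ⟨j - 1, by omega⟩
    beta_reduce
    rw [Pi.smul_apply, map_smul, hpow i S d hS, smul_zero]
  · simp

/-- This makes trailing zero parts harmless. For a < -(l+1), e^Θ ψ_a |-l-1⟩ = 0 gives ψ_a u = -β
ψ_{a+1} u, and these relations suppress every configuration with a hole below. -/
theorem psi_expTheta_ketNeg_succ [CharZero k] {β : k} (hβ : β ≠ 0) (l : ℕ) :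
    psi (-((l : ℤ) + 1)) (expOp (Theta β) (ketNeg (l + 1) : Fock k σ)) = ketNeg l := by
  set u : Fock k σ := expOp (Theta β) (ketNeg (l + 1)) with hu
  have hstep : ∀ a : ℤ, a < -((l : ℤ) + 1) →
      psi a u = - ((MvPowerSeries.C β : MvPowerSeries σ k) • psi (a + 1) u) := by
    intro a ha
    have h1 := expTheta_psi β a (ketNeg (l + 1) : Fock k σ)
    rw [psi_ketNeg_eq_zero (by push_cast; omega), ← expThetaLin_apply, map_zero, ← hu] at h1
    exact eq_neg_of_add_eq_zero_left h1.symm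
  -- At a configuration without the site a, ψ_a u vanishes. Starting at the hole, the relation
  -- carries this vanishing up to -(l+1), with one division by β per site.
  have hzero : ∀ (S : Maya) (r : ℕ), -((l : ℤ) + 1) - r ∉ S.1 → psi (-((l : ℤ) + 1)) u S = 0 := by
    intro S r hr
    have hall : ∀ i : ℕ, i ≤ r → psi (-((l : ℤ) + 1) - (r - i : ℕ)) u S = 0 := by
      intro i
      induction i with
      | zero => intro _; exact psi_apply_of_notMem (by simpa using hr) u
      | succ i ih =>
        intro hi
        have h2 := congrFun (hstep (-((l : ℤ) + 1) - (r - i : ℕ)) (by omega)) S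
        rw [ih (by omega), Pi.neg_apply, Pi.smul_apply, eq_comm, neg_eq_zero, smul_eq_mul,
          ← MvPowerSeries.smul_eq_C_mul, smul_eq_zero] at h2
        convert h2.resolve_left hβ using 2
        omega
    simpa using hall r le_rfl
  funext S
  by_cases hS : ∀ r : ℕ, -((l : ℤ) + 1) - r ∈ S.1
  · have h0 : -((l : ℤ) + 1) ∈ S.1 := by simpa using hS 0
    have hfill : (S.erase (-((l : ℤ) + 1))).IsFilled (l + 1) := by
      intro j hj
      push_cast at hj
      refine ⟨?_, by rw [Set.mem_singleton_iff]; omega⟩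
      have := hS (-((l : ℤ) + 1) - j).toNat
      rwa [Int.toNat_of_nonneg (by omega), sub_sub_cancel] at this
    have h1 := mem_unfilled.1 (expTheta_ketNeg_sub_mem (σ := σ) β (l + 1)) _ hfill
    rw [Pi.sub_apply, sub_eq_zero] at h1
    rw [psi_apply_of_mem h0, hu, h1, ← psi_apply_of_mem h0, psi_ketNeg_succ]
  · push Not at hS
    obtain ⟨r, hr⟩ := hS
    rw [hzero S r hr, ketNeg_apply_eq_zero (j := -((l : ℤ) + 1) - r)]
    intro h
    exact hr (h.2 (by omega))

end Kets

/-! ### The functional ⟨0|e^H in n variables. -/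

section Vev

variable {k : Type*} [Field k] [CharZero k] {n : ℕ}

variable (k n) in
/-- The functional `⟨0| e^H`. -/
def vevLin : Fock k (Fin n) →ₗ[MvPowerSeries (Fin n) k] MvPowerSeries (Fin n) k :=
  LinearMap.proj Maya.vacuum ∘ₗ expHamiltonianLin

theorem vevLin_apply (v : Fock k (Fin n)) :
    vevLin k n v = vacuumPairing (expOp Hamiltonian v) := rfl

theorem natDegree_reverseProd_le {R : Type*} [CommRing R] {ι : Type*} [Fintype ι] (y : ι → R) :
    (reverseProd y).natDegree ≤ Fintype.card ι := by
  refine (Polynomial.natDegree_prod_le _ _).trans ?_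
  refine (Finset.sum_le_card_nsmul _ _ 1 fun i _ => ?_).trans (by simp)
  compute_degree

/-- Commuting ψ*_b past e^H yields ψ*_{b+i} with i ≤ n only. All these indices are negative, and
⟨0|ψ*_c = 0 for c < 0. -/
theorem vevLin_psiStar {b : ℤ} (hb : b < -(n : ℤ)) (v : Fock k (Fin n)) :
    vevLin k n (psiStar b v) = 0 := by
  rw [vevLin_apply, expHamiltonian_psiStar, vacuumPairing, Polynomial.sum, Finset.sum_apply]
  refine Finset.sum_eq_zero fun i hi => ?_
  have h1 : i ≤ (reverseProd MvPowerSeries.X).natDegree := Polynomial.le_natDegree_of_mem_supp i hi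
  have h2 := natDegree_reverseProd_le (MvPowerSeries.X : Fin n → MvPowerSeries (Fin n) k)
  rw [Fintype.card_fin] at h2
  rw [Pi.smul_apply, psiStar_apply_of_mem (Maya.mem_vacuum.2 (by omega)), smul_zero]

theorem vevLin_sum_psi {a : ℤ} (ha : 0 ≤ a) (v : Fock k (Fin n)) :
    vevLin k n ((elemPoly k n).sum fun i r => r • psi (a - i) v) = 0 := by
  rw [vevLin_apply, expHamiltonian_psi, vacuumPairing, psi_apply_of_notMem]
  rw [Maya.mem_vacuum]
  omega

/-- v = ψ_j ψ*_j v + ψ*_j ψ_j v splits v into parts with the site j occupied and vacant. For j < -n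
the vacant part has zero expectation; it is discarded for each j from -n-1 down to -M. -/
theorem vevLin_eq_of_zero_of_notMem {M : ℕ} (hM : n ≤ M) (v : Fock k (Fin n)) :
    ∃ w, vevLin k n w = vevLin k n v ∧ (∀ S, v S = 0 → w S = 0) ∧
      ∀ S : Maya, (∃ j, -(M : ℤ) ≤ j ∧ j < -(n : ℤ) ∧ j ∉ S.1) → w S = 0 := by
  classical
  induction hM with
  | refl => exact ⟨v, rfl, fun _ h => h, fun S ⟨j, h1, h2, _⟩ => by omega⟩
  | @step M hM ih =>
    obtain ⟨w, h1, h2, h3⟩ := ih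
    have happ : ∀ S : Maya, psi (-((M : ℤ) + 1)) (psiStar (-((M : ℤ) + 1)) w) S =
      if -((M : ℤ) + 1) ∈ S.1 then w S else 0 := fun S => psi_psiStar_self_apply _ _ _
    refine ⟨psi (-((M : ℤ) + 1)) (psiStar (-((M : ℤ) + 1)) w), ?_, fun S hS => ?_,
      fun S ⟨j, hj1, hj2, hj3⟩ => ?_⟩
    · have hn : n ≤ M := hM
      rw [← h1]
      conv_rhs => rw [← psi_psiStar_add_psiStar_psi_self (-((M : ℤ) + 1)) w]
      rw [map_add, vevLin_psiStar (by omega), add_zero]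
    · rw [happ, h2 S hS, ite_self]
    · rw [happ]
      split_ifs with hmem
      · refine h3 S ⟨j, ?_, hj2, hj3⟩
        have : j ≠ -((M : ℤ) + 1) := by rintro rfl; exact hj3 hmem
        push_cast at hj1
        omega
      · rfl

/-- Raising a particle by m costs degree at least m in the variables, and opens holes at depth at
most m further down. With total degree at most M, ⟨0|e^H evaluates v only at configurations filled
below -M. The predicate `P` keeps the depth q already reached and the remaining degree at constant
sum M. -/
theorem coeff_vevLin_eq_zero {M : ℕ} {v : Fock k (Fin n)} (hv : v ∈ unfilled k (Fin n) M)
    {d : Fin n →₀ ℕ} (hd : d.degree ≤ M) : MvPowerSeries.coeff d (vevLin k n v) = 0 := by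
  refine coeff_expOp_eq_zero (P := fun S d => ∃ q, q + d.degree = M ∧ S.IsFilled q)
    (A := Hamiltonian) ?_ ?_ Maya.vacuum d ⟨M - d.degree, by omega, fun j hj => ?_⟩
  · rintro w hw S d ⟨q, hq, hS⟩
    refine finsum_eq_zero_of_forall_eq_zero fun m => ?_
    have hm : (1 : ℕ) ≤ m := m.2
    have h1 : ∀ e, e.degree < (m : ℕ) → MvPowerSeries.coeff e (((m : ℕ) : k)⁻¹ • ∑ i : Fin n,
        (MvPowerSeries.X i : MvPowerSeries (Fin n) k) ^ (m : ℕ)) = 0 := by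
      have := coeff_eq_zero_of_mem_varIdeal_pow (hamiltonianCoeff_mem (k := k) (n := n) m)
      rwa [hamiltonianCoeff, ← natCast_inv_smul (k := k)] at this
    classical
    beta_reduce
    rw [Pi.smul_apply, smul_eq_mul, MvPowerSeries.coeff_mul]
    refine Finset.sum_eq_zero fun x hx => ?_
    have hdeg : x.1.degree + x.2.degree = d.degree := by
      rw [← map_add, Finset.HasAntidiagonal.mem_antidiagonal.1 hx]
    rcases lt_or_ge x.1.degree (m : ℕ) with h | h
    · rw [h1 _ h, zero_mul]
    · rw [current_apply (by omega), ← finsum_coeff _ (finite_support_psi_psiStar (by omega) w S),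
        finsum_eq_zero_of_forall_eq_zero, mul_zero]
      intro j
      by_cases hj : j ∈ S.movable (m : ℕ)
      · rw [psi_psiStar_apply_of_movable hj, map_zsmul, hw _ _ ⟨M - x.2.degree, by omega, ?_⟩,
          smul_zero]
        intro i hi
        have := hS.le_of_notMem hj.2
        refine Or.inl ⟨hS i (by omega), ?_⟩
        rw [Set.mem_singleton_iff]
        omega
      · rw [psi_psiStar_apply_eq_zero (by omega) hj, map_zero]
  · rintro S d ⟨q, hq, hS⟩
    rw [mem_unfilled.1 hv S fun j hj => hS j (by omega), map_zero]
  · rw [Maya.mem_vacuum]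
    omega

/-- In `n` variables, `⟨0| e^H` vanishes on all vectors that have no component containing all
integers below `-n`. -/
theorem vevLin_eq_zero_of_mem_unfilled {v : Fock k (Fin n)} (hv : v ∈ unfilled k (Fin n) n) :
    vevLin k n v = 0 := by
  ext d
  -- With M ≥ `d.degree`, only configurations filled below -M matter for this coefficient. Such a
  -- configuration is either filled below -n, where v vanishes, or has a hole between -M and -n,
  -- where w vanishes.
  obtain ⟨w, h1, h2, h3⟩ := vevLin_eq_of_zero_of_notMem (le_max_left n d.degree) v
  rw [← h1, map_zero]
  refine coeff_vevLin_eq_zero (M := max n d.degree) (mem_unfilled.2 fun S hS => ?_)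
    (le_max_right _ _)
  by_cases h : S.IsFilled n
  · exact h2 S (mem_unfilled.1 hv S h)
  · rw [Maya.IsFilled] at h
    push Not at h
    obtain ⟨j, hj, hjS⟩ := h
    exact h3 S ⟨j, hS.le_of_notMem hjS, hj, hjS⟩

theorem vevLin_ketNeg_zero : vevLin k n (ketNeg 0) = 1 := by
  have h0 : Hamiltonian (ketNeg 0 : Fock k (Fin n)) = 0 := by
    funext S
    ext d
    refine finsum_eq_zero_of_forall_eq_zero fun m => ?_
    have hm : (1 : ℕ) ≤ m := m.2
    beta_reduce
    rw [Pi.smul_apply, current_apply_eq_zero (by omega), smul_zero, map_zero]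
    intro j hj
    by_cases h : j < 0
    · refine ketNeg_apply_eq_zero (j := j) fun h' => ?_
      rcases h'.2 (by simpa using h) with h2 | h2
      · exact h2.2 rfl
      · rw [Set.mem_singleton_iff] at h2
        omega
    · refine ketNeg_apply_eq_zero (j := j + (m : ℕ)) fun h' => ?_
      have := h'.1 (Or.inr rfl)
      omega
  have hpow : ∀ j, Hamiltonian^[j + 1] (ketNeg 0 : Fock k (Fin n)) = 0 := by
    intro j
    induction j with
    | zero => exact h0
    | succ j ih => rw [Function.iterate_succ', Function.comp_apply, ih, ← hamiltonianLin_apply,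
        map_zero]
  ext d
  refine (finsum_eq_single _ 0 fun j hj => ?_).trans ?_
  · obtain ⟨i, rfl⟩ : ∃ i, j = i + 1 := ⟨j - 1, by omega⟩
    beta_reduce
    rw [hpow, smul_zero, Pi.zero_apply, map_zero]
  · simp [ketNeg]

end Vev

end

end StableGrothendieck

namespace StableGrothendieck

noncomputable section

/-! ### Fermion fields indexed by polynomials. -/

section FermionField

open Polynomial

variable {k : Type*} [Field k] {σ : Type*}

/-- The field `∑ f_i ψ_{i - l}` attached to a polynomial `f`. -/
def fermionField (l : ℕ) : (MvPowerSeries σ k)[X] →ₗ[MvPowerSeries σ k]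
    Module.End (MvPowerSeries σ k) (Fock k σ) :=
  Polynomial.lsum fun i => LinearMap.toSpanSingleton _ _ (psiLin ((i : ℤ) - l))

theorem fermionField_eq_sum (l : ℕ) (f : (MvPowerSeries σ k)[X]) :
    fermionField l f = f.sum fun i r => r • psiLin ((i : ℤ) - l) := rfl

theorem fermionField_monomial (l i : ℕ) (r : MvPowerSeries σ k) :
    fermionField l (monomial i r) = r • psiLin ((i : ℤ) - l) := by
  rw [fermionField_eq_sum]
  exact sum_monomial_index _ _ (zero_smul _ _)

theorem fermionField_X_pow (l i : ℕ) (v : Fock k σ) :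
    fermionField l (X ^ i) v = psi ((i : ℤ) - l) v := by
  rw [X_pow_eq_monomial, fermionField_monomial, one_smul, psiLin_apply]

/-- The fields anticommute and 2 is invertible. Square zero is what the universal property of the
exterior algebra needs in `vevForm`. -/
theorem fermionField_mul_self [CharZero k] (l : ℕ) (f : (MvPowerSeries σ k)[X]) :
    fermionField l f * fermionField l f = 0 := by
  have h : ∀ f g : (MvPowerSeries σ k)[X],
      fermionField l f * fermionField l g = -(fermionField l g * fermionField l f) := by
    intro f g
    induction f using Polynomial.induction_on' with
    | add f₁ f₂ h₁ h₂ =>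
      rw [map_add, add_mul, h₁, h₂, mul_add, neg_add]
    | monomial i r =>
      induction g using Polynomial.induction_on' with
      | add g₁ g₂ h₁ h₂ => rw [map_add, mul_add, h₁, h₂, add_mul, neg_add]
      | monomial j s =>
        refine LinearMap.ext fun v => ?_
        rw [fermionField_monomial, fermionField_monomial, LinearMap.neg_apply]
        simp only [Module.End.mul_apply, LinearMap.smul_apply, map_smul, psiLin_apply]
        rw [psi_psi, smul_neg, smul_neg, smul_comm]
  have h2 := h f f
  rw [eq_neg_iff_add_eq_zero, ← two_nsmul] at h2
  refine LinearMap.ext fun v => ?_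
  funext S
  ext d
  have h3 := congrArg (MvPowerSeries.coeff d) (congrFun (LinearMap.congr_fun h2 v) S)
  rw [LinearMap.smul_apply, Pi.smul_apply, map_nsmul] at h3
  simpa using h3

theorem expTheta_fermionField [CharZero k] (β : k) (l : ℕ) (f : (MvPowerSeries σ k)[X])
    (v : Fock k σ) : expThetaLin β (fermionField l f v) =
      fermionField l ((1 + C (MvPowerSeries.C β) * X) * f) (expThetaLin β v) := by
  induction f using Polynomial.induction_on' with
  | add f g hf hg =>
    rw [map_add, LinearMap.add_apply, map_add, hf, hg, mul_add, map_add, LinearMap.add_apply]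
  | monomial i r =>
    have h : (1 + C (MvPowerSeries.C β) * X) * monomial i r =
        monomial i r + monomial (i + 1) (MvPowerSeries.C β * r) := by
      rw [add_mul, one_mul, ← monomial_one_one_eq_X, C_mul_monomial, monomial_mul_monomial,
        mul_one, add_comm 1 i]
    rw [h, map_add, fermionField_monomial, fermionField_monomial, LinearMap.smul_apply, map_smul,
      psiLin_apply, expThetaLin_apply, expTheta_psi, LinearMap.add_apply, LinearMap.smul_apply,
      LinearMap.smul_apply, psiLin_apply, psiLin_apply, smul_add, smul_smul, mul_comm r]
    rw [show ((i + 1 : ℕ) : ℤ) - l = (i : ℤ) - l + 1 by push_cast; ring]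
    rfl

theorem fermionField_mem_unfilled (l : ℕ) (f : (MvPowerSeries σ k)[X]) {v : Fock k σ}
    (hv : v ∈ unfilled k σ l) : fermionField l f v ∈ unfilled k σ l := by
  rw [fermionField_eq_sum, Polynomial.sum, LinearMap.sum_apply]
  exact sum_mem fun i _ => Submodule.smul_mem _ _ (psi_mem_unfilled (by omega) hv)

/-- `ψ(f_1) ⋯ ψ(f_r)`. -/
def fermionProd (l : ℕ) (L : List (MvPowerSeries σ k)[X]) :
    Module.End (MvPowerSeries σ k) (Fock k σ) := (L.map (fermionField l)).prod

theorem fermionProd_cons (l : ℕ) (f : (MvPowerSeries σ k)[X]) (L : List (MvPowerSeries σ k)[X])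
    (v : Fock k σ) : fermionProd l (f :: L) v = fermionField l f (fermionProd l L v) := by
  rw [fermionProd, List.map_cons, List.prod_cons, Module.End.mul_apply, fermionProd]

theorem fermionProd_mem_unfilled (l : ℕ) (L : List (MvPowerSeries σ k)[X]) {v : Fock k σ}
    (hv : v ∈ unfilled k σ l) : fermionProd l L v ∈ unfilled k σ l := by
  induction L with
  | nil => exact hv
  | cons f L ih => rw [fermionProd_cons]; exact fermionField_mem_unfilled l f ih

theorem expTheta_fermionProd [CharZero k] (β : k) (l : ℕ) (L : List (MvPowerSeries σ k)[X])
    (v : Fock k σ) : expThetaLin β (fermionProd l L v) =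
      fermionProd l (L.map fun f => (1 + C (MvPowerSeries.C β) * X) * f) (expThetaLin β v) := by
  induction L with
  | nil => rfl
  | cons f L ih => rw [fermionProd_cons, expTheta_fermionField, ih, List.map_cons, fermionProd_cons]

/-- Up to vectors without components containing all integers below `-l`, the operators `e^Θ` in
`ψ(f_1) e^Θ ψ(f_2) e^Θ ⋯ |-l⟩` can be moved to the right and absorbed. -/
theorem foldr_fermionField_sub_mem [CharZero k] (β : k) (l : ℕ) {r : ℕ}
    (f : Fin r → (MvPowerSeries σ k)[X]) :
    (List.ofFn f).foldr (fun g v => fermionField l g (expOp (Theta β) v)) (ketNeg l) -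
      fermionProd l (List.ofFn fun i => (1 + C (MvPowerSeries.C β) * X) ^ (i : ℕ) * f i)
        (ketNeg l) ∈ unfilled k σ l := by
  induction r with
  | zero =>
    rw [List.ofFn_zero, List.ofFn_zero]
    have : (ketNeg l : Fock k σ) - ketNeg l ∈ unfilled k σ l := by
      rw [sub_self]
      exact zero_mem _
    exact this
  | succ r ih =>
    set v : Fock k σ := (List.ofFn fun i => f (Fin.succ i)).foldr
      (fun g v => fermionField l g (expOp (Theta β) v)) (ketNeg l) with hv
    set L := List.ofFn fun i : Fin r =>
      (1 + C (MvPowerSeries.C β) * X) ^ (i : ℕ) * f i.succ with hL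
    have h1 : v - fermionProd l L (ketNeg l) ∈ unfilled k σ l := ih fun i => f i.succ
    -- Two errors arise: the one from the shorter product, and the one from replacing e^Θ |-l⟩ by
    -- |-l⟩. Both stay in `unfilled`, which is stable under e^Θ and under the fields, all of whose
    -- indices are at least -l.
    have h2 := expTheta_mem_unfilled β h1
    rw [← expThetaLin_apply, map_sub, expTheta_fermionProd] at h2
    have h3 := fermionProd_mem_unfilled l (L.map fun f => (1 + C (MvPowerSeries.C β) * X) * f)
      (expTheta_ketNeg_sub_mem (σ := σ) β l)
    rw [map_sub] at h3
    have h4 := fermionField_mem_unfilled l (f 0) (add_mem h2 h3)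
    rw [expThetaLin_apply, expThetaLin_apply, sub_add_sub_cancel, map_sub] at h4
    rw [List.ofFn_succ, List.ofFn_succ, List.foldr_cons, fermionProd_cons]
    convert h4 using 3
    · simp
    · rw [hL, List.map_ofFn]
      refine congrArg (fun h => fermionProd l (List.ofFn h) (ketNeg l)) (funext fun i => ?_)
      rw [Function.comp_apply, Fin.val_succ, pow_succ', mul_assoc]

end FermionField

/-! ### Alternating forms on polynomials modulo ∏(X - y_i). -/

section Alternants

open Polynomial

theorem reflect_reverseProd {S : Type*} [CommRing S] {n : ℕ} (y : Fin n → S) :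
    reflect n (reverseProd y) = ∏ i, (X - C (y i)) := by
  induction n with
  | zero => simp [reverseProd]
  | succ n ih =>
    have h1 : reverseProd y = reverseProd (fun i => y (Fin.castSucc i)) *
        (1 - C (y (Fin.last n)) * X) := Fin.prod_univ_castSucc _
    have h2 : reflect 1 (1 - C (y (Fin.last n)) * X) = X - C (y (Fin.last n)) := by
      have h3 := reflect_C_mul_X_pow 1 1 (c := y (Fin.last n))
      rw [revAt_le le_rfl, Nat.sub_self, pow_zero, mul_one, pow_one] at h3
      rw [reflect_sub, reflect_one, pow_one, h3]
    have h3 := natDegree_reverseProd_le fun i : Fin n => y (Fin.castSucc i)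
    rw [Fintype.card_fin] at h3
    rw [h1, reflect_mul _ _ h3 (by compute_degree), ih, h2, Fin.prod_univ_castSucc]

/-- An alternating form on `S[X]` that vanishes if one of its arguments is a multiple of
`∏ (X - y_i)` is a multiple of `det (g_j(y_i))`. -/
theorem alternatingMap_mul_det {S : Type*} [CommRing S] [Nontrivial S] {n : ℕ} (y : Fin n → S)
    (Φ : S[X] [⋀^Fin n]→ₗ[S] S)
    (hΦ : ∀ (g : Fin n → S[X]) (j : Fin n), ∏ i, (X - C (y i)) ∣ g j → Φ g = 0)
    (g h : Fin n → S[X]) :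
    Φ g * Matrix.det (Matrix.of fun i j => (h j).eval (y i)) =
      Φ h * Matrix.det (Matrix.of fun i j => (g j).eval (y i)) := by
  classical
  set P : S[X] := ∏ i, (X - C (y i)) with hP
  have hmonic : P.Monic := monic_prod_of_monic _ _ fun i _ => monic_X_sub_C (y i)
  have hdeg : P.degree = n := by
    rw [hP, degree_prod_of_monic _ _ fun i _ => monic_X_sub_C (y i)]
    simp
  have hred : ∀ f : S[X], f %ₘ P = ∑ l : Fin n, C ((f %ₘ P).coeff l) * X ^ (l : ℕ) := by
    intro f
    ext m
    rw [Fin.sum_univ_eq_sum_range fun l => C ((f %ₘ P).coeff l) * X ^ l]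
    simp only [finsetSum_coeff, coeff_C_mul_X_pow, Finset.sum_ite_eq, Finset.mem_range]
    split_ifs with h
    · rfl
    · refine coeff_eq_zero_of_degree_lt ((degree_modByMonic_lt f hmonic).trans_le ?_)
      rw [hdeg]
      exact_mod_cast not_lt.1 h
  -- Replacing one argument by its remainder changes Φ by a value with an argument divisible by P,
  -- that is, by zero.
  have hswap : ∀ (s : Finset (Fin n)) (g : Fin n → S[X]),
      Φ (s.piecewise (fun j => g j %ₘ P) g) = Φ g := by
    intro s g
    induction s using Finset.induction_on with
    | empty => rw [Finset.piecewise_empty]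
    | insert j s hj ih =>
      rw [Finset.piecewise_insert, ← ih, ← sub_eq_zero]
      set u := s.piecewise (fun j => g j %ₘ P) g with hu
      have h1 : Φ u = Φ (Function.update u j (g j)) := by
        congr 1
        rw [eq_comm, Function.update_eq_self_iff, hu, Finset.piecewise_eq_of_notMem _ _ _ hj]
      rw [h1, ← Φ.map_update_sub]
      refine hΦ _ j ?_
      rw [Function.update_self]
      exact ⟨-(g j /ₘ P), by rw [modByMonic_eq_sub_mul_div]; ring⟩
  set τ : (Fin n → S) →ₗ[S] S[X] := ∑ l : Fin n,
    (Polynomial.monomial (l : ℕ)) ∘ₗ LinearMap.proj l with hτ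
  set ρ : (Fin n → S[X]) → Fin n → Fin n → S := fun g j l => (g j %ₘ P).coeff l with hρ
  -- The remainders form a free module of rank n, on which an alternating n-form is a multiple of
  -- the determinant of coordinates.
  have key1 : ∀ g, Φ g = (Φ.compLinearMap τ) (Pi.basisFun S (Fin n)) * (Matrix.of (ρ g)).det := by
    intro g
    have h1 : Φ g = Φ.compLinearMap τ (ρ g) := by
      rw [← hswap Finset.univ g, Finset.piecewise_univ, AlternatingMap.compLinearMap_apply]
      congr 1
      funext j
      rw [hred (g j), hτ, LinearMap.sum_apply]
      refine Finset.sum_congr rfl fun l _ => ?_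
      rw [LinearMap.comp_apply, LinearMap.proj_apply, C_mul_X_pow_eq_monomial]
    rw [h1]
    conv_lhs => rw [(Φ.compLinearMap τ).eq_smul_basis_det (Pi.basisFun S (Fin n))]
    rw [AlternatingMap.smul_apply, smul_eq_mul, Pi.basisFun_det]
    rfl
  -- Evaluation at a root of P sees only the remainder, so the matrix of values is the Vandermonde
  -- matrix times the coefficient matrix.
  have key2 : ∀ g : Fin n → S[X], Matrix.det (Matrix.of fun i j => (g j).eval (y i)) =
      (Matrix.vandermonde y).det * (Matrix.of (ρ g)).det := by
    intro g
    rw [← Matrix.det_transpose (Matrix.of (ρ g)), ← Matrix.det_mul]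
    congr 1
    ext i j
    have hroot : P.eval (y i) = 0 := by
      rw [hP, eval_prod]
      exact Finset.prod_eq_zero (Finset.mem_univ i) (by simp)
    have hmod := congrArg (eval (y i)) (modByMonic_add_div (g j) P)
    rw [eval_add, eval_mul, hroot, zero_mul, add_zero] at hmod
    rw [Matrix.of_apply, Matrix.mul_apply, ← hmod, hred (g j), eval_finsetSum]
    refine Finset.sum_congr rfl fun l _ => ?_
    rw [Matrix.vandermonde_apply, Matrix.transpose_apply, eval_mul, eval_C, eval_pow, eval_X,
      mul_comm]
    rfl
  rw [key1 g, key1 h, key2 g, key2 h]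
  ring

end Alternants

end

end StableGrothendieck

namespace StableGrothendieck

noncomputable section

/-! ### The expectation value as a quotient of alternants. -/

section VevForm

open Polynomial

variable {k : Type*} [Field k] {n : ℕ}

theorem prod_X_sub_eq_sum :
    ∏ i : Fin n, (X - C (MvPowerSeries.X i : MvPowerSeries (Fin n) k)) =
      ∑ i ∈ Finset.range (n + 1), C ((elemPoly k n).coeff i) * X ^ (n - i) := by
  have hdeg := natDegree_reverseProd_le (MvPowerSeries.X : Fin n → MvPowerSeries (Fin n) k)
  rw [Fintype.card_fin] at hdeg
  rw [← reflect_reverseProd]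
  ext1 m
  rw [coeff_reflect]
  simp only [finsetSum_coeff, coeff_C_mul_X_pow]
  rcases le_or_gt m n with hm | hm
  · rw [revAt_le hm, Finset.sum_eq_single (n - m)]
    · rw [if_pos (by omega)]
    · intro i hi him
      rw [if_neg]
      have := Finset.mem_range.1 hi
      omega
    · intro h
      exact absurd (Finset.mem_range.2 (by omega)) h
  · rw [revAt_eq_self_of_lt hm, coeff_eq_zero_of_natDegree_lt (hdeg.trans_lt hm),
      Finset.sum_eq_zero]
    intro i _
    rw [if_neg (by omega)]

/-- The exponent l - 1 - j stands for ψ_{-1-j}, so the product ψ_{-1} ⋯ ψ_{-r} refills exactly the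
sites emptied in |-r⟩. Keeping l apart from r makes the induction possible. -/
theorem fermionProd_staircase {σ : Type*} (l : ℕ) {r : ℕ} (hr : r ≤ l) :
    fermionProd l (List.ofFn fun j : Fin r => (X : (MvPowerSeries σ k)[X]) ^ (l - 1 - (j : ℕ)))
      (ketNeg r) = ketNeg 0 := by
  induction r with
  | zero => rfl
  | succ r ih =>
    rw [List.ofFn_succ', List.concat_eq_append, fermionProd, List.map_append, List.prod_append,
      List.map_singleton, List.prod_singleton, Module.End.mul_apply, fermionField_X_pow]
    have h : ((l - 1 - (Fin.last r : ℕ) : ℕ) : ℤ) - l = -((r : ℤ) + 1) := by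
      rw [Fin.val_last]
      omega
    rw [h, psi_ketNeg_succ]
    exact ih (by omega)

theorem det_pow_staircase {S : Type*} [CommRing S] (y : Fin n → S) :
    Matrix.det (Matrix.of fun i j : Fin n => y i ^ (n - 1 - (j : ℕ))) =
      ∏ i : Fin n, ∏ j ∈ Finset.Ioi i, (y i - y j) := by
  have h := Matrix.det_projVandermonde (1 : Fin n → S) y
  simp only [Pi.one_apply, one_mul] at h
  rw [← h]
  congr 1
  ext i j
  rw [Matrix.of_apply, Matrix.projVandermonde_apply, Pi.one_apply, one_pow, one_mul, Fin.val_rev]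
  congr 1
  omega

theorem coe_vandermonde : ((vandermonde k n : MvPolynomial (Fin n) k) : MvPowerSeries (Fin n) k) =
    Matrix.det (Matrix.of fun i j : Fin n =>
      (MvPowerSeries.X i : MvPowerSeries (Fin n) k) ^ (n - 1 - (j : ℕ))) := by
  rw [det_pow_staircase, vandermonde, ← MvPolynomial.coeToMvPowerSeries.ringHom_apply]
  simp only [map_prod, map_sub, MvPolynomial.coeToMvPowerSeries.ringHom_apply,
    MvPolynomial.coe_X]

variable [CharZero k]

variable (k n) in
/-- The alternating form `(g_1, …, g_n) ↦ ⟨0| e^H ψ(g_1) ⋯ ψ(g_n) |-n⟩`. -/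
def vevForm : (MvPowerSeries (Fin n) k)[X] [⋀^Fin n]→ₗ[MvPowerSeries (Fin n) k]
    MvPowerSeries (Fin n) k :=
  ((vevLin k n ∘ₗ LinearMap.applyₗ (ketNeg n)) ∘ₗ
    (ExteriorAlgebra.lift (MvPowerSeries (Fin n) k)
      ⟨fermionField n, fermionField_mul_self n⟩).toLinearMap).compAlternatingMap
    (ExteriorAlgebra.ιMulti (MvPowerSeries (Fin n) k) n)

theorem vevForm_apply (g : Fin n → (MvPowerSeries (Fin n) k)[X]) :
    vevForm k n g = vevLin k n (fermionProd n (List.ofFn g) (ketNeg n)) := by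
  rw [vevForm, LinearMap.compAlternatingMap_apply, ExteriorAlgebra.ιMulti_apply]
  simp only [LinearMap.comp_apply, AlgHom.toLinearMap_apply, map_list_prod, List.map_ofFn,
    LinearMap.applyₗ_apply_apply, fermionProd]
  congr 4
  funext i
  simp only [Function.comp_apply, ExteriorAlgebra.lift_ι_apply]

/-- The field of X^a ∏(X - x_i) is the combination of ψ_{a-i} that e^H turns into ψ_a e^H, the
degree n cancelling the index shift; and ⟨0|ψ_a = 0 for a ≥ 0. -/
theorem vevLin_fermionField_of_dvd {f : (MvPowerSeries (Fin n) k)[X]}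
    (hf : ∏ i : Fin n, (X - C (MvPowerSeries.X i)) ∣ f) (v : Fock k (Fin n)) :
    vevLin k n (fermionField n f v) = 0 := by
  obtain ⟨q, rfl⟩ := hf
  have hdeg := natDegree_reverseProd_le (MvPowerSeries.X : Fin n → MvPowerSeries (Fin n) k)
  rw [Fintype.card_fin] at hdeg
  induction q using Polynomial.induction_on' with
  | add p q hp hq => rw [mul_add, map_add, LinearMap.add_apply, map_add, hp, hq, add_zero]
  | monomial a r =>
    have h := vevLin_sum_psi (k := k) (n := n) (a := a) (by omega) v
    rw [Polynomial.sum_over_range' (f := fun i r => r • psi ((a : ℤ) - (i : ℕ)) v) _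
      (fun _ => zero_smul _ _) (n + 1) (Nat.lt_succ_of_le hdeg)] at h
    rw [prod_X_sub_eq_sum, Finset.sum_mul, map_sum, LinearMap.sum_apply, ← smul_zero r, ← h,
      ← map_smul, Finset.smul_sum]
    congr 1
    refine Finset.sum_congr rfl fun i hi => ?_
    have := Finset.mem_range.1 hi
    rw [C_mul_X_pow_eq_monomial, monomial_mul_monomial, fermionField_monomial,
      LinearMap.smul_apply, psiLin_apply, smul_smul, mul_comm r]
    congr 2
    omega

theorem vevForm_eq_zero_of_dvd (g : Fin n → (MvPowerSeries (Fin n) k)[X]) (j : Fin n)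
    (hj : ∏ i : Fin n, (X - C (MvPowerSeries.X i)) ∣ g j) : vevForm k n g = 0 := by
  obtain _ | n := n
  · exact j.elim0
  have key : ∀ g : Fin (n + 1) → (MvPowerSeries (Fin (n + 1)) k)[X],
      ∏ i : Fin (n + 1), (X - C (MvPowerSeries.X i)) ∣ g 0 → vevForm k (n + 1) g = 0 := by
    intro g hg
    rw [vevForm_apply, List.ofFn_succ, fermionProd_cons]
    exact vevLin_fermionField_of_dvd hg _
  by_cases h0 : 0 = j
  · subst h0
    exact key g hj
  · have h1 := (vevForm k (n + 1)).map_swap g h0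
    rw [key _ (by simpa using hj), eq_comm, neg_eq_zero] at h1
    exact h1

theorem vevForm_staircase :
    vevForm k n (fun j : Fin n => X ^ (n - 1 - (j : ℕ))) = 1 := by
  rw [vevForm_apply, fermionProd_staircase n le_rfl, vevLin_ketNeg_zero]

theorem vevForm_mul_vandermonde (g : Fin n → (MvPowerSeries (Fin n) k)[X]) :
    vevForm k n g * (vandermonde k n : MvPolynomial (Fin n) k) =
      Matrix.det (Matrix.of fun i j => (g j).eval (MvPowerSeries.X i)) := by
  have h := alternatingMap_mul_det MvPowerSeries.X (vevForm k n) vevForm_eq_zero_of_dvd g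
    (fun j : Fin n => X ^ (n - 1 - (j : ℕ)))
  rw [vevForm_staircase, one_mul] at h
  rw [← h, coe_vandermonde]
  simp only [eval_pow, eval_X]

/-- The ket `ψ_{μ_1 - 1} e^Θ ⋯ ψ_{μ_N - N} e^Θ |-N⟩`. -/
def fermionicKet {σ : Type*} (β : k) (μ : YoungDiagram) (N : ℕ) : Fock k σ :=
  (List.range N).foldr
    (fun i v => psi ((μ.rowLen i : ℤ) - ((i : ℤ) + 1)) (expOp (Theta β) v)) (ketNeg N)

theorem rowLen_eq_zero {μ : YoungDiagram} {i : ℕ} (h : μ.colLen 0 ≤ i) : μ.rowLen i = 0 := by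
  by_contra h0
  have h1 : (i, 0) ∈ μ := YoungDiagram.mem_iff_lt_rowLen.2 (Nat.pos_of_ne_zero h0)
  have := YoungDiagram.mem_iff_lt_colLen.1 h1
  omega

/-- The innermost factor for a zero part is ψ_{-N-1} e^Θ |-N-1⟩ = |-N⟩, so padding can be removed
from the inside. -/
theorem fermionicKet_eq {σ : Type*} {β : k} (hβ : β ≠ 0) (μ : YoungDiagram) {N : ℕ}
    (hN : μ.colLen 0 ≤ N) : (fermionicKet β μ N : Fock k σ) = fermionicKet β μ (μ.colLen 0) := by
  induction hN with
  | refl => rfl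
  | @step N hN ih =>
    rw [← ih, fermionicKet, List.range_succ, List.foldr_append, List.foldr_cons, List.foldr_nil,
      rowLen_eq_zero hN, Nat.cast_zero, zero_sub, psi_expTheta_ketNeg_succ hβ, fermionicKet]

/-- Padding to exactly n factors matches two bounds: the errors of absorbing e^Θ have a hole below
-n, and this is what ⟨0|e^H ignores in n variables. -/
theorem fermionicVEV_eq {β : k} (hβ : β ≠ 0) (μ : YoungDiagram) (hn : μ.colLen 0 ≤ n) :
    fermionicVEV β μ n = vevForm k n fun j : Fin n =>
      (1 + C (MvPowerSeries.C β) * X) ^ (j : ℕ) * X ^ (μ.rowLen j + (n - 1 - (j : ℕ))) := by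
  have h1 : fermionicVEV β μ n = vevLin k n (fermionicKet β μ (μ.colLen 0)) := rfl
  rw [h1, ← fermionicKet_eq hβ μ hn, vevForm_apply, ← sub_eq_zero, ← map_sub]
  refine vevLin_eq_zero_of_mem_unfilled ?_
  convert foldr_fermionField_sub_mem β n fun j : Fin n =>
    (X : (MvPowerSeries (Fin n) k)[X]) ^ (μ.rowLen j + (n - 1 - (j : ℕ))) using 2
  rw [fermionicKet, List.ofFn_eq_map, List.foldr_map, ← List.map_coe_finRange_eq_range,
    List.foldr_map]
  refine congrArg (fun F => List.foldr F (ketNeg n) (List.finRange n)) ?_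
  funext j v
  rw [fermionField_X_pow]
  congr 1
  have := j.2
  push_cast
  omega

theorem fermionicVEV_mul_vandermonde {β : k} (hβ : β ≠ 0) (μ : YoungDiagram)
    (hn : μ.colLen 0 ≤ n) :
    fermionicVEV β μ n * (vandermonde k n : MvPolynomial (Fin n) k) =
      (grothendieckNumerator β μ n : MvPolynomial (Fin n) k) := by
  rw [fermionicVEV_eq hβ μ hn, vevForm_mul_vandermonde, grothendieckNumerator,
    ← MvPolynomial.coeToMvPowerSeries.ringHom_apply, RingHom.map_det]
  congr 1
  ext1 i j
  simp only [Matrix.of_apply, RingHom.mapMatrix_apply, Matrix.map_apply, map_mul, map_pow, map_add,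
    map_one, MvPolynomial.coeToMvPowerSeries.ringHom_apply, MvPolynomial.coe_X, MvPolynomial.coe_C,
    eval_mul, eval_pow, eval_add, eval_one, eval_C, eval_X]
  ring

end VevForm

/-! ### Setting variables to zero in the Fock space. -/

section Naturality

variable {k : Type*} [Field k] {σ τ : Type*} (e : σ ↪ τ)

/-- The specialization of vectors of the Fock space that sets variables to zero. -/
def fockRestrict (v : Fock k τ) : Fock k σ := fun S => MvPowerSeries.killCompl e (v S)

theorem fockRestrict_apply (v : Fock k τ) (S : Maya) :
    fockRestrict e v S = MvPowerSeries.killCompl e (v S) := rfl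

theorem fockRestrict_psi (n : ℤ) (v : Fock k τ) :
    fockRestrict e (psi n v) = psi n (fockRestrict e v) := by
  funext S
  rw [fockRestrict_apply]
  by_cases h : n ∈ S.1
  · rw [psi_apply_of_mem h, psi_apply_of_mem h, map_zsmul, fockRestrict_apply]
  · rw [psi_apply_of_notMem h, psi_apply_of_notMem h, map_zero]

theorem fockRestrict_psiStar (n : ℤ) (v : Fock k τ) :
    fockRestrict e (psiStar n v) = psiStar n (fockRestrict e v) := by
  funext S
  rw [fockRestrict_apply]
  by_cases h : n ∈ S.1
  · rw [psiStar_apply_of_mem h, psiStar_apply_of_mem h, map_zero]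
  · rw [psiStar_apply_of_notMem h, psiStar_apply_of_notMem h, map_zsmul, fockRestrict_apply]

theorem fockRestrict_formalSum {ι : Type*} (u : ι → Fock k τ) :
    fockRestrict e (formalSum u) = formalSum fun i => fockRestrict e (u i) := by
  funext S
  ext d
  rw [fockRestrict_apply, MvPowerSeries.coeff_killCompl]
  refine finsum_congr fun i => ?_
  beta_reduce
  rw [fockRestrict_apply, MvPowerSeries.coeff_killCompl]

theorem fockRestrict_smul (c : k) (v : Fock k τ) :
    fockRestrict e (c • v) = c • fockRestrict e v :=
  funext fun S => map_smul (MvPowerSeries.killCompl e) c (v S)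

theorem fockRestrict_normalOrdered (m n : ℤ) (v : Fock k τ) :
    fockRestrict e (normalOrdered m n v) = normalOrdered m n (fockRestrict e v) := by
  rw [normalOrdered, normalOrdered]
  split_ifs
  · rw [← fockRestrict_psi, ← fockRestrict_psiStar]
    exact funext fun S => map_neg (MvPowerSeries.killCompl e) _
  · rw [fockRestrict_psi, fockRestrict_psiStar]

theorem fockRestrict_current (m : ℤ) (v : Fock k τ) :
    fockRestrict e (current m v) = current m (fockRestrict e v) := by
  rw [current, fockRestrict_formalSum]
  simp only [fockRestrict_normalOrdered]
  rfl

theorem fockRestrict_expOp {A : Fock k τ → Fock k τ} {B : Fock k σ → Fock k σ}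
    (h : ∀ v, fockRestrict e (A v) = B (fockRestrict e v)) (v : Fock k τ) :
    fockRestrict e (expOp A v) = expOp B (fockRestrict e v) := by
  have hpow : ∀ j, fockRestrict e (A^[j] v) = B^[j] (fockRestrict e v) := by
    intro j
    induction j with
    | zero => rfl
    | succ j ih => rw [Function.iterate_succ', Function.comp_apply, h, ih,
        Function.iterate_succ', Function.comp_apply]
  rw [expOp, fockRestrict_formalSum]
  simp only [fockRestrict_smul, hpow]
  rfl

theorem fockRestrict_Theta (β : k) (v : Fock k τ) :
    fockRestrict e (Theta β v) = Theta β (fockRestrict e v) := by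
  rw [Theta, fockRestrict_formalSum]
  simp only [fockRestrict_smul, fockRestrict_current]
  rfl

theorem fockRestrict_ketNeg (l : ℕ) : fockRestrict e (ketNeg l : Fock k τ) = ketNeg l := by
  classical
  funext S
  rw [fockRestrict_apply, ketNeg_apply, ketNeg_apply]
  split_ifs
  · exact map_one _
  · exact map_zero _

theorem killCompl_sum_pow {m n : ℕ} (h : m ≤ n) {q : ℕ} (hq : q ≠ 0) :
    MvPowerSeries.killCompl (Fin.castLEEmb h)
      (∑ i : Fin n, (MvPowerSeries.X i : MvPowerSeries (Fin n) k) ^ q) =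
      ∑ i : Fin m, MvPowerSeries.X i ^ q := by
  classical
  rw [map_sum, ← Finset.sum_subset (Finset.subset_univ (Finset.univ.map (Fin.castLEEmb h)))]
  · rw [Finset.sum_map]
    exact Finset.sum_congr rfl fun i _ => by rw [map_pow, MvPowerSeries.killCompl_X]
  · intro i _ hi
    rw [map_pow, MvPowerSeries.killCompl_X_eq_zero, zero_pow hq]
    rintro ⟨j, rfl⟩
    exact hi (Finset.mem_map_of_mem _ (Finset.mem_univ j))

theorem fockRestrict_Hamiltonian {m n : ℕ} (h : m ≤ n) (v : Fock k (Fin n)) :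
    fockRestrict (Fin.castLEEmb h) (Hamiltonian v) =
      Hamiltonian (fockRestrict (Fin.castLEEmb h) v) := by
  rw [Hamiltonian, fockRestrict_formalSum]
  refine congrArg formalSum (funext fun q => funext fun S => ?_)
  rw [fockRestrict_apply, Pi.smul_apply, Pi.smul_apply, smul_eq_mul, smul_eq_mul, map_mul, map_smul,
    killCompl_sum_pow h q.ne_zero, ← fockRestrict_apply, fockRestrict_current]

/-- The variables enter only through the power sums in H, which restrict to power sums. This reaches
numbers of variables below ℓ(μ), where the bialternant formula is not available. -/
theorem killCompl_fermionicVEV {m n : ℕ} (h : m ≤ n) (β : k) (μ : YoungDiagram) :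
    MvPowerSeries.killCompl (Fin.castLEEmb h) (fermionicVEV β μ n) = fermionicVEV β μ m := by
  have h1 : ∀ L : List ℕ, fockRestrict (Fin.castLEEmb h) (L.foldr
      (fun i v => psi ((μ.rowLen i : ℤ) - ((i : ℤ) + 1)) (expOp (Theta β) v))
      (ketNeg (μ.colLen 0))) = L.foldr
      (fun i v => psi ((μ.rowLen i : ℤ) - ((i : ℤ) + 1)) (expOp (Theta β) v))
      (ketNeg (μ.colLen 0)) := by
    intro L
    induction L with
    | nil => exact fockRestrict_ketNeg _ _
    | cons i L ih =>
      rw [List.foldr_cons, List.foldr_cons, fockRestrict_psi,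
        fockRestrict_expOp _ (fockRestrict_Theta _ β), ih]
  rw [fermionicVEV, vacuumPairing, ← fockRestrict_apply,
    fockRestrict_expOp _ (fockRestrict_Hamiltonian h), h1]
  rfl

end Naturality

end

end StableGrothendieck

namespace StableGrothendieck

noncomputable section

/-! ### Generalized Jacobi–Trudi determinants and the bialternant formula. -/

section JacobiTrudi

open Polynomial

variable {k : Type*} [Field k] {n : ℕ}

theorem coeff_indicator_mul_completeSeries (A : Finset (Fin n)) (m : ℤ) (d : Fin n →₀ ℕ) :
    MvPowerSeries.coeff d (MvPowerSeries.monomial (Finsupp.indicator A fun _ _ => 1)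
      ((-1 : k) ^ A.card) * completeSeries k (Fin n) (m - A.card)) =
    if A ⊆ d.support then (if (d.degree : ℤ) = m then (-1 : k) ^ A.card else 0) else 0 := by
  classical
  rw [MvPowerSeries.coeff_monomial_mul]
  have hle : (Finsupp.indicator A fun _ _ => 1) ≤ d ↔ A ⊆ d.support := by
    constructor
    · intro h i hi
      have := h i
      rw [Finsupp.indicator_of_mem hi] at this
      rw [Finsupp.mem_support_iff]
      omega
    · intro h i
      by_cases hi : i ∈ A
      · rw [Finsupp.indicator_of_mem hi]
        have := Finsupp.mem_support_iff.mp (h hi)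
        omega
      · rw [Finsupp.indicator_of_notMem hi]
        exact Nat.zero_le _
  by_cases h : A ⊆ d.support
  · rw [if_pos (hle.mpr h), if_pos h, coeff_completeSeries]
    have hdeg : (Finsupp.indicator A fun _ _ => 1).degree = A.card := by
      rw [Finsupp.degree_eq_sum, ← Finset.sum_subset (Finset.subset_univ A)]
      · rw [Finset.card_eq_sum_ones]
        exact Finset.sum_congr rfl fun i hi => Finsupp.indicator_of_mem hi _
      · intro i _ hi
        exact Finsupp.indicator_of_notMem hi _
    have hsum := congrArg Finsupp.degree (tsub_add_cancel_of_le (hle.mpr h))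
    rw [map_add, hdeg] at hsum
    by_cases hd : (d.degree : ℤ) = m
    · rw [if_pos hd, if_pos (by omega), mul_one]
    · rw [if_neg hd, if_neg (by omega), mul_zero]
  · rw [if_neg (fun h' => h (hle.mp h')), if_neg h]

/-- This is ∏_{j≠i}(1 - x_j T) · ∏_j (1 - x_j T)^{-1} = (1 - x_i T)^{-1} in degree c. On
coefficients it is inclusion–exclusion over subsets of the support of d without i. -/
theorem sum_indicator_mul_completeSeries (i : Fin n) (c : ℕ) :
    ∑ A ∈ (Finset.univ.erase i).powerset,
      MvPowerSeries.monomial (Finsupp.indicator A fun _ _ => 1) ((-1 : k) ^ A.card) *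
        completeSeries k (Fin n) (c - A.card) = MvPowerSeries.X i ^ c := by
  classical
  ext d
  rw [map_sum, Finset.sum_congr rfl fun A _ => coeff_indicator_mul_completeSeries A (c : ℤ) d,
    MvPowerSeries.coeff_X_pow, ← Finset.sum_filter]
  have hfil : (Finset.univ.erase i).powerset.filter (fun A => A ⊆ d.support) =
      (d.support.erase i).powerset := by
    ext A
    simp only [Finset.mem_filter, Finset.mem_powerset, Finset.subset_erase]
    exact ⟨fun h => ⟨h.2, h.1.2⟩, fun h => ⟨⟨Finset.subset_univ _, h.2⟩, h.1⟩⟩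
  have hsum := congrArg (Int.cast : ℤ → k)
    (Finset.sum_powerset_neg_one_pow_card (x := d.support.erase i))
  push_cast at hsum
  have hd : d = Finsupp.single i c ↔ d.support.erase i = ∅ ∧ (d.degree : ℤ) = c := by
    constructor
    · rintro rfl
      refine ⟨?_, by simp⟩
      rw [Finset.erase_eq_empty_iff]
      have := Finsupp.support_single_subset (a := i) (b := c)
      rwa [Finset.subset_singleton_iff] at this
    · rintro ⟨h1, h2⟩
      rw [Finset.erase_eq_empty_iff, ← Finset.subset_singleton_iff,
        Finsupp.support_subset_singleton] at h1
      rw [h1, Finsupp.degree_single] at h2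
      rw [h1]
      congr 1
      exact_mod_cast h2
  rw [hfil]
  by_cases h2 : (d.degree : ℤ) = c
  · simp only [if_pos h2]
    rw [hsum]
    exact if_congr (by rw [hd]; exact (and_iff_left h2).symm) rfl rfl
  · simp only [if_neg h2, Finset.sum_const_zero]
    rw [if_neg fun h => h2 (hd.1 h).2]

/-- The signed elementary symmetric polynomial of degree `n - 1 - l` in the variables different
from `x_i`. -/
def signedElem (k : Type*) [Field k] (n : ℕ) (i l : Fin n) : MvPowerSeries (Fin n) k :=
  ∑ A ∈ (Finset.univ.erase i).powerset, if (l : ℕ) + A.card + 1 = n then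
    MvPowerSeries.monomial (Finsupp.indicator A fun _ _ => 1) ((-1 : k) ^ A.card) else 0

theorem X_pow_eq_sum (i : Fin n) (c : ℕ) : (MvPowerSeries.X i : MvPowerSeries (Fin n) k) ^ c =
    ∑ l : Fin n, signedElem k n i l * completeSeries k (Fin n) ((c : ℤ) - (n - 1 - (l : ℕ))) := by
  classical
  simp only [signedElem, Finset.sum_mul]
  rw [Finset.sum_comm, ← sum_indicator_mul_completeSeries i c]
  refine Finset.sum_congr rfl fun A hA => ?_
  have hn := i.2
  have hcard := Finset.card_le_card (Finset.mem_powerset.1 hA)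
  rw [Finset.card_erase_of_mem (Finset.mem_univ i), Finset.card_univ, Fintype.card_fin] at hcard
  rw [Finset.sum_eq_single ⟨n - 1 - A.card, by omega⟩]
  · rw [if_pos (by simp only; omega)]
    congr 2
    push_cast
    omega
  · intro l _ hl
    rw [if_neg, zero_mul]
    intro h
    exact hl (Fin.ext (by simp only; omega))
  · intro h
    exact absurd (Finset.mem_univ _) h

/-- The symmetric function `∑ f_c h_{c - (n - 1) + l}` attached to a polynomial `f`. -/
def completeSum (k : Type*) [Field k] (n l : ℕ) : k[X] →ₗ[k] SymFun k :=
  Polynomial.lsum fun c => LinearMap.toSpanSingleton k (SymFun k)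
    (completeSym k ((c : ℤ) - (n - 1 - l)))

theorem completeSum_monomial (n l c : ℕ) (r : k) :
    completeSum k n l (monomial c r) = r • completeSym k ((c : ℤ) - (n - 1 - l)) :=
  sum_monomial_index _ _ (zero_smul _ _)

theorem completeSum_X_pow (n l c : ℕ) :
    completeSum k n l (X ^ c) = completeSym k ((c : ℤ) - (n - 1 - l)) := by
  rw [X_pow_eq_monomial, completeSum_monomial, one_smul]

theorem aeval_X_eq_sum (i : Fin n) (f : k[X]) :
    aeval (MvPowerSeries.X i : MvPowerSeries (Fin n) k) f =
      ∑ l : Fin n, signedElem k n i l * specialize k n (completeSum k n l f) := by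
  induction f using Polynomial.induction_on' with
  | add f g hf hg =>
    simp only [map_add, mul_add, Finset.sum_add_distrib, hf, hg]
  | monomial c r =>
    simp only [completeSum_monomial, map_smul, specialize_completeSym, mul_smul_comm]
    rw [← Finset.smul_sum, ← X_pow_eq_sum, aeval_monomial, Algebra.smul_def]

/-- The determinant `det (∑_c f_{j,c} h_{c - (n - 1) + l})`. -/
def jacobiTrudi (n : ℕ) (f : Fin n → k[X]) : SymFun k :=
  Matrix.det (Matrix.of fun j l : Fin n => completeSum k n l (f j))

theorem completeSym_zero : completeSym k 0 = 1 := by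
  refine Subtype.ext (MvPowerSeries.ext fun d => ?_)
  classical
  change MvPowerSeries.coeff d (completeSeries k ℕ 0) = MvPowerSeries.coeff d 1
  rw [coeff_completeSeries, MvPowerSeries.coeff_one]
  refine if_congr ?_ rfl rfl
  rw [Nat.cast_eq_zero, Finsupp.degree_eq_zero_iff]

theorem completeSym_of_neg {m : ℤ} (hm : m < 0) : completeSym k m = 0 := by
  refine Subtype.ext (MvPowerSeries.ext fun d => ?_)
  change MvPowerSeries.coeff d (completeSeries k ℕ m) = MvPowerSeries.coeff d 0
  rw [coeff_completeSeries, if_neg (by omega), map_zero]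

/-- The entries are h_{l-j}, so the matrix is upper unitriangular. -/
theorem jacobiTrudi_staircase : jacobiTrudi n (fun j => (X : k[X]) ^ (n - 1 - (j : ℕ))) = 1 := by
  rw [jacobiTrudi, Matrix.det_of_isUpperTriangular]
  · refine Finset.prod_eq_one fun j _ => ?_
    have := j.2
    rw [Matrix.of_apply, completeSum_X_pow, ← completeSym_zero]
    congr 1
    omega
  · intro j l hl
    have h1 : (l : ℕ) < j := hl
    have := j.2
    rw [Matrix.of_apply, completeSum_X_pow, completeSym_of_neg]
    omega

/-- By `aeval_X_eq_sum` the matrix factors, and the first factor does not depend on `f`. -/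
theorem det_aeval_eq (f : Fin n → k[X]) :
    Matrix.det (Matrix.of fun i j : Fin n =>
      aeval (MvPowerSeries.X i : MvPowerSeries (Fin n) k) (f j)) =
    Matrix.det (Matrix.of (signedElem k n)) * specialize k n (jacobiTrudi n f) := by
  rw [jacobiTrudi, AlgHom.map_det, ← Matrix.det_transpose (AlgHom.mapMatrix _ _), ← Matrix.det_mul]
  congr 1
  ext1 i j
  rw [Matrix.of_apply, aeval_X_eq_sum, Matrix.mul_apply]
  rfl

/-- The bialternant formula. -/
theorem specialize_jacobiTrudi_mul (f : Fin n → k[X]) :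
    specialize k n (jacobiTrudi n f) * (vandermonde k n : MvPolynomial (Fin n) k) =
      Matrix.det (Matrix.of fun i j : Fin n =>
        aeval (MvPowerSeries.X i : MvPowerSeries (Fin n) k) (f j)) := by
  -- The staircase identifies the factor independent of `f` as the Vandermonde determinant.
  have h := det_aeval_eq (k := k) (n := n) fun j => X ^ (n - 1 - (j : ℕ))
  rw [jacobiTrudi_staircase, map_one, mul_one] at h
  simp only [map_pow, aeval_X] at h
  rw [coe_vandermonde, h, det_aeval_eq, mul_comm]

theorem det_eq_det_castSucc {R : Type*} [CommRing R] (A : Matrix (Fin (n + 1)) (Fin (n + 1)) R)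
    (h : ∀ j, j ≠ Fin.last n → A (Fin.last n) j = 0) (h1 : A (Fin.last n) (Fin.last n) = 1) :
    A.det = (A.submatrix Fin.castSucc Fin.castSucc).det := by
  rw [Matrix.det_succ_row _ (Fin.last n), Finset.sum_eq_single (Fin.last n)]
  · rw [h1, mul_one, Fin.val_last, Even.neg_one_pow ⟨n, rfl⟩, one_mul, Fin.succAbove_last]
  · intro j _ hj
    rw [h j hj, mul_zero, zero_mul]
  · intro h
    exact absurd (Finset.mem_univ _) h

/-- A zero part adds a last row 0, …, 0, 1, so the size of the determinant may exceed the length. -/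
theorem schur_eq_det (μ : YoungDiagram) (hn : μ.colLen 0 ≤ n) :
    schur k μ = Matrix.det (Matrix.of fun i j : Fin n =>
      completeSym k ((μ.rowLen i : ℤ) - (i : ℕ) + (j : ℕ))) := by
  induction hn with
  | refl => rfl
  | @step n hn ih =>
    rw [ih, det_eq_det_castSucc]
    · rfl
    · intro j hj
      have h1 := Fin.val_lt_last hj
      rw [Matrix.of_apply, Fin.val_last, rowLen_eq_zero hn, completeSym_of_neg]
      push_cast
      omega
    · rw [Matrix.of_apply, Fin.val_last, rowLen_eq_zero hn, Nat.cast_zero, zero_sub,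
        neg_add_cancel, completeSym_zero]

theorem schur_eq_jacobiTrudi (μ : YoungDiagram) (hn : μ.colLen 0 ≤ n) :
    schur k μ = jacobiTrudi n fun j => X ^ (μ.rowLen j + (n - 1 - (j : ℕ))) := by
  rw [schur_eq_det μ hn, jacobiTrudi]
  congr 1
  ext1 i j
  have := i.2
  rw [Matrix.of_apply, Matrix.of_apply, completeSum_X_pow]
  congr 1
  push_cast
  omega

end JacobiTrudi

end

end StableGrothendieck

namespace StableGrothendieck

noncomputable section

/-! ### Degree bounds. -/

section DegreeBound

variable {k : Type*} [Field k] {σ : Type*}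

/-- The power series `f` has degree at most `m`. -/
def DegreeLE (f : MvPowerSeries σ k) (m : ℤ) : Prop :=
  ∀ d, MvPowerSeries.coeff d f ≠ 0 → (d.degree : ℤ) ≤ m

theorem DegreeLE.mono {f : MvPowerSeries σ k} {m m' : ℤ} (hf : DegreeLE f m) (h : m ≤ m') :
    DegreeLE f m' := fun d hd => (hf d hd).trans h

theorem DegreeLE.one : DegreeLE (1 : MvPowerSeries σ k) 0 := fun d hd => by
  classical
  rw [MvPowerSeries.coeff_one, ite_ne_right_iff] at hd
  simp [hd.1]

theorem DegreeLE.add {f g : MvPowerSeries σ k} {m : ℤ} (hf : DegreeLE f m) (hg : DegreeLE g m) :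
    DegreeLE (f + g) m := fun d hd => by
  by_cases h : MvPowerSeries.coeff d f = 0
  · rw [map_add, h, zero_add] at hd
    exact hg d hd
  · exact hf d h

theorem DegreeLE.smul {f : MvPowerSeries σ k} {m : ℤ} (c : k) (hf : DegreeLE f m) :
    DegreeLE (c • f) m := fun d hd => hf d fun h => hd (by
  rw [MvPowerSeries.coeff_smul, h, mul_zero])

theorem DegreeLE.zsmul {f : MvPowerSeries σ k} {m : ℤ} (c : ℤ) (hf : DegreeLE f m) :
    DegreeLE (c • f) m := fun d hd => hf d fun h => hd (by rw [map_zsmul, h, smul_zero])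

theorem DegreeLE.mul {f g : MvPowerSeries σ k} {m m' : ℤ} (hf : DegreeLE f m)
    (hg : DegreeLE g m') : DegreeLE (f * g) (m + m') := fun d hd => by
  classical
  rw [MvPowerSeries.coeff_mul] at hd
  obtain ⟨p, hp, hne⟩ := Finset.exists_ne_zero_of_sum_ne_zero hd
  rw [← Finset.HasAntidiagonal.mem_antidiagonal.mp hp, map_add, Nat.cast_add]
  exact add_le_add (hf _ (left_ne_zero_of_mul hne)) (hg _ (right_ne_zero_of_mul hne))

theorem DegreeLE.sum {ι : Type*} {s : Finset ι} {f : ι → MvPowerSeries σ k} {m : ℤ}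
    (h : ∀ i ∈ s, DegreeLE (f i) m) : DegreeLE (∑ i ∈ s, f i) m := fun d hd => by
  rw [map_sum] at hd
  obtain ⟨i, hi, hne⟩ := Finset.exists_ne_zero_of_sum_ne_zero hd
  exact h i hi d hne

theorem DegreeLE.prod {ι : Type*} {s : Finset ι} {f : ι → MvPowerSeries σ k} {m : ι → ℤ}
    (h : ∀ i ∈ s, DegreeLE (f i) (m i)) : DegreeLE (∏ i ∈ s, f i) (∑ i ∈ s, m i) := by
  classical
  induction s using Finset.induction_on with
  | empty => exact DegreeLE.one
  | insert i s hi ih =>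
    rw [Finset.prod_insert hi, Finset.sum_insert hi]
    exact (h i (Finset.mem_insert_self _ _)).mul
      (ih fun j hj => h j (Finset.mem_insert_of_mem hj))

/-- Bounds additive in row and column give every term of the Leibniz expansion the same bound. -/
theorem DegreeLE.det {n : ℕ} {A : Matrix (Fin n) (Fin n) (MvPowerSeries σ k)} {a b : Fin n → ℤ}
    (h : ∀ i j, DegreeLE (A i j) (a i + b j)) : DegreeLE A.det (∑ i, a i + ∑ i, b i) := by
  rw [Matrix.det_apply]
  refine DegreeLE.sum fun s _ => ?_
  rw [Units.smul_def]
  refine DegreeLE.zsmul _ ?_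
  rw [← Equiv.sum_comp s a, ← Finset.sum_add_distrib]
  exact DegreeLE.prod fun i _ => h _ _

theorem degreeLE_completeSym (m : ℤ) : DegreeLE (completeSym k m).1 m := fun d hd => by
  have : (if (d.degree : ℤ) = m then (1 : k) else 0) ≠ 0 := hd
  rw [ite_ne_right_iff] at this
  exact this.1.le

theorem degreeLE_jacobiTrudi {n : ℕ} (e : Fin n → ℕ) :
    DegreeLE (jacobiTrudi n fun j => (Polynomial.X : Polynomial k) ^ e j).1
      (∑ j, (e j : ℤ) + ∑ l : Fin n, (-(n - 1 - (l : ℕ)) : ℤ)) := by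
  have h : (jacobiTrudi n fun j => (Polynomial.X : Polynomial k) ^ e j).1 =
      (SymFun k).val (jacobiTrudi n fun j => (Polynomial.X : Polynomial k) ^ e j) := rfl
  rw [h, jacobiTrudi, AlgHom.map_det]
  refine DegreeLE.det fun i j => ?_
  rw [AlgHom.mapMatrix_apply, Matrix.map_apply, Matrix.of_apply, completeSum_X_pow]
  exact degreeLE_completeSym _

theorem degreeLE_X_pow (i : σ) (e : ℕ) :
    DegreeLE ((MvPowerSeries.X i : MvPowerSeries σ k) ^ e) e := fun d hd => by
  classical
  rw [MvPowerSeries.coeff_X_pow, ite_ne_right_iff] at hd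
  simp [hd.1]

theorem degreeLE_vandermonde (n : ℕ) :
    DegreeLE ((vandermonde k n :) : MvPowerSeries (Fin n) k)
      (∑ l : Fin n, ((n : ℤ) - 1 - (l : ℕ))) := by
  rw [coe_vandermonde, ← zero_add (∑ l : Fin n, ((n : ℤ) - 1 - (l : ℕ))),
    ← Finset.sum_const_zero (s := (Finset.univ : Finset (Fin n)))]
  refine DegreeLE.det fun i j => (degreeLE_X_pow _ _).mono ?_
  have := j.2
  omega

theorem exists_degreeLE (f : SymFun k) : ∃ D : ℕ, DegreeLE f.1 D := by
  obtain ⟨D, hD⟩ := f.2.2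
  refine ⟨D, fun d hd => ?_⟩
  by_contra h
  exact hd (hD d (by omega))

end DegreeBound

/-! ### Recovering a symmetric function from finitely many variables. -/

section Specialization

variable {k : Type*} [Field k] {n : ℕ}

theorem coeff_mapDomain_perm (f : SymFun k) (t : Equiv.Perm ℕ) (d : ℕ →₀ ℕ) :
    MvPowerSeries.coeff (d.mapDomain t) f.1 = MvPowerSeries.coeff d f.1 := by
  have h := MvPowerSeries.coeff_embDomain_rename t.toEmbedding f.1 d
  rw [Finsupp.embDomain_eq_mapDomain] at h
  exact (congrArg _ (f.2.1 t)).symm.trans h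

theorem coeff_specialize (f : SymFun k) (d : Fin n →₀ ℕ) :
    MvPowerSeries.coeff d (specialize k n f) = MvPowerSeries.coeff (d.mapDomain Fin.val) f.1 := by
  change MvPowerSeries.coeff d (MvPowerSeries.killCompl Fin.valEmbedding f.1) = _
  rw [MvPowerSeries.coeff_killCompl, Finsupp.embDomain_eq_mapDomain]
  rfl

theorem coeff_mapDomain_specialize (f : SymFun k) (s : Equiv.Perm (Fin n)) (d : Fin n →₀ ℕ) :
    MvPowerSeries.coeff (d.mapDomain s) (specialize k n f) =
      MvPowerSeries.coeff d (specialize k n f) := by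
  have h : (d.mapDomain s).mapDomain Fin.val =
      (d.mapDomain Fin.val).mapDomain (s.viaEmbedding Fin.valEmbedding) := by
    rw [← Finsupp.mapDomain_comp, ← Finsupp.mapDomain_comp]
    congr 1
    funext i
    exact (s.viaEmbedding_apply Fin.valEmbedding i).symm
  rw [coeff_specialize, coeff_specialize, h, coeff_mapDomain_perm]

theorem killCompl_specialize {m n : ℕ} (h : m ≤ n) (f : SymFun k) :
    MvPowerSeries.killCompl (Fin.castLEEmb h) (specialize k n f) = specialize k m f := by
  ext d
  rw [MvPowerSeries.coeff_killCompl, coeff_specialize, coeff_specialize,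
    Finsupp.embDomain_eq_mapDomain, ← Finsupp.mapDomain_comp]
  rfl

theorem DegreeLE.specialize {f : SymFun k} {m : ℤ} (hf : DegreeLE f.1 m) (n : ℕ) :
    DegreeLE (specialize k n f) m := fun d hd => by
  rw [coeff_specialize] at hd
  have := hf _ hd
  rwa [Finsupp.degree_mapDomain] at this

/-- A monomial of degree at most n involves at most n variables, and a permutation moves these among
the first n. -/
theorem exists_perm_mapDomain (d : ℕ →₀ ℕ) (hn : d.degree ≤ n) :
    ∃ (t : Equiv.Perm ℕ) (e : Fin n →₀ ℕ), d.mapDomain t = e.mapDomain Fin.val := by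
  classical
  have hcard : d.support.card ≤ n := by
    refine le_trans ?_ hn
    rw [Finsupp.degree_apply, Finset.card_eq_sum_ones]
    exact Finset.sum_le_sum fun i hi => Nat.one_le_iff_ne_zero.2 (Finsupp.mem_support_iff.1 hi)
  have := Set.powersetCard.isPretransitive (α := ℕ) (n := d.support.card)
  obtain ⟨t, ht⟩ := MulAction.exists_smul_eq (Equiv.Perm ℕ)
    (⟨d.support, rfl⟩ : Set.powersetCard ℕ d.support.card)
    ⟨Finset.range d.support.card, Finset.card_range _⟩
  have ht' : d.support.image t = Finset.range d.support.card := congrArg Subtype.val ht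
  refine ⟨t, (d.mapDomain t).comapDomain Fin.val Fin.val_injective.injOn, ?_⟩
  rw [Finsupp.mapDomain_comapDomain _ Fin.val_injective]
  intro i hi
  have h1 := Finsupp.mapDomain_support hi
  rw [ht', Finset.mem_range] at h1
  exact ⟨⟨i, by omega⟩, rfl⟩

theorem eq_zero_of_specialize_eq_zero {f : SymFun k} (hf : DegreeLE f.1 n)
    (h : specialize k n f = 0) : f = 0 := by
  refine Subtype.ext (MvPowerSeries.ext fun d => ?_)
  by_contra hd
  obtain ⟨t, e, he⟩ := exists_perm_mapDomain (n := n) d (by exact_mod_cast hf d hd)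
  refine hd ?_
  rw [← coeff_mapDomain_perm f t, he, ← coeff_specialize, h]
  rfl

end Specialization

/-! ### The Schur functions span Λ, and the kernel of specialization. -/

section Alternants

open MvPolynomial

variable {k : Type*} [Field k] {n : ℕ}

/-- The alternant `det (x_i^{e_j})`. -/
def alternant (k : Type*) [Field k] {n : ℕ} (e : Fin n →₀ ℕ) : MvPolynomial (Fin n) k :=
  Matrix.det (Matrix.of fun i j => X i ^ e j)

theorem rename_alternant (e : Fin n →₀ ℕ) (s : Equiv.Perm (Fin n)) :
    rename s (alternant k e) = Equiv.Perm.sign s • alternant k e := by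
  rw [alternant, AlgHom.map_det, Units.smul_def, zsmul_eq_mul, ← Matrix.det_permute]
  congr 1
  ext1 i j
  simp

theorem alternant_eq_sum (e : Fin n →₀ ℕ) : alternant k e =
    ∑ s : Equiv.Perm (Fin n), Equiv.Perm.sign s • monomial (e.mapDomain s) 1 := by
  rw [alternant, Matrix.det_apply]
  refine Finset.sum_congr rfl fun s _ => ?_
  congr 1
  rw [← rename_monomial, monomial_eq, Finsupp.prod_fintype _ _ fun _ => pow_zero _]
  simp

/-- Antisymmetrizing q multiplies it by n! and turns each monomial into an alternant. Summing over
all exponents, sorted or not, avoids choosing representatives of orbits. -/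
theorem factorial_smul_eq_sum_alternant {q : MvPolynomial (Fin n) k}
    (hq : ∀ s : Equiv.Perm (Fin n), rename s q = Equiv.Perm.sign s • q) :
    n.factorial • q = ∑ e ∈ q.support, coeff e q • alternant k e := by
  have h1 : ∀ s : Equiv.Perm (Fin n), q = Equiv.Perm.sign s • rename s q := fun s => by
    rw [hq, smul_smul, Int.units_mul_self, one_smul]
  calc n.factorial • q = ∑ s : Equiv.Perm (Fin n), Equiv.Perm.sign s • rename s q := by
        rw [← Finset.sum_congr rfl fun s _ => h1 s, Finset.sum_const, Finset.card_univ,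
          Fintype.card_perm, Fintype.card_fin]
    _ = ∑ e ∈ q.support, coeff e q • alternant k e := by
        simp only [alternant_eq_sum, Finset.smul_sum]
        rw [Finset.sum_comm]
        refine Finset.sum_congr rfl fun s _ => ?_
        conv_lhs => rw [q.as_sum]
        rw [map_sum, Finset.smul_sum]
        refine Finset.sum_congr rfl fun e _ => ?_
        rw [rename_monomial, smul_comm]
        congr 1
        rw [smul_monomial, smul_eq_mul, mul_one]

theorem vandermonde_eq_alternant : vandermonde k n =
    alternant k (Finsupp.equivFunOnFinite.symm fun j : Fin n => n - 1 - (j : ℕ)) := by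
  rw [alternant, vandermonde, ← det_pow_staircase]
  rfl

theorem coe_alternant (e : Fin n →₀ ℕ) : ((alternant k e : MvPolynomial (Fin n) k) :
    MvPowerSeries (Fin n) k) =
      specialize k n (jacobiTrudi n fun j => Polynomial.X ^ e j) * (vandermonde k n :) := by
  rw [specialize_jacobiTrudi_mul]
  change coeToMvPowerSeries.ringHom _ = _
  rw [alternant, RingHom.map_det]
  congr 1
  ext1 i j
  simp

theorem vandermonde_ne_zero : vandermonde k n ≠ 0 := by
  refine Finset.prod_ne_zero_iff.2 fun i _ => Finset.prod_ne_zero_iff.2 fun j hj => ?_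
  rw [sub_ne_zero, Ne, X_injective.eq_iff]
  exact (Finset.mem_Ioi.1 hj).ne

theorem coe_vandermonde_ne_zero : ((vandermonde k n :) : MvPowerSeries (Fin n) k) ≠ 0 :=
  fun h => vandermonde_ne_zero (coe_injective _ _ (h.trans coe_zero.symm))

theorem eq_of_mul_vandermonde_eq {f g : MvPowerSeries (Fin n) k}
    (h : f * (vandermonde k n :) = g * (vandermonde k n :)) : f = g :=
  have : IsDomain (MvPowerSeries (Fin n) k) := NoZeroDivisors.to_isDomain _
  mul_right_cancel₀ coe_vandermonde_ne_zero h

/-- Bounded degree in finitely many variables leaves finitely many monomials, so a truncation loses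
nothing. -/
theorem exists_mvPolynomial_eq_specialize (n : ℕ) (f : SymFun k) :
    ∃ p : MvPolynomial (Fin n) k, (p : MvPowerSeries (Fin n) k) = specialize k n f := by
  obtain ⟨D, hf⟩ := exists_degreeLE f
  refine ⟨MvPowerSeries.truncTotal (D + 1) (specialize k n f), MvPowerSeries.ext fun d => ?_⟩
  rw [coeff_coe]
  rcases lt_or_ge d.degree (D + 1) with h | h
  · rw [MvPowerSeries.coeff_truncTotal _ h]
  · rw [MvPowerSeries.coeff_truncTotal_eq_zero _ h]
    by_contra h0
    have := hf.specialize n d (Ne.symm h0)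
    omega

theorem add_sub_le_of_strictAnti {e : Fin n → ℕ} (he : StrictAnti e) {i j : Fin n} (h : i ≤ j) :
    e j + (j - i : ℕ) ≤ e i := by
  obtain ⟨j, hj⟩ := j
  induction j with
  | zero =>
    have : i = ⟨0, hj⟩ := Fin.ext (Nat.le_zero.1 h)
    simp [this]
  | succ j ih =>
    rcases Nat.lt_or_ge j i with h1 | h1
    · have : i = ⟨j + 1, hj⟩ := Fin.ext (le_antisymm h h1)
      simp [this]
    · have h2 := ih (by omega) h1
      have h3 : e ⟨j + 1, hj⟩ < e ⟨j, by omega⟩ := he (Nat.lt_succ_self j)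
      simp only at h2 ⊢
      omega

theorem exists_rowLen_eq {e : Fin n → ℕ} (he : Antitone e) :
    ∃ μ : YoungDiagram, μ.colLen 0 ≤ n ∧ ∀ j : Fin n, μ.rowLen j = e j := by
  refine ⟨YoungDiagram.ofRowLens (List.ofFn e) he.sortedGE_ofFn, ?_, fun j => ?_⟩
  · by_contra! h
    rw [← YoungDiagram.mem_iff_lt_colLen, YoungDiagram.mem_ofRowLens] at h
    obtain ⟨h1, -⟩ := h
    simp at h1
  · have := YoungDiagram.rowLen_ofRowLens (hw := he.sortedGE_ofFn)
      (Fin.cast (List.length_ofFn (f := e)).symm j)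
    simpa using this

theorem jacobiTrudi_comp_perm (f : Fin n → Polynomial k) (s : Equiv.Perm (Fin n)) :
    jacobiTrudi n (f ∘ s) = (Equiv.Perm.sign s : ℤ) • jacobiTrudi n f := by
  rw [zsmul_eq_mul, jacobiTrudi, jacobiTrudi, ← Matrix.det_permute]
  rfl

/-- The exponents `μ_j + n - 1 - j`. -/
def shiftedParts (n : ℕ) (μ : YoungDiagram) : Fin n →₀ ℕ :=
  Finsupp.equivFunOnFinite.symm fun j => μ.rowLen j + (n - 1 - (j : ℕ))

theorem strictAnti_shiftedParts (μ : YoungDiagram) : StrictAnti (shiftedParts n μ) := fun i j h => by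
  have h1 := μ.rowLen_anti i j h.le
  have h2 : (i : ℕ) < j := h
  have h3 := j.2
  change μ.rowLen j + (n - 1 - (j : ℕ)) < μ.rowLen i + (n - 1 - (i : ℕ))
  omega

/-- Equal exponents give equal rows. Distinct exponents, sorted decreasingly and diminished by the
staircase, are the parts of a partition, and sorting costs only a sign. -/
theorem jacobiTrudi_mem_span_schur (e : Fin n → ℕ) :
    jacobiTrudi n (fun j => (Polynomial.X : Polynomial k) ^ e j) ∈
      Submodule.span k (Set.range (schur k)) := by
  by_cases he : Function.Injective e
  · set s := Tuple.sort (OrderDual.toDual ∘ e)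
    have hs : StrictAnti (e ∘ s) :=
      Antitone.strictAnti_of_injective (Tuple.monotone_sort (OrderDual.toDual ∘ e)).dual_right
        (he.comp s.injective)
    obtain ⟨μ, hμ, h⟩ := exists_rowLen_eq (n := n) (e := fun j => e (s j) - (n - 1 - (j : ℕ)))
      fun i j hij => by
        have := add_sub_le_of_strictAnti hs hij
        have h2 : (i : ℕ) ≤ j := hij
        have h3 := j.2
        simp only [Function.comp_apply] at this ⊢
        omega
    have h1 := schur_eq_jacobiTrudi (k := k) μ hμ
    have h2 : (fun j : Fin n => (Polynomial.X : Polynomial k) ^ (μ.rowLen j + (n - 1 - (j : ℕ)))) =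
        (fun j => Polynomial.X ^ e j) ∘ s := by
      funext j
      have hn := j.2
      have h3 := add_sub_le_of_strictAnti hs (i := j) (j := ⟨n - 1, by omega⟩) (Nat.le_sub_one_of_lt hn)
      simp only [Function.comp_apply] at h3 ⊢
      rw [h, Nat.sub_add_cancel (by omega)]
    rw [h2, jacobiTrudi_comp_perm] at h1
    have h3 : jacobiTrudi n (fun j => (Polynomial.X : Polynomial k) ^ e j) =
        (Equiv.Perm.sign s : ℤ) • schur k μ := by
      rw [h1, smul_smul, ← Units.val_mul, Int.units_mul_self, Units.val_one, one_smul]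
    rw [h3]
    exact Submodule.smul_of_tower_mem _ _ (Submodule.subset_span ⟨μ, rfl⟩)
  · rw [Function.not_injective_iff] at he
    obtain ⟨i, j, hij, hne⟩ := he
    rw [jacobiTrudi, Matrix.det_zero_of_row_eq hne]
    · exact Submodule.zero_mem _
    · funext l
      simp only [Matrix.of_apply, hij]

/-- The Schur functions span `Λ`. -/
theorem span_schur [CharZero k] : Submodule.span k (Set.range (schur k)) = ⊤ := by
  rw [eq_top_iff]
  intro f _
  -- N serves both as degree bound and as number of variables, so identities in Λ between functions
  -- of degree at most N can be checked after specialization.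
  obtain ⟨N, hf⟩ := exists_degreeLE f
  obtain ⟨p, hp⟩ := exists_mvPolynomial_eq_specialize N f
  have hps : ∀ s : Equiv.Perm (Fin N), rename s p = p := fun s => by
    ext d
    obtain ⟨d, rfl⟩ : ∃ d', d = Finsupp.mapDomain s d' :=
      ⟨d.mapDomain s.symm, by rw [← Finsupp.mapDomain_comp]; simp⟩
    rw [coeff_rename_mapDomain _ s.injective, ← coeff_coe, ← coeff_coe, hp,
      coeff_mapDomain_specialize]
  set q := p * vandermonde k N with hq
  have hqs : ∀ s : Equiv.Perm (Fin N), rename s q = Equiv.Perm.sign s • q := fun s => by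
    rw [hq, map_mul, hps, vandermonde_eq_alternant, rename_alternant, mul_smul_comm]
  have hqdeg : ∀ e ∈ q.support, (e.degree : ℤ) ≤ N + ∑ l : Fin N, ((N : ℤ) - 1 - (l : ℕ)) := by
    intro e he
    refine ((hf.specialize N).mul (degreeLE_vandermonde N)) e ?_
    rw [← hp, ← coe_mul, coeff_coe]
    exact mem_support_iff.1 he
  set g : SymFun k := ∑ e ∈ q.support, coeff e q • jacobiTrudi N fun j => Polynomial.X ^ e j with hg
  have hgspan : g ∈ Submodule.span k (Set.range (schur k)) :=
    Submodule.sum_mem _ fun e _ => Submodule.smul_mem _ _ (jacobiTrudi_mem_span_schur _)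
  -- The degree gained by multiplying with the Vandermonde product is what the Jacobi–Trudi
  -- determinant subtracts again.
  have hgdeg : DegreeLE g.1 N := by
    have : g.1 = ∑ e ∈ q.support,
        coeff e q • (jacobiTrudi N fun j => (Polynomial.X : Polynomial k) ^ e j).1 := by
      rw [hg]
      push_cast
      rfl
    rw [this]
    refine DegreeLE.sum fun e he => ((degreeLE_jacobiTrudi _).mono ?_).smul _
    have := hqdeg e he
    rw [Finsupp.degree_eq_sum] at this
    rw [Finset.sum_neg_distrib]
    push_cast at this
    linarith
  have hspec : specialize k N (N.factorial • f) = specialize k N g := by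
    refine eq_of_mul_vandermonde_eq ?_
    have h := congrArg (coeToMvPowerSeries.ringHom (R := k)) (factorial_smul_eq_sum_alternant hqs)
    have hsm : ∀ (c : k) (r : MvPolynomial (Fin N) k),
        coeToMvPowerSeries.ringHom (c • r) = c • (r : MvPowerSeries (Fin N) k) := fun c r =>
      coe_smul r c
    rw [map_nsmul, map_sum, Finset.sum_congr rfl fun e _ => hsm _ _] at h
    rw [map_nsmul, ← hp, smul_mul_assoc, ← coe_mul, hg, map_sum, Finset.sum_mul]
    refine h.trans (Finset.sum_congr rfl fun e _ => ?_)
    rw [coe_alternant, map_smul, smul_mul_assoc]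
  have hfg : (N.factorial : k) • f - g = 0 := by
    refine eq_zero_of_specialize_eq_zero (n := N) ?_ ?_
    · have : ((N.factorial : k) • f - g).1 = (N.factorial : k) • f.1 + (-1 : k) • g.1 := by
        rw [neg_one_smul, ← sub_eq_add_neg]
        rfl
      rw [this]
      exact (hf.smul _).add (hgdeg.smul _)
    · rw [map_sub, Nat.cast_smul_eq_nsmul, hspec, sub_self]
  have h0 : (N.factorial : k) ≠ 0 := Nat.cast_ne_zero.2 N.factorial_ne_zero
  rw [sub_eq_zero] at hfg
  rw [← inv_smul_smul₀ h0 f, hfg]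
  exact Submodule.smul_mem _ _ hgspan

/-- A permutation carrying one strictly decreasing sequence to another is increasing, hence the
identity. -/
theorem coeff_alternant {e g : Fin n →₀ ℕ} (he : StrictAnti e) (hg : StrictAnti g) :
    coeff g (alternant k e) = if e = g then 1 else 0 := by
  classical
  have key : ∀ s : Equiv.Perm (Fin n), e.mapDomain s = g → s = 1 := fun s h => by
    have hs : StrictMono s := fun i j hij => by
      have := he hij
      rw [← Finsupp.mapDomain_apply s.injective e i, ← Finsupp.mapDomain_apply s.injective e j, h]
        at this
      exact hg.lt_iff_gt.1 this
    refine Equiv.ext fun i => ?_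
    have h1 := StrictMono.range_inj (f := s) (g := id) hs strictMono_id
    rw [Set.range_id, s.surjective.range_eq] at h1
    exact congrFun (h1.1 rfl) i
  rw [alternant_eq_sum, coeff_sum, Finset.sum_eq_single 1]
  · rw [Equiv.Perm.sign_one, one_smul, coeff_monomial, Equiv.Perm.coe_one, Finsupp.mapDomain_id]
  · intro s _ hs
    rw [Units.smul_def, coeff_smul, coeff_monomial, if_neg fun h => hs (key s h), smul_zero]
  · intro h
    exact absurd (Finset.mem_univ _) h

theorem shiftedParts_injOn {μ ν : YoungDiagram} (hμ : μ.colLen 0 ≤ n) (hν : ν.colLen 0 ≤ n)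
    (h : shiftedParts n μ = shiftedParts n ν) : μ = ν := by
  have h1 : ∀ i, μ.rowLen i = ν.rowLen i := fun i => by
    rcases Nat.lt_or_ge i n with hi | hi
    · exact Nat.add_right_cancel (DFunLike.congr_fun h ⟨i, hi⟩)
    · rw [rowLen_eq_zero (hμ.trans hi), rowLen_eq_zero (hν.trans hi)]
  refine YoungDiagram.ext (Finset.ext fun ⟨i, j⟩ => ?_)
  rw [YoungDiagram.mem_cells, YoungDiagram.mem_cells, YoungDiagram.mem_iff_lt_rowLen,
    YoungDiagram.mem_iff_lt_rowLen, h1]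

/-- The kernel of the specialization to `n` variables is `M_{n+1}`. -/
theorem mem_lengthFiltration_of_specialize_eq_zero [CharZero k] {f : SymFun k}
    (h : specialize k n f = 0) : f ∈ lengthFiltration k (n + 1) := by
  have hf : f ∈ Submodule.span k (Set.range (schur k)) := span_schur (k := k) ▸ Submodule.mem_top
  rw [Finsupp.mem_span_range_iff_exists_finsupp] at hf
  obtain ⟨c, rfl⟩ := hf
  classical
  -- After multiplication by the Vandermonde product, the coefficient at the exponent ν + (n-1, …,
  -- 0) picks out `c ν`: longer Schur functions specialize to zero, the others become alternants.
  have hc : ∀ ν : YoungDiagram, ν.colLen 0 ≤ n → c ν = 0 := by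
    intro ν hν
    have h1 : ∀ μ : YoungDiagram, MvPowerSeries.coeff (shiftedParts n ν)
        (specialize k n (schur k μ) * ((vandermonde k n : MvPolynomial (Fin n) k) : MvPowerSeries (Fin n) k)) =
          if μ = ν then 1 else 0 := by
      intro μ
      rcases Nat.lt_or_ge n (μ.colLen 0) with hμ | hμ
      · rw [specialize_schur_eq_zero n μ hμ, zero_mul, map_zero, if_neg]
        rintro rfl
        omega
      · rw [schur_eq_jacobiTrudi μ hμ]
        refine (congrArg _ (coe_alternant (shiftedParts n μ)).symm).trans ?_
        rw [coeff_coe, coeff_alternant (strictAnti_shiftedParts μ) (strictAnti_shiftedParts ν)]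
        exact if_congr ⟨shiftedParts_injOn hμ hν, congrArg _⟩ rfl rfl
    have h2 := congrArg (fun g => MvPowerSeries.coeff (shiftedParts n ν)
      (g * ((vandermonde k n : MvPolynomial (Fin n) k) : MvPowerSeries (Fin n) k))) h
    simp only [Finsupp.sum, map_sum, map_smul, Finset.sum_mul, smul_mul_assoc, h1, zero_mul,
      map_zero] at h2
    simpa using h2
  refine Submodule.sum_mem _ fun μ hμ => Submodule.smul_mem _ _ (Submodule.subset_span ⟨μ, ?_, rfl⟩)
  by_contra! h1
  exact Finsupp.mem_support_iff.1 hμ (hc μ (by omega))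

end Alternants

end

end StableGrothendieck

namespace StableGrothendieck

noncomputable section

/-! ### Elements of Λ̂ and their specializations. -/

section Completion

variable {k : Type*} [Field k] {n : ℕ}

theorem specializeHat_eq {F : SymFunHat k} {f : SymFun k}
    (h : F.1 (n + 1) = (lengthFiltration k (n + 1)).mkQ f) :
    specializeHat k n F = specialize k n f := by
  have hle : lengthFiltration k (n + 1) ≤ LinearMap.ker (specialize k n).toLinearMap := by
    rw [lengthFiltration, Submodule.span_le]
    rintro f ⟨μ, h, rfl⟩
    exact specialize_schur_eq_zero n μ h
  change Submodule.liftQ _ _ hle (F.1 (n + 1)) = _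
  rw [h, Submodule.mkQ_apply, Submodule.liftQ_apply]
  rfl

variable [CharZero k]

theorem apply_succ_eq_of_specializeHat_eq {F G : SymFunHat k}
    (h : specializeHat k n F = specializeHat k n G) : F.1 (n + 1) = G.1 (n + 1) := by
  obtain ⟨f, hf⟩ := Submodule.mkQ_surjective _ (F.1 (n + 1))
  obtain ⟨g, hg⟩ := Submodule.mkQ_surjective _ (G.1 (n + 1))
  rw [specializeHat_eq hf.symm, specializeHat_eq hg.symm, ← sub_eq_zero, ← map_sub] at h
  rw [← hf, ← hg, ← sub_eq_zero, ← map_sub, Submodule.mkQ_apply, Submodule.Quotient.mk_eq_zero]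
  exact mem_lengthFiltration_of_specialize_eq_zero h

/-- The specialization to n variables determines the component in Λ / M_{n+1}, and smaller
components are images of larger ones, so large n suffice. -/
theorem symFunHat_ext {F G : SymFunHat k} (l : ℕ)
    (h : ∀ n, l ≤ n → specializeHat k n F = specializeHat k n G) : F = G := by
  have h1 : ∀ j m, F.1 (m + j) = G.1 (m + j) → F.1 m = G.1 m := by
    intro j
    induction j with
    | zero => exact fun m hm => hm
    | succ j ih =>
      intro m hm
      refine ih m ?_
      rw [← F.2 (m + j), ← G.2 (m + j)]
      exact congrArg _ hm
  refine Subtype.ext (funext fun m => h1 (l + 1) m ?_)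
  exact apply_succ_eq_of_specializeHat_eq (h (m + l) (by omega))

/-- The element of `Λ̂` given by symmetric functions `f_0, f_1, …` with compatible
specializations. -/
def symFunHatOfSeq (f : ℕ → SymFun k)
    (h : ∀ n, specialize k n (f (n + 1)) = specialize k n (f n)) : SymFunHat k :=
  ⟨fun n => (lengthFiltration k n).mkQ (f n), fun n => by
    change (lengthFiltration k n).mkQ (f (n + 1)) = (lengthFiltration k n).mkQ (f n)
    rw [← sub_eq_zero, ← map_sub, Submodule.mkQ_apply, Submodule.Quotient.mk_eq_zero]
    refine lengthFiltration_succ_le n (mem_lengthFiltration_of_specialize_eq_zero ?_)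
    rw [map_sub, h, sub_self]⟩

end Completion

/-! ### Comparison of the two elements. -/

section Main

variable {k : Type*} [Field k]

/-- A symmetric function whose specialization to `n` variables is `G_μ(x_1, …, x_n)`. -/
def grothendieckSym (β : k) (μ : YoungDiagram) (n : ℕ) : SymFun k :=
  jacobiTrudi n fun j => Polynomial.X ^ (μ.rowLen j + (n - 1 - (j : ℕ))) *
    (1 + Polynomial.C β * Polynomial.X) ^ (j : ℕ)

theorem specialize_grothendieckSym_mul (β : k) (μ : YoungDiagram) (n : ℕ) :
    specialize k n (grothendieckSym β μ n) *
        ((vandermonde k n : MvPolynomial (Fin n) k) : MvPowerSeries (Fin n) k) =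
      (grothendieckNumerator β μ n : MvPolynomial (Fin n) k) := by
  rw [grothendieckSym, specialize_jacobiTrudi_mul]
  change _ = MvPolynomial.coeToMvPowerSeries.ringHom (grothendieckNumerator β μ n)
  rw [grothendieckNumerator, RingHom.map_det]
  congr 1
  ext1 i j
  simp only [Matrix.of_apply, RingHom.mapMatrix_apply, Matrix.map_apply, map_mul, map_pow, map_add,
    map_one, Polynomial.aeval_X, Polynomial.aeval_C,
    MvPolynomial.coeToMvPowerSeries.ringHom_apply, MvPolynomial.coe_X, MvPolynomial.coe_C]
  rfl

variable [CharZero k] {β : k}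

/-- In n variables both sides have the same product with the Vandermonde product, which is cancelled
in a domain; both are then restricted to m variables. -/
theorem specialize_grothendieckSym (hβ : β ≠ 0) (μ : YoungDiagram) {m n : ℕ} (hm : m ≤ n) (hn : μ.colLen 0 ≤ n) :
    specialize k m (grothendieckSym β μ n) = fermionicVEV β μ m := by
  rw [← killCompl_specialize hm, ← killCompl_fermionicVEV hm]
  congr 1
  refine eq_of_mul_vandermonde_eq ?_
  rw [specialize_grothendieckSym_mul]
  exact (fermionicVEV_mul_vandermonde hβ μ hn).symm

theorem exists_isFermionicVEV (hβ : β ≠ 0) (μ : YoungDiagram) :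
    ∃ G : SymFunHat k, IsFermionicVEV β μ G :=
  -- The maximum keeps the size of the determinant at least ℓ(μ), as the bialternant formula
  -- requires, even when fewer variables are specialized.
  ⟨symFunHatOfSeq (fun n => grothendieckSym β μ (max n (μ.colLen 0))) fun n => by
    rw [specialize_grothendieckSym hβ μ (le_max_of_le_left n.le_succ) (le_max_right _ _),
      specialize_grothendieckSym hβ μ (le_max_left _ _) (le_max_right _ _)], fun n => by
    rw [specializeHat_eq rfl]
    exact specialize_grothendieckSym hβ μ (le_max_of_le_left n.le_succ) (le_max_right _ _)⟩

/-- The quotient of alternants is unique among power series because the Vandermonde product is not a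
zero divisor, and it is a polynomial because it is the specialization of a symmetric function of
bounded degree. -/
theorem isStableGrothendieck_iff (hβ : β ≠ 0) (μ : YoungDiagram) (F : SymFunHat k) :
    IsStableGrothendieck β μ F ↔
    ∀ n, μ.colLen 0 ≤ n → specializeHat k n F = fermionicVEV β μ n := by
  refine forall₂_congr fun n hn => ?_
  rw [← specialize_grothendieckSym hβ μ le_rfl hn]
  have h := specialize_grothendieckSym_mul β μ n
  constructor
  · rintro ⟨g, hg, hF⟩
    rw [IsGrothendieckPolynomial] at hg
    rw [← hg, MvPolynomial.coe_mul] at h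
    rw [hF, eq_of_mul_vandermonde_eq h]
  · intro hF
    obtain ⟨g, hg⟩ := exists_mvPolynomial_eq_specialize n (grothendieckSym β μ n)
    refine ⟨g, MvPolynomial.coe_injective _ _ ?_, hF.trans hg.symm⟩
    rw [MvPolynomial.coe_mul, hg, h]

end Main

end

end StableGrothendieck

open StableGrothendieck

theorem theorem3 (μ : YoungDiagram) :
    ∃ G : SymFunHat (RatFunc ℂ),
      IsStableGrothendieck (RatFunc.X : RatFunc ℂ) μ G ∧
      IsFermionicVEV (RatFunc.X : RatFunc ℂ) μ G ∧
      (∀ F : SymFunHat (RatFunc ℂ), IsStableGrothendieck RatFunc.X μ F → F = G) ∧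
      (∀ F : SymFunHat (RatFunc ℂ), IsFermionicVEV RatFunc.X μ F → F = G) := by
  have hβ : (RatFunc.X : RatFunc ℂ) ≠ 0 := RatFunc.X_ne_zero
  obtain ⟨G, hG⟩ := exists_isFermionicVEV hβ μ
  refine ⟨G, (isStableGrothendieck_iff hβ μ G).2 fun n _ => hG n, hG, fun F hF => ?_, fun F hF => ?_⟩
  · rw [isStableGrothendieck_iff hβ] at hF
    exact symFunHat_ext (μ.colLen 0) fun n hn => (hF n hn).trans (hG n).symm
  · exact symFunHat_ext 0 fun n _ => (hF n).trans (hG n).symm
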